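/- **Setting.** Let $s\ge 1$ and let an explicit $S$-stage Runge–Kutta integrator be given by coefficients $a_{ij}$ ($j<i$), $b_i$: for a vector field $G$, $g_i=\zeta+h\sum_{j<i}a_{ij}G(g_j)$ and $\Phi_h(\zeta)=\zeta+h\sum_{i=1}^S b_iG(g_i)$. Assume that it has order $s$: for sufficiently smooth $G$ ($C^{s+1}$ near $\zeta_0$), on any finite-dimensional space, $\|\Phi_h(\zeta_0)-\Psi(h)\|=O(h^{s+1})$ as $h\to0$, where $\Psi'=G(\Psi)$, $\Psi(0)=\zeta_0$. Let $\mathcal G$ be a connected simple graph on $n\ge2$ nodes with Laplacian $L$, let $p\ge1$, $\mathbf L=L\otimes I_p$, let $\sqrt{\mathbf L}$ be its positive semidefinite square root, $\lambda_{\max}$ its largest and $\lambda^+_{\min}$ its smallest positive eigenvalue. Let $f_1,\dots,f_n:\mathbb R^p\to\mathbb R$ be $\mu$-strongly convex, $\mu>0$, let $F(\mathbf x)=\sum_i f_i(x_i)$ for $\mathbf x=[x_1;\dots;x_n]\in\mathbb R^{np}$, let $x^*$ be the minimizer of $\sum_i f_i$ on $\mathbb R^p$ and $\mathbf x^*=[x^*;\dots;x^*]$.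 Put $$\mathbf x^*(\mathbf z)=\arg\max_{\mathbf x}\{\langle \mathbf z,\mathbf x\rangle-F(\mathbf x)\},\qquad \varphi(\mathbf y)=\max_{\mathbf x}\{\langle \mathbf y,\sqrt{\mathbf L}\mathbf x\rangle-F(\mathbf x)\},$$ $$\mathcal E=e\Big[\frac{\|\nabla F(\mathbf x^*)\|^2}{\lambda^+_{\min}}+\min_{\mathbf L\mathbf x=0}F-\min F\Big]+1,\qquad \rho=\frac{\sqrt{2\mathcal E\lambda_{\max}}}{\mu},\qquad \mathcal B=\{\mathbf x:\|\mathbf x-\mathbf x^*\|\le\rho\}.$$ Assume that $F$ is $s+2$ times continuously differentiable on $\mathcal B$ and that each $f_i$ is $M$-Lipschitz on $\{x\in\mathbb R^p:\|x-x^*\|\le\rho\}$, the set swept by the blocks of the points of $\mathcal B$ (this holds if $F$ is $M$-Lipschitz on $\mathcal B$). **Algorithm.** For $N\ge1$ let $h=h_0/N^{1/(s+1)}$. Agent $i$ keeps $\xi^i=[\hat v^i;\hat y^i;t^i]\in\mathbb R^{2p+1}$, started at $[0;0;1]$, and all agents perform $N$ steps of the integrator with step size $h$ for the field whose $i$-th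 component is $$\Big[-\tfrac5{t^i}\hat v^i-4\sum_jL_{ij}x_j^*(\hat y^j);\ \hat v^i;\ 1\Big],\qquad x_j^*(z)=\arg\max_x\{\langle z,x\rangle-f_j(x)\}.$$ Let $[\mathbf v_N;\mathbf y_N;t_N]$ be the $N$-th iterate of the same integrator, with the same $h$ and started at $[\mathbf 0;\mathbf 0;1]$, for the heavy-ball system $G(\mathbf v,\mathbf y,t)=[-\frac5t\mathbf v-4\sqrt{\mathbf L}\,\mathbf x^*(\sqrt{\mathbf L}\mathbf y);\mathbf v;1]$, and let $\mathbf x_N=\mathbf x^*(\sqrt{\mathbf L}\mathbf y_N)$. **Constants.** Say that $K$ dominates the problem if $K\ge\mathcal E$, $\mu\le K\lambda_{\max}$, and $\|\nabla^j\varphi(\mathbf y)\|\le K$ for $3\le j\le s+2$ and all $\mathbf y$ with $\|\mathbf x^*(\sqrt{\mathbf L}\mathbf y)-\mathbf x^*\|<\rho$. **Theorem.** There are functions $C(K)$ and $h_0(K,\mu,\lambda_{\max})>0$ (for positive arguments), depending only on $s$ and on the integrator, such that every problem as above is dominated by some finite $K$, and for every dominating $K$ and every $N\ge1$, with $h_0=h_0(K,\mu,\lambda_{\max})$: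 after $N$ iterations the state of agent $i$ consists of the $i$-th blocks of $\sqrt{\mathbf L}\mathbf v_N$ and $\sqrt{\mathbf L}\mathbf y_N$ and of $t_N$, and $$\text{(i)}\quad \|\sqrt{\mathbf L}\,\mathbf x_N\|^2\le C(K)\,\frac{\lambda_{\max}^3}{\mu^3}\,S\,N^{-2s/(s+1)},$$ $$\text{(ii)}\quad \frac1n\|\mathbf x_N-\mathbf x^*\|^2\le C(K)\,\frac{\lambda_{\max}^2}{n\mu^3}\,S\,N^{-2s/(s+1)},$$ $$\text{(iii)}\quad \frac1n\,[F(\mathbf x_N)-F(\mathbf x^*)]\le C(K)\,\sqrt{\frac{S\lambda_{\max}^3}{n^2\mu^3\lambda^+_{\min}}}\;M\,N^{-s/(s+1)}.$$ -/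

import Mathlib

open scoped Kronecker Topology MatrixOrder InnerProductSpace

noncomputable section

namespace HeavyBall

/-! ### Explicit Runge-Kutta integrators -/

/-- Coefficients of an explicit `S`-stage Runge-Kutta method (only the entries `a i j` with `j < i`
are ever used). -/
structure ExplicitRK (S : ℕ) where
  a : Fin S → Fin S → ℝ
  b : Fin S → ℝ

namespace ExplicitRK

variable {S : ℕ} {Z : Type*} [AddCommGroup Z] [Module ℝ Z]

/-- The stages `g_i = z + h ∑_{j < i} a_{ij} G(g_j)`. -/
def stage (rk : ExplicitRK S) (G : Z → Z) (h : ℝ) (z : Z) (i : Fin S) : Z :=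
  z + h • ∑ j : Fin i.val, rk.a i ⟨j.val, j.isLt.trans i.isLt⟩ •
    G (stage rk G h z ⟨j.val, j.isLt.trans i.isLt⟩)
termination_by i.val
decreasing_by exact j.isLt

/-- One step `Φ_h(z) = z + h ∑_i b_i G(g_i)`. -/
def step (rk : ExplicitRK S) (G : Z → Z) (h : ℝ) (z : Z) : Z :=
  z + h • ∑ i : Fin S, rk.b i • G (rk.stage G h z i)

/-- The integrator has order `s`: for every sufficiently smooth vector field near `z₀` on a
finite-dimensional space, and every solution `Ψ` of `Ψ' = G(Ψ)`, `Ψ 0 = z₀` near time `0`, one has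
`‖Φ_h(z₀) - Ψ(h)‖ = O(h^{s+1})` as `h → 0`. -/
def HasOrder (rk : ExplicitRK S) (s : ℕ) : Prop :=
  ∀ (Z : Type) [NormedAddCommGroup Z] [NormedSpace ℝ Z] [FiniteDimensional ℝ Z]
    (G : Z → Z) (z₀ : Z) (Ψ : ℝ → Z),
    ContDiffAt ℝ ((s + 1 : ℕ) : WithTop ℕ∞) G z₀ → Ψ 0 = z₀ →
    (∀ᶠ t in 𝓝 (0 : ℝ), HasDerivAt Ψ (G (Ψ t)) t) →
    (fun h : ℝ => rk.step G h z₀ - Ψ h) =O[𝓝 0] fun h : ℝ => h ^ (s + 1)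

end ExplicitRK

/-! ### The distributed problem -/

/-- The space `ℝ^p` of a local variable. -/
abbrev Loc (p : ℕ) := EuclideanSpace ℝ (Fin p)

/-- The space `ℝ^{np}` of stacked variables `[x_1; …; x_n]`. -/
abbrev Stk (n p : ℕ) := EuclideanSpace ℝ (Fin n × Fin p)

variable {n p : ℕ}

/-- The `i`-th block `x_i ∈ ℝ^p` of `x ∈ ℝ^{np}`. -/
def block (x : Stk n p) (i : Fin n) : Loc p := WithLp.toLp 2 fun j => x (i, j)

/-- The consensus vector `[x; …; x]`. -/
def consensus (n : ℕ) {p : ℕ} (x : Loc p) : Stk n p := WithLp.toLp 2 fun ij => x ij.2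

/-- `F(x) = ∑_i f_i(x_i)`. -/
def F (f : Fin n → Loc p → ℝ) (x : Stk n p) : ℝ := ∑ i, f i (block x i)

/-- A maximizer of `⟨z, x⟩ - g(x)` over `x` (unique, hence "the" maximizer, when `g` is strongly
convex on a finite-dimensional space). -/
def argmaxConj {E : Type*} [NormedAddCommGroup E] [InnerProductSpace ℝ E] (g : E → ℝ) (z : E) : E :=
  Classical.epsilon fun x => ∀ x', ⟪z, x'⟫_ℝ - g x' ≤ ⟪z, x⟫_ℝ - g x

/-- `𝐱*(z) = argmax_x ⟨z, x⟩ - F(x)` on `ℝ^{np}`. -/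
def xStar (f : Fin n → Loc p → ℝ) (z : Stk n p) : Stk n p := argmaxConj (F f) z

section graph

variable (G : SimpleGraph (Fin n)) [DecidableRel G.Adj] (p)

/-- `𝐋 = L ⊗ I_p`, with `L` the Laplacian matrix of the graph. -/
def bigLap : Matrix (Fin n × Fin p) (Fin n × Fin p) ℝ :=
  G.lapMatrix ℝ ⊗ₖ (1 : Matrix (Fin p) (Fin p) ℝ)

/-- `√𝐋`, the positive semidefinite square root, as an operator on `ℝ^{np}`. -/
def sqrtLap : Stk n p →L[ℝ] Stk n p :=
  Matrix.toEuclideanCLM (𝕜 := ℝ) (CFC.sqrt (bigLap p G))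

/-- The largest eigenvalue of `𝐋`. -/
def lamMax : ℝ := sSup (spectrum ℝ (bigLap p G))

/-- The smallest positive eigenvalue of `𝐋`. -/
def lamMin : ℝ := sInf {l | l ∈ spectrum ℝ (bigLap p G) ∧ 0 < l}

end graph

section dual

variable (G : SimpleGraph (Fin n)) [DecidableRel G.Adj] (f : Fin n → Loc p → ℝ)

/-- The dual function `φ(y) = max_x ⟨y, √𝐋 x⟩ - F(x)`. -/
def dual (y : Stk n p) : ℝ := ⨆ x : Stk n p, (⟪y, sqrtLap p G x⟫_ℝ - F f x)

/-- `ℰ = e (‖∇F(𝐱*)‖² / λ⁺_min + min_{𝐋x = 0} F - min F) + 1`, where `xs` is the minimizer of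
`∑ f_i` and `𝐱* = [xs; …; xs]`. -/
def energy (xs : Loc p) : ℝ :=
  Real.exp 1 * (‖gradient (F f) (consensus n xs)‖ ^ 2 / lamMin p G
    + ((⨅ x : {x : Stk n p // Matrix.toEuclideanCLM (𝕜 := ℝ) (bigLap p G) x = 0}, F f x)
      - ⨅ x : Stk n p, F f x)) + 1

/-- The radius `√(2ℰ λ_max) / μ` of the compact set `𝓑`. -/
def radius (μ : ℝ) (xs : Loc p) : ℝ := √(2 * energy G f xs * lamMax p G) / μ

/-- The compact set `𝓑 = {x | ‖x - 𝐱*‖ ≤ √(2ℰ λ_max) / μ}` of `ℝ^{np}`. -/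
def setB (μ : ℝ) (xs : Loc p) : Set (Stk n p) :=
  Metric.closedBall (consensus n xs) (radius G f μ xs)

/-- The compact set swept in `ℝ^p` by the local variables `x_i` when `x` ranges over `𝓑`
(a ball around `xs` of the same radius). -/
def locB (μ : ℝ) (xs : Loc p) : Set (Loc p) :=
  Metric.closedBall xs (radius G f μ xs)

/-- `K` dominates the quantities of a problem that the `O(·)` notation treats as constants: `ℰ`, the
ratio `μ / λ_max`, and the derivatives of orders `3, …, s + 2` of the dual function at the dual
points whose primal point is interior to `𝓑`. -/
def Dominates (s : ℕ) (μ : ℝ) (xs : Loc p) (K : ℝ) : Prop :=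
  energy G f xs ≤ K ∧ μ ≤ K * lamMax p G ∧
    ∀ j : ℕ, 3 ≤ j → j ≤ s + 2 → ∀ y : Stk n p,
      ‖xStar f (sqrtLap p G y) - consensus n xs‖ < radius G f μ xs →
        ‖iteratedFDeriv ℝ j (dual G f) y‖ ≤ K

/-! ### The heavy-ball system and the algorithm -/

/-- The vector field `[-(5/t) v - 4 √𝐋 𝐱*(√𝐋 y); v; 1]` at `ζ = [v; y; t]`. -/
def dualField (ζ : Stk n p × Stk n p × ℝ) : Stk n p × Stk n p × ℝ :=
  (-((5 / ζ.2.2) • ζ.1) - (4 : ℝ) • sqrtLap p G (xStar f (sqrtLap p G ζ.2.1)), ζ.1, 1)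

/-- The Runge-Kutta iterates `ζ_k = [v_k; y_k; t_k]`, started at `[0; 0; 1]`. -/
def dualIter {S : ℕ} (rk : ExplicitRK S) (h : ℝ) (k : ℕ) : Stk n p × Stk n p × ℝ :=
  (rk.step (dualField G f) h)^[k] (0, 0, 1)

/-- The distributed field: the component of agent `i` at `ξ_i = [v̂_i; ŷ_i; t_i]` is
`[-(5/t_i) v̂_i - 4 ∑_j L_{ij} x*_j(ŷ_j); v̂_i; 1]`, with `x*_j(z) = argmax_x ⟨z, x⟩ - f_j(x)` computed
by agent `j`. -/
def agentField (ξ : Fin n → Loc p × Loc p × ℝ) : Fin n → Loc p × Loc p × ℝ := fun i =>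
  (-((5 / (ξ i).2.2) • (ξ i).1)
      - (4 : ℝ) • ∑ j, G.lapMatrix ℝ i j • argmaxConj (f j) (ξ j).2.1, (ξ i).1, 1)

/-- The iterates of the distributed algorithm, every agent starting at `[0; 0; 1]`. -/
def algIter {S : ℕ} (rk : ExplicitRK S) (h : ℝ) (k : ℕ) : Fin n → Loc p × Loc p × ℝ :=
  (rk.step (agentField G f) h)^[k] fun _ => (0, 0, 1)

end dual

end HeavyBall

end

/-!
The dual function `φ` is convex with minimal value `-F(𝐱*)`, its gradient `√𝐋 𝐱*(√𝐋 y)` is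
`R`-Lipschitz for `R = λ_max / μ`, and the heavy-ball system `y'' + (5/t) y' + 4 ∇φ(y) = 0` has the
Lyapunov function (`lyap`)

  `t²/16 ‖v‖² + ‖y + (t/4) v - y*‖² + t² (φ(y) - φ(y*))`,

which decreases along exact solutions (`SmoothConvex.lyap_antitone`) and is at most `ℰ - 1` at the
start, for the dual solution `y*` orthogonal to the kernel of `√𝐋`. If it stays below `ℰ` along the
iterates, then `φ(y_N) - φ(y*) ≤ ℰ / t_N²`, and `t_N = 1 + N h` is of order `R^{-1/2} N^{s/(s+1)}`.

It stays below `ℰ` because the local errors do not add up to more than `1/2`. In the natural scaling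
`V = t₀ v`, `Q = √R t₀ (y - y₀)`, with time `√R t` (`scaledField`), the field has, near every state
of energy below `ℰ`, derivatives bounded in terms of `K` only
(`exists_boundedDerivs_scaledField`). Runge-Kutta steps commute with affine changes of
variables (`ExplicitRK.map_step`), so one step in the original variables is one of step size `√R h`
in the scaled ones. Its error is at most `C (√R h)^{s+1}` with `C` depending on the method and on
the bounds alone (`exists_local_error_bound`): the order condition, which is not uniform in the
field, makes the Taylor coefficients of the error up to order `s` vanish, and the derivative of
order `s + 1` is bounded uniformly. With `√R h = c N^{-1/(s+1)}`, the `N` errors sum to at most a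
constant times `c^{s+1}` (`exists_lyap_iterate_le`).

The rates follow by duality: `‖∇φ‖² ≤ 2 R (φ - φ(y*))`; strong convexity gives
`μ/2 ‖𝐱 - 𝐱*‖² ≤ φ - φ(y*)`; and `F(𝐱) - F(𝐱*) ≤ ⟨y, √𝐋 𝐱⟩`. The last rate involves `M`, which
strong convexity on a ball of radius `ρ` forces to be at least `√(λ⁺_min / 2)`
(`IsProblem.lamMin_le_lipschitz`). A finite `K` exists since `D 𝐱* = (D²F)⁻¹ ∘ 𝐱*` bounds the
derivatives of `φ` order by order (`exists_boundedDerivs_argmaxConj`). Finally, `√𝐋` maps the dual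
field to the field of the agents, so that the linear invariance of Runge-Kutta steps gives
the claim on the states of the agents (`algIter_eq`).
-/

noncomputable section

namespace HeavyBall

/-! ### Maps with uniformly bounded derivatives -/

section BoundedDerivs

variable {D E F' G' : Type*} [NormedAddCommGroup D] [NormedSpace ℝ D]
  [NormedAddCommGroup E] [NormedSpace ℝ E] [NormedAddCommGroup F'] [NormedSpace ℝ F']
  [NormedAddCommGroup G'] [NormedSpace ℝ G']

/-- `f` is `C^m` on `U`, and `A` bounds the norms of its derivatives of orders `0, …, m` there.
The derivatives are those of the ambient space, so the notion is only used for open `U`. -/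
structure BoundedDerivs (m : ℕ) (A : ℝ) (f : E → F') (U : Set E) : Prop where
  contDiffOn : ContDiffOn ℝ m f U
  norm_le : ∀ j ≤ m, ∀ x ∈ U, ‖iteratedFDeriv ℝ j f x‖ ≤ A

namespace BoundedDerivs

variable {m : ℕ} {A B : ℝ} {f g : E → F'} {U : Set E}

lemma mono (h : BoundedDerivs m A f U) (hAB : A ≤ B) : BoundedDerivs m B f U :=
  ⟨h.contDiffOn, fun j hj x hx => (h.norm_le j hj x hx).trans hAB⟩

lemma of_le (h : BoundedDerivs m A f U) {k : ℕ} (hk : k ≤ m) : BoundedDerivs k A f U :=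
  ⟨h.contDiffOn.of_le (by exact_mod_cast hk), fun j hj x hx => h.norm_le j (hj.trans hk) x hx⟩

lemma norm_apply_le (h : BoundedDerivs m A f U) {x : E} (hx : x ∈ U) : ‖f x‖ ≤ A := by
  simpa using h.norm_le 0 (Nat.zero_le _) x hx

lemma norm_fderiv_le (h : BoundedDerivs (m + 1) A f U) {x : E} (hx : x ∈ U) :
    ‖fderiv ℝ f x‖ ≤ A := by
  have := h.norm_le 1 (by omega) x hx
  rwa [← norm_iteratedFDeriv_fderiv, norm_iteratedFDeriv_zero] at this

lemma congr (hU : IsOpen U) (h : BoundedDerivs m A f U) (hfg : Set.EqOn g f U) :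
    BoundedDerivs m A g U := by
  refine ⟨h.contDiffOn.congr hfg, fun j hj x hx => ?_⟩
  have : g =ᶠ[𝓝 x] f := Filter.eventuallyEq_of_mem (hU.mem_nhds hx) hfg
  rw [(this.iteratedFDeriv ℝ j).eq_of_nhds]
  exact h.norm_le j hj x hx

lemma contDiffAt (hU : IsOpen U) (h : BoundedDerivs m A f U) {x : E} (hx : x ∈ U) :
    ContDiffAt ℝ m f x := h.contDiffOn.contDiffAt (hU.mem_nhds hx)

lemma differentiableAt (hU : IsOpen U) (h : BoundedDerivs (m + 1) A f U) {x : E} (hx : x ∈ U) :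
    DifferentiableAt ℝ f x :=
  (h.contDiffAt hU hx).differentiableAt (by simp)

lemma const (c : F') (hc : ‖c‖ ≤ A) : BoundedDerivs m A (fun _ : E => c) U := by
  refine ⟨contDiffOn_const, fun j _ x _ => ?_⟩
  rcases Nat.eq_zero_or_pos j with rfl | hj
  · simpa using hc
  · rw [iteratedFDeriv_const_of_ne hj.ne']
    simpa using (norm_nonneg c).trans hc

/-- A bounded map whose derivative is `C^m` with bounded derivatives is `C^{m+1}` with bounded
derivatives. -/
lemma of_hasFDerivAt (hU : IsOpen U) {f' : E → E →L[ℝ] F'} (h : BoundedDerivs m A f' U)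
    (hf : ∀ x ∈ U, HasFDerivAt f (f' x) x) (hA : ∀ x ∈ U, ‖f x‖ ≤ A) :
    BoundedDerivs (m + 1) A f U := by
  have hfd : BoundedDerivs m A (fderiv ℝ f) U := h.congr hU fun x hx => (hf x hx).fderiv
  refine ⟨?_, fun j hj x hx => ?_⟩
  · have := (contDiffOn_succ_iff_fderiv_of_isOpen (𝕜 := ℝ) (f := f) (n := (m : WithTop ℕ∞)) hU).2
      ⟨fun x hx => (hf x hx).differentiableAt.differentiableWithinAt, by simp, hfd.contDiffOn⟩
    exact_mod_cast this
  · cases j with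
    | zero => simpa using hA x hx
    | succ j =>
      rw [← norm_iteratedFDeriv_fderiv]
      exact hfd.norm_le j (by omega) x hx

lemma clm_comp (hU : IsOpen U) (L : F' →L[ℝ] G') (h : BoundedDerivs m A f U) :
    BoundedDerivs m (‖L‖ * A) (fun x => L (f x)) U := by
  refine ⟨L.contDiff.comp_contDiffOn h.contDiffOn, fun j hj x hx => ?_⟩
  refine (L.norm_iteratedFDeriv_comp_left (h.contDiffAt hU hx) (by exact_mod_cast hj)).trans ?_
  exact mul_le_mul_of_nonneg_left (h.norm_le j hj x hx) (norm_nonneg _)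

/-- A continuous linear map, on a set on which it is bounded. -/
lemma clm (L : E →L[ℝ] F') (hL : ‖L‖ ≤ A) (hA : ∀ x ∈ U, ‖L x‖ ≤ A) (hU : IsOpen U) :
    BoundedDerivs m A L U := by
  have := (const (m := m) (U := U) L hL).of_hasFDerivAt (f := L) hU
    (fun x _ => L.hasFDerivAt) hA
  exact this.of_le (Nat.le_succ m)

lemma add (hU : IsOpen U) (hf : BoundedDerivs m A f U) (hg : BoundedDerivs m B g U) :
    BoundedDerivs m (A + B) (fun x => f x + g x) U := by
  refine ⟨hf.contDiffOn.add hg.contDiffOn, fun j hj x hx => ?_⟩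
  have h1 := (hf.contDiffAt hU hx).of_le (m := (j : WithTop ℕ∞)) (by exact_mod_cast hj)
  have h2 := (hg.contDiffAt hU hx).of_le (m := (j : WithTop ℕ∞)) (by exact_mod_cast hj)
  rw [fun_iteratedFDeriv_add_apply h1 h2]
  exact (norm_add_le _ _).trans (add_le_add (hf.norm_le j hj x hx) (hg.norm_le j hj x hx))

lemma const_smul (hU : IsOpen U) (c : ℝ) (hf : BoundedDerivs m A f U) :
    BoundedDerivs m (|c| * A) (fun x => c • f x) U := by
  refine ⟨hf.contDiffOn.const_smul c, fun j hj x hx => ?_⟩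
  have h1 := (hf.contDiffAt hU hx).of_le (m := (j : WithTop ℕ∞)) (by exact_mod_cast hj)
  rw [iteratedFDeriv_const_smul_apply' h1, norm_smul, Real.norm_eq_abs]
  exact mul_le_mul_of_nonneg_left (hf.norm_le j hj x hx) (abs_nonneg _)

lemma sum (hU : IsOpen U) {ι : Type*} (u : Finset ι) {f : ι → E → F'} {A : ι → ℝ}
    (hf : ∀ i ∈ u, BoundedDerivs m (A i) (f i) U) :
    BoundedDerivs m (∑ i ∈ u, A i) (fun x => ∑ i ∈ u, f i x) U := by
  classical
  induction u using Finset.induction with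
  | empty => simpa using const (m := m) (U := U) (0 : F') (by simp)
  | insert a u ha ih =>
    simp only [Finset.sum_insert ha]
    exact (hf a (by simp)).add hU (ih fun i hi => hf i (by simp [hi]))

lemma prodMk (hU : IsOpen U) {g : E → G'} (hf : BoundedDerivs m A f U)
    (hg : BoundedDerivs m B g U) :
    BoundedDerivs m (‖ContinuousLinearMap.inl ℝ F' G'‖ * A + ‖ContinuousLinearMap.inr ℝ F' G'‖ * B)
      (fun x => (f x, g x)) U := by
  refine ((hf.clm_comp hU (ContinuousLinearMap.inl ℝ F' G')).add hU
    (hg.clm_comp hU (ContinuousLinearMap.inr ℝ F' G'))).congr hU fun x _ => ?_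
  simp

lemma prodMk' (hU : IsOpen U) {g : E → G'} (hf : BoundedDerivs m A f U)
    (hg : BoundedDerivs m B g U) (hA : 0 ≤ A) (hB : 0 ≤ B) :
    BoundedDerivs m (A + B) (fun x => (f x, g x)) U := by
  refine (hf.prodMk hU hg).mono (add_le_add ?_ ?_)
  · exact mul_le_of_le_one_left hA (ContinuousLinearMap.norm_inl_le_one ℝ F' G')
  · exact mul_le_of_le_one_left hB (ContinuousLinearMap.norm_inr_le_one ℝ F' G')

lemma bilinear (hU : IsOpen U) (L : F' →L[ℝ] G' →L[ℝ] D) {g : E → G'} (hB : 0 ≤ B)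
    (hf : BoundedDerivs m A f U) (hg : BoundedDerivs m B g U) :
    BoundedDerivs m (‖L‖ * (2 ^ m * A * B)) (fun x => L (f x) (g x)) U := by
  refine ⟨L.isBoundedBilinearMap.contDiff.comp_contDiffOn (hf.contDiffOn.prodMk hg.contDiffOn),
    fun j hj x hx => ?_⟩
  have hA : 0 ≤ A := (norm_nonneg _).trans (hf.norm_apply_le hx)
  have hjm : (j : WithTop ℕ∞) ≤ m := by exact_mod_cast hj
  have := L.norm_iteratedFDerivWithin_le_of_bilinear hf.contDiffOn hg.contDiffOn
    hU.uniqueDiffOn hx hjm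
  rw [iteratedFDerivWithin_of_isOpen j hU hx] at this
  refine this.trans (mul_le_mul_of_nonneg_left ?_ (norm_nonneg L))
  calc _ ≤ ∑ i ∈ Finset.range (j + 1), (j.choose i : ℝ) * A * B := by
        refine Finset.sum_le_sum fun i hi => ?_
        have hi' := Finset.mem_range_succ_iff.1 hi
        rw [iteratedFDerivWithin_of_isOpen i hU hx, iteratedFDerivWithin_of_isOpen (j - i) hU hx]
        have h1 := hf.norm_le i (hi'.trans hj) x hx
        have h2 := hg.norm_le (j - i) (by omega) x hx
        gcongr
    _ = 2 ^ j * A * B := by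
        rw [← Finset.sum_mul, ← Finset.sum_mul]
        congr 2
        exact_mod_cast Nat.sum_range_choose j
    _ ≤ 2 ^ m * A * B := by gcongr; norm_num

/-- Composition; the bound is Faà di Bruno's, in the crude form that suffices for uniformity. -/
lemma comp (hU : IsOpen U) {W : Set F'} (hW : IsOpen W) {g : F' → G'} (hA : 0 ≤ A)
    (hg : BoundedDerivs m A g W) (hf : BoundedDerivs m B f U) (hm : Set.MapsTo f U W) :
    BoundedDerivs m (m.factorial * A * (max 1 B) ^ m) (fun x => g (f x)) U := by
  refine ⟨hg.contDiffOn.comp hf.contDiffOn hm, fun j hj x hx => ?_⟩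
  have h1 : (1 : ℝ) ≤ max 1 B := le_max_left _ _
  have hjm : (j : WithTop ℕ∞) ≤ m := by exact_mod_cast hj
  have := norm_iteratedFDerivWithin_comp_le (n := j) (N := (m : WithTop ℕ∞)) hg.contDiffOn
    hf.contDiffOn hjm hW.uniqueDiffOn hU.uniqueDiffOn hm hx (C := A) (D := max 1 B)
    (fun i hi => by
      rw [iteratedFDerivWithin_of_isOpen i hW (hm hx)]
      exact hg.norm_le i (hi.trans hj) _ (hm hx))
    (fun i hi1 hi => by
      rw [iteratedFDerivWithin_of_isOpen i hU hx]
      refine (hf.norm_le i (hi.trans hj) _ hx).trans ((le_max_right 1 B).trans ?_)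
      exact le_self_pow₀ h1 (by omega))
  rw [iteratedFDerivWithin_of_isOpen j hU hx] at this
  refine this.trans ?_
  have : (j.factorial : ℝ) ≤ m.factorial := by exact_mod_cast Nat.factorial_le hj
  gcongr

end BoundedDerivs

end BoundedDerivs

/-! ### Runge-Kutta steps under affine changes of variables -/

namespace ExplicitRK

section affine

variable {S : ℕ} (rk : ExplicitRK S) {Z Z' : Type*} [AddCommGroup Z] [Module ℝ Z]
  [AddCommGroup Z'] [Module ℝ Z'] {T : Z → Z'} {l : Z →ₗ[ℝ] Z'} {G : Z → Z} {G' : Z' → Z'}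
  {h h' : ℝ}

lemma map_stage (hT : ∀ z w, T (z + w) = T z + l w) (hG : ∀ z, h' • G' (T z) = h • l (G z))
    (z : Z) (i : Fin S) : T (rk.stage G h z i) = rk.stage G' h' (T z) i := by
  obtain ⟨i, hi⟩ := i
  induction i using Nat.strong_induction_on with
  | _ i ih =>
    rw [stage, stage, hT, map_smul, map_sum, Finset.smul_sum, Finset.smul_sum]
    congr 1
    refine Finset.sum_congr rfl fun j _ => ?_
    rw [map_smul, smul_comm h, smul_comm h', ← ih j.val j.isLt (j.isLt.trans hi), hG]

/-- Runge-Kutta steps commute with an affine map `T` of linear part `l` that carries one field,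
scaled by its step size, to the other. -/
lemma map_step (hT : ∀ z w, T (z + w) = T z + l w) (hG : ∀ z, h' • G' (T z) = h • l (G z))
    (z : Z) : T (rk.step G h z) = rk.step G' h' (T z) := by
  rw [step, step, hT, map_smul, map_sum, Finset.smul_sum, Finset.smul_sum]
  congr 1
  refine Finset.sum_congr rfl fun i _ => ?_
  rw [map_smul, smul_comm h, smul_comm h', ← rk.map_stage hT hG, hG]

end affine

/-! ### Consistency -/

section consistency

variable {S : ℕ} {rk : ExplicitRK S} {s : ℕ}

lemma step_const {Z : Type*} [AddCommGroup Z] [Module ℝ Z] (rk : ExplicitRK S) (c : Z) (h : ℝ)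
    (z : Z) : rk.step (fun _ => c) h z = z + (h * ∑ i, rk.b i) • c := by
  rw [step, ← Finset.sum_smul, smul_smul]

/-- A method of order at least one is consistent: apply the order condition to `Ψ' = 1`. -/
lemma HasOrder.sum_b (hrk : rk.HasOrder s) (hs : 1 ≤ s) : ∑ i, rk.b i = 1 := by
  have h1 := hrk ℝ (fun _ => 1) 0 (fun t => t) contDiffAt_const rfl
    (Filter.Eventually.of_forall fun t => hasDerivAt_id' t)
  have h2 : (fun h : ℝ => h ^ (s + 1)) =o[𝓝 0] fun h : ℝ => h := by
    have := Asymptotics.isLittleO_pow_pow (𝕜 := ℝ) (m := 1) (n := s + 1) (by omega)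
    simpa using this
  have h3 := h1.trans_isLittleO h2
  have h4 : (fun h : ℝ => rk.step (fun _ => (1 : ℝ)) h 0 - h)
      = fun h => (∑ i, rk.b i - 1) * h := by
    funext h
    rw [step_const]
    simp
    ring
  rw [h4] at h3
  by_contra hne
  have hne' : ∑ i, rk.b i - 1 ≠ 0 := sub_ne_zero.2 hne
  have h5 : (fun h : ℝ => h) =o[𝓝 0] fun h : ℝ => h :=
    (Asymptotics.isLittleO_const_mul_left_iff hne').1 h3
  have hfreq : ∃ᶠ x : ℝ in 𝓝[≠] 0, x ≠ 0 :=
    Filter.Eventually.frequently (eventually_mem_nhdsWithin)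
  exact Asymptotics.isLittleO_irrefl (hfreq.filter_mono nhdsWithin_le_nhds) h5

lemma HasOrder.stages_pos (hrk : rk.HasOrder s) (hs : 1 ≤ s) : 1 ≤ S := by
  rcases Nat.eq_zero_or_pos S with rfl | h
  · have := hrk.sum_b hs
    simp at this
  · exact h

end consistency

/-! ### Uniform bounds on one Runge-Kutta step -/

section bounds

variable {S : ℕ} (rk : ExplicitRK S)

/-- The sum of the moduli of all coefficients `a i j`. -/
def absSum : ℝ := ∑ i, ∑ j, |rk.a i j|

lemma absSum_nonneg : 0 ≤ rk.absSum :=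
  Finset.sum_nonneg fun _ _ => Finset.sum_nonneg fun _ _ => abs_nonneg _

lemma sum_stage_coeff_le (i : Fin S) :
    ∑ j : Fin i.val, |rk.a i ⟨j.val, j.isLt.trans i.isLt⟩| ≤ rk.absSum := by
  have h1 : ∑ j : Fin i.val, |rk.a i ⟨j.val, j.isLt.trans i.isLt⟩| ≤ ∑ j, |rk.a i j| := by
    let e : Fin i.val ↪ Fin S :=
      ⟨fun j => ⟨j.val, j.isLt.trans i.isLt⟩, fun a b hab => by
        simpa [Fin.ext_iff] using hab⟩
    calc _ = ∑ j ∈ Finset.univ.map e, |rk.a i j| := by rw [Finset.sum_map]; rfl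
      _ ≤ _ := Finset.sum_le_sum_of_subset_of_nonneg (Finset.subset_univ _)
          fun _ _ _ => abs_nonneg _
  exact h1.trans (Finset.single_le_sum (f := fun i => ∑ j, |rk.a i j|)
    (fun i _ => Finset.sum_nonneg fun _ _ => abs_nonneg _) (Finset.mem_univ i))

variable {Z : Type*} [NormedAddCommGroup Z] [NormedSpace ℝ Z] {G : Z → Z} {z₀ : Z} {A r : ℝ}

lemma stage_mem_ball (hG : ∀ z ∈ Metric.ball z₀ r, ‖G z‖ ≤ A) {h : ℝ}
    (hA : 0 ≤ A) (hh : |h| * (rk.absSum * A) < r) (i : Fin S) :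
    rk.stage G h z₀ i ∈ Metric.ball z₀ r := by
  obtain ⟨i, hi⟩ := i
  induction i using Nat.strong_induction_on with
  | _ i ih =>
    rw [mem_ball_iff_norm, stage, add_sub_cancel_left, norm_smul, Real.norm_eq_abs]
    refine lt_of_le_of_lt (mul_le_mul_of_nonneg_left ?_ (abs_nonneg h)) hh
    refine (norm_sum_le _ _).trans ?_
    refine le_trans ?_ (mul_le_mul_of_nonneg_right (rk.sum_stage_coeff_le ⟨i, hi⟩) hA)
    rw [Finset.sum_mul]
    refine Finset.sum_le_sum fun j _ => ?_
    rw [norm_smul, Real.norm_eq_abs]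
    exact mul_le_mul_of_nonneg_left (hG _ (ih j.val j.isLt (j.isLt.trans hi))) (abs_nonneg _)

end bounds

end ExplicitRK

section localError

/-- Linear functions of the step size. -/
lemma BoundedDerivs.id_Ioo {m : ℕ} {T : ℝ} (hT1 : T ≤ 1) :
    BoundedDerivs m 1 (fun h : ℝ => h) (Set.Ioo (-T) T) := by
  refine BoundedDerivs.clm (ContinuousLinearMap.id ℝ ℝ) ContinuousLinearMap.norm_id_le
    (fun x hx => ?_) isOpen_Ioo
  simp only [ContinuousLinearMap.coe_id', id_eq, Real.norm_eq_abs, abs_le]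
  constructor <;> linarith [hx.1, hx.2]

/-- The increments `z + h ∑ c_j u_j(h)` of which stages and steps consist. -/
lemma BoundedDerivs.increment {Z : Type*} [NormedAddCommGroup Z] [NormedSpace ℝ Z] {m : ℕ}
    {T A : ℝ} (hT1 : T ≤ 1) {ι : Type*} (t : Finset ι) (c : ι → ℝ) {u : ι → ℝ → Z} {B : ι → ℝ}
    (hB : ∀ i, 0 ≤ B i) {z : Z} (hz : ‖z‖ ≤ A)
    (hu : ∀ i ∈ t, BoundedDerivs m (B i) (u i) (Set.Ioo (-T) T)) :
    BoundedDerivs m (A + 2 ^ m * ∑ i ∈ t, |c i| * B i) (fun h => z + h • ∑ i ∈ t, c i • u i h)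
      (Set.Ioo (-T) T) := by
  have h1 := BoundedDerivs.sum isOpen_Ioo t (fun i hi => (hu i hi).const_smul isOpen_Ioo (c i))
  have hnn : 0 ≤ ∑ i ∈ t, |c i| * B i :=
    Finset.sum_nonneg fun i _ => mul_nonneg (abs_nonneg _) (hB i)
  have h2 := (BoundedDerivs.id_Ioo (m := m) hT1).bilinear isOpen_Ioo
    (ContinuousLinearMap.lsmul ℝ ℝ : ℝ →L[ℝ] Z →L[ℝ] Z) hnn h1
  refine ((BoundedDerivs.const z hz).add isOpen_Ioo h2).mono (add_le_add le_rfl ?_)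
  refine (mul_le_of_le_one_left (by positivity) ContinuousLinearMap.opNorm_lsmul_le).trans_eq ?_
  rw [mul_one]

variable {S : ℕ} (rk : ExplicitRK S)

/-- The stages are functions of the step size with bounds that depend only on the method and on
the bounds for the field. -/
lemma exists_bound_stage (m : ℕ) {A r T : ℝ} (hA : 0 ≤ A) (hT1 : T ≤ 1)
    (hT : T * (rk.absSum * A) < r) (i : Fin S) :
    ∃ C : ℝ, 0 ≤ C ∧ ∀ (Z : Type) [NormedAddCommGroup Z] [NormedSpace ℝ Z] (G : Z → Z) (z₀ : Z),
      ‖z₀‖ ≤ A → BoundedDerivs m A G (Metric.ball z₀ r) →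
        BoundedDerivs m C (fun h => rk.stage G h z₀ i) (Set.Ioo (-T) T) := by
  obtain ⟨i, hi⟩ := i
  induction i using Nat.strong_induction_on with
  | _ i ih =>
    choose C hC0 hC using fun j : Fin i => ih j.val j.isLt (j.isLt.trans hi)
    refine ⟨A + 2 ^ m * ∑ j : Fin i, |rk.a ⟨i, hi⟩ ⟨j.val, j.isLt.trans hi⟩| *
      (m.factorial * A * (max 1 (C j)) ^ m), by positivity, fun Z _ _ G z₀ hz hG => ?_⟩
    have key : ∀ j : Fin i, BoundedDerivs m (m.factorial * A * (max 1 (C j)) ^ m)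
        (fun h => G (rk.stage G h z₀ ⟨j.val, j.isLt.trans hi⟩)) (Set.Ioo (-T) T) := by
      intro j
      refine BoundedDerivs.comp isOpen_Ioo Metric.isOpen_ball hA hG (hC j Z G z₀ hz hG) ?_
      intro h hh
      refine rk.stage_mem_ball (fun z hz => hG.norm_apply_le hz) hA (lt_of_le_of_lt ?_ hT) _
      exact mul_le_mul_of_nonneg_right (abs_le.2 ⟨hh.1.le, hh.2.le⟩)
        (mul_nonneg rk.absSum_nonneg hA)
    refine (BoundedDerivs.increment hT1 Finset.univ
      (fun j : Fin i => rk.a ⟨i, hi⟩ ⟨j.val, j.isLt.trans hi⟩) (fun j => by positivity) hz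
      (fun j _ => key j)).congr isOpen_Ioo fun h _ => ?_
    rw [ExplicitRK.stage]

lemma exists_bound_step (m : ℕ) {A r T : ℝ} (hA : 0 ≤ A) (hT1 : T ≤ 1)
    (hT : T * (rk.absSum * A) < r) :
    ∃ C : ℝ, 0 ≤ C ∧ ∀ (Z : Type) [NormedAddCommGroup Z] [NormedSpace ℝ Z] (G : Z → Z) (z₀ : Z),
      ‖z₀‖ ≤ A → BoundedDerivs m A G (Metric.ball z₀ r) →
        BoundedDerivs m C (fun h => rk.step G h z₀) (Set.Ioo (-T) T) := by
  choose C hC0 hC using fun i => exists_bound_stage rk m hA hT1 hT i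
  refine ⟨A + 2 ^ m * ∑ i, |rk.b i| * (m.factorial * A * (max 1 (C i)) ^ m), by positivity,
    fun Z _ _ G z₀ hz hG => ?_⟩
  refine BoundedDerivs.increment hT1 Finset.univ rk.b (fun j => by positivity) hz fun i _ => ?_
  refine BoundedDerivs.comp isOpen_Ioo Metric.isOpen_ball hA hG (hC i Z G z₀ hz hG) ?_
  intro h hh
  refine rk.stage_mem_ball (fun z hz => hG.norm_apply_le hz) hA (lt_of_le_of_lt ?_ hT) _
  exact mul_le_mul_of_nonneg_right (abs_le.2 ⟨hh.1.le, hh.2.le⟩)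
    (mul_nonneg rk.absSum_nonneg hA)

/-- The derivatives of a solution of `Ψ' = G(Ψ)` are bounded in terms of those of `G`. -/
lemma exists_bound_solution (m : ℕ) {A B : ℝ} (hA : 0 ≤ A) (hB : 0 ≤ B) :
    ∃ C : ℝ, 0 ≤ C ∧ ∀ (Z : Type) [NormedAddCommGroup Z] [NormedSpace ℝ Z] (G : Z → Z)
      (U : Set Z) (V : Set ℝ) (Ψ : ℝ → Z), IsOpen U → IsOpen V → BoundedDerivs m A G U →
      (∀ t ∈ V, HasDerivAt Ψ (G (Ψ t)) t) → (∀ t ∈ V, Ψ t ∈ U) → (∀ t ∈ V, ‖Ψ t‖ ≤ B) →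
        BoundedDerivs m C Ψ V := by
  induction m with
  | zero =>
    refine ⟨B, hB, fun Z _ _ G U V Ψ hU hV hG hΨ hm hb => ⟨?_, fun j hj t ht => ?_⟩⟩
    · exact contDiffOn_zero.2 fun t ht => (hΨ t ht).continuousAt.continuousWithinAt
    · obtain rfl : j = 0 := by omega
      simpa using hb t ht
  | succ m ih =>
    obtain ⟨C, hC0, hC⟩ := ih
    refine ⟨max B (m.factorial * A * (max 1 C) ^ m), le_max_of_le_left hB,
      fun Z _ _ G U V Ψ hU hV hG hΨ hm hb => ?_⟩
    have h1 := hC Z G U V Ψ hU hV (hG.of_le (Nat.le_succ m)) hΨ hm hb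
    have h2 := BoundedDerivs.comp hV hU hA (hG.of_le (Nat.le_succ m)) h1 hm
    have h3 := h2.clm_comp hV
      (ContinuousLinearMap.toSpanSingletonLIE ℝ Z).toContinuousLinearEquiv.toContinuousLinearMap
    have hn : ‖(ContinuousLinearMap.toSpanSingletonLIE ℝ
        Z).toContinuousLinearEquiv.toContinuousLinearMap‖ ≤ 1 :=
      (ContinuousLinearMap.toSpanSingletonLIE ℝ Z).toLinearIsometry.norm_toContinuousLinearMap_le
    refine BoundedDerivs.of_hasFDerivAt hV (h3.mono ?_) (fun t ht => (hΨ t ht).hasFDerivAt)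
      (fun t ht => (hb t ht).trans (le_max_left _ _))
    refine le_trans ?_ (le_max_right _ _)
    exact mul_le_of_le_one_left (by positivity) hn

/-- A vector-valued polynomial of degree less than `n` that is `O(x^n)` at `0` vanishes. -/
lemma coeff_eq_zero_of_isBigO {Z : Type*} [NormedAddCommGroup Z] [NormedSpace ℝ Z] (n : ℕ)
    (c : ℕ → Z)
    (h : (fun x : ℝ => ∑ k ∈ Finset.range n, x ^ k • c k) =O[𝓝[>] 0] fun x : ℝ => x ^ n) :
    ∀ k < n, c k = 0 := by
  induction n generalizing c with
  | zero => intro k hk; omega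
  | succ n ih =>
    have hc0 : c 0 = 0 := by
      have hx : Filter.Tendsto (fun x : ℝ => x ^ (n + 1)) (𝓝[>] 0) (𝓝 0) := by
        have : Filter.Tendsto (fun x : ℝ => x ^ (n + 1)) (𝓝 0) (𝓝 (0 ^ (n + 1))) :=
          (continuous_pow (n + 1)).tendsto 0
        simpa using this.mono_left nhdsWithin_le_nhds
      have h1 := h.trans_tendsto hx
      have h2 : Filter.Tendsto (fun x : ℝ => ∑ k ∈ Finset.range (n + 1), x ^ k • c k) (𝓝[>] 0)
          (𝓝 (∑ k ∈ Finset.range (n + 1), (0 : ℝ) ^ k • c k)) := by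
        have : Continuous fun x : ℝ => ∑ k ∈ Finset.range (n + 1), x ^ k • c k := by fun_prop
        exact (this.tendsto 0).mono_left nhdsWithin_le_nhds
      have h3 := tendsto_nhds_unique h2 h1
      rw [Finset.sum_range_succ'] at h3
      simpa using h3
    have h' : (fun x : ℝ => ∑ k ∈ Finset.range n, x ^ k • c (k + 1)) =O[𝓝[>] 0]
        fun x : ℝ => x ^ n := by
      obtain ⟨C, hC⟩ := h.bound
      refine Asymptotics.IsBigO.of_bound C ?_
      filter_upwards [hC, self_mem_nhdsWithin] with x hx hx0
      have hx0' : (0 : ℝ) < x := hx0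
      have heq : ∑ k ∈ Finset.range (n + 1), x ^ k • c k
          = x • ∑ k ∈ Finset.range n, x ^ k • c (k + 1) := by
        rw [Finset.sum_range_succ', hc0, smul_zero, add_zero, Finset.smul_sum]
        refine Finset.sum_congr rfl fun k _ => ?_
        rw [smul_smul, pow_succ']
      rw [heq, norm_smul, pow_succ', norm_mul, mul_left_comm] at hx
      exact le_of_mul_le_mul_left hx (norm_pos_iff.2 hx0'.ne')
    intro k hk
    cases k with
    | zero => exact hc0
    | succ k => exact ih _ h' k (by omega)

/-- A `C^{n+1}` function that is `O(h^{n+1})` at `0` is bounded by `C h^{n+1}`, where `C` bounds its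
derivative of order `n + 1`, for its Taylor polynomial of order `n` vanishes. -/
lemma norm_le_pow_of_isBigO {Z : Type*} [NormedAddCommGroup Z] [NormedSpace ℝ Z] {n : ℕ}
    {T C : ℝ} {d : ℝ → Z} (hd : BoundedDerivs (n + 1) C d (Set.Ioo (-T) T))
    (hO : d =O[𝓝 0] fun h : ℝ => h ^ (n + 1)) {h : ℝ} (h0 : 0 ≤ h) (hT : h < T) :
    ‖d h‖ ≤ C * h ^ (n + 1) := by
  have hC0 : 0 ≤ C := (norm_nonneg _).trans (hd.norm_apply_le (x := h) ⟨by linarith, hT⟩)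
  rcases h0.eq_or_lt with rfl | hpos
  · have := hO.bound
    obtain ⟨c, hc⟩ := this
    simpa using hc.self_of_nhds
  have hsub : Set.Icc 0 h ⊆ Set.Ioo (-T) T := fun x hx => ⟨by linarith [hx.1], by linarith [hx.2]⟩
  have hcd : ContDiffOn ℝ ((n : WithTop ℕ∞) + 1) d (Set.Icc 0 h) := by
    have := hd.contDiffOn.mono hsub
    exact_mod_cast this
  have hbd : ∀ y ∈ Set.Icc 0 h, ‖iteratedDerivWithin (n + 1) d (Set.Icc 0 h) y‖ ≤ C := by
    intro y hy
    rw [iteratedDerivWithin_eq_iteratedDeriv (uniqueDiffOn_Icc hpos)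
      (by exact_mod_cast hd.contDiffAt isOpen_Ioo (hsub hy)) hy,
      ← norm_iteratedFDeriv_eq_norm_iteratedDeriv]
    exact hd.norm_le (n + 1) le_rfl y (hsub hy)
  have htay : ∀ x ∈ Set.Icc 0 h, ‖d x - taylorWithinEval d n (Set.Icc 0 h) 0 x‖
      ≤ C * x ^ (n + 1) := by
    intro x hx
    have := taylor_mean_remainder_bound hpos.le hcd hx hbd
    rw [sub_zero] at this
    refine this.trans (div_le_self (mul_nonneg hC0 (pow_nonneg hx.1 _)) ?_)
    exact_mod_cast Nat.one_le_iff_ne_zero.2 (Nat.factorial_ne_zero n)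
  have hmem : Set.Icc 0 h ∈ 𝓝[>] (0 : ℝ) :=
    Filter.mem_of_superset (Ioo_mem_nhdsGT hpos) Set.Ioo_subset_Icc_self
  have hpoly : (fun x : ℝ => taylorWithinEval d n (Set.Icc 0 h) 0 x) =O[𝓝[>] 0]
      fun x : ℝ => x ^ (n + 1) := by
    have h1 : (fun x : ℝ => d x - taylorWithinEval d n (Set.Icc 0 h) 0 x) =O[𝓝[>] 0]
        fun x : ℝ => x ^ (n + 1) := by
      refine Asymptotics.IsBigO.of_bound C ?_
      filter_upwards [hmem] with x hx
      refine (htay x hx).trans_eq ?_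
      rw [Real.norm_of_nonneg (pow_nonneg hx.1 _)]
    have h2 := (hO.mono nhdsWithin_le_nhds).sub h1
    simpa using h2
  have hcoef := coeff_eq_zero_of_isBigO (n + 1)
    (fun k => ((k.factorial : ℝ)⁻¹) • iteratedDerivWithin k d (Set.Icc 0 h) 0) (by
      refine hpoly.congr_left fun x => ?_
      rw [taylor_within_apply]
      refine Finset.sum_congr rfl fun k _ => ?_
      rw [smul_smul, sub_zero, mul_comm])
  have hzero : taylorWithinEval d n (Set.Icc 0 h) 0 h = 0 := by
    rw [taylor_within_apply]
    refine Finset.sum_eq_zero fun k hk => ?_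
    have := hcoef k (Finset.mem_range.1 hk)
    rw [sub_zero, mul_comm, mul_smul, this, smul_zero]
  simpa [hzero] using htay h ⟨hpos.le, le_rfl⟩

/-- The Picard-Lindelöf theorem, with the solution confined to the ball on which the field is
controlled. -/
lemma exists_solution_mem_closedBall {Z : Type*} [NormedAddCommGroup Z] [NormedSpace ℝ Z]
    [CompleteSpace Z] {f : ℝ → Z → Z} {tmin tmax : ℝ} {t₀ : Set.Icc tmin tmax} {x₀ : Z}
    {a L K : NNReal} (hf : IsPicardLindelof f t₀ x₀ a 0 L K) :
    ∃ α : ℝ → Z, α t₀ = x₀ ∧ ∀ t ∈ Set.Icc tmin tmax,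
      HasDerivWithinAt α (f t (α t)) (Set.Icc tmin tmax) t ∧ α t ∈ Metric.closedBall x₀ a := by
  have hx : x₀ ∈ Metric.closedBall x₀ ((0 : NNReal) : ℝ) := by simp
  obtain ⟨α, hα⟩ := ODE.FunSpace.exists_isFixedPt_next hf hx
  refine ⟨α.compProj, by rw [ODE.FunSpace.compProj_val, ← hα, ODE.FunSpace.next_apply₀],
    fun t ht => ⟨?_, α.compProj_mem_closedBall hf.mul_max_le⟩⟩
  apply ODE.hasDerivWithinAt_picard_Icc t₀.2 hf.continuousOn_uncurry
    α.continuous_compProj.continuousOn (fun _ ht' => α.compProj_mem_closedBall hf.mul_max_le)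
    x₀ ht |>.congr_of_mem _ ht
  intro t' ht'
  nth_rw 1 [← hα]
  rw [ODE.FunSpace.compProj_of_mem ht', ODE.FunSpace.next_apply]

lemma exists_solution_mem_ball {Z : Type*} [NormedAddCommGroup Z] [NormedSpace ℝ Z]
    [CompleteSpace Z] {G : Z → Z} {z₀ : Z} {A r T : ℝ} (hA : 0 ≤ A) (hr : 0 < r) (hT : 0 < T)
    (hTA : T * A ≤ r / 2) {m : ℕ} (hG : BoundedDerivs (m + 1) A G (Metric.ball z₀ r)) :
    ∃ Ψ : ℝ → Z, Ψ 0 = z₀ ∧ ∀ t ∈ Set.Ioo (-T) T,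
      HasDerivAt Ψ (G (Ψ t)) t ∧ Ψ t ∈ Metric.ball z₀ r := by
  have hsub : Metric.closedBall z₀ (r / 2) ⊆ Metric.ball z₀ r :=
    Metric.closedBall_subset_ball (by linarith)
  lift A to NNReal using hA
  have hr2 : 0 ≤ r / 2 := by positivity
  obtain ⟨a, ha⟩ : ∃ a : NNReal, (a : ℝ) = r / 2 := ⟨⟨r / 2, hr2⟩, rfl⟩
  rw [← ha] at hsub
  have hlip : LipschitzOnWith A G (Metric.closedBall z₀ a) := by
    refine (convex_closedBall z₀ a).lipschitzOnWith_of_nnnorm_fderiv_le (𝕜 := ℝ)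
      (fun x hx => hG.differentiableAt Metric.isOpen_ball (hsub hx)) fun x hx => ?_
    exact hG.norm_fderiv_le (hsub hx)
  have h0 : (0 : ℝ) ∈ Set.Icc (-T) T := ⟨by linarith, hT.le⟩
  have hPL : IsPicardLindelof (fun _ => G) (tmin := -T) (tmax := T) ⟨0, h0⟩ z₀ a 0 A A := by
    refine IsPicardLindelof.of_time_independent (fun x hx => hG.norm_apply_le (hsub hx)) hlip ?_
    simp only [sub_zero, zero_sub, neg_neg, max_self, NNReal.coe_zero, ha]
    linarith
  obtain ⟨α, hα0, hα⟩ := exists_solution_mem_closedBall hPL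
  refine ⟨α, hα0, fun t ht => ?_⟩
  obtain ⟨h1, h2⟩ := hα t (Set.Ioo_subset_Icc_self ht)
  exact ⟨h1.hasDerivAt (Icc_mem_nhds ht.1 ht.2), hsub h2⟩

/-- The local error of a method of order `s` is bounded by `C h^{s+1}` with a constant that depends
only on the method and on bounds for the field and its derivatives on a ball, not on the field
or on the dimension. -/
theorem exists_local_error_bound {s : ℕ} (hrk : rk.HasOrder s) {A r : ℝ} (hA : 0 < A)
    (hr : 0 < r) :
    ∃ C T : ℝ, 0 ≤ C ∧ 0 < T ∧ ∀ (Z : Type) [NormedAddCommGroup Z] [NormedSpace ℝ Z]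
      [FiniteDimensional ℝ Z] (G : Z → Z) (z₀ : Z), ‖z₀‖ ≤ A →
      BoundedDerivs (s + 1) A G (Metric.ball z₀ r) →
      ∃ Ψ : ℝ → Z, Ψ 0 = z₀ ∧
        (∀ t ∈ Set.Ioo (-T) T, HasDerivAt Ψ (G (Ψ t)) t ∧ Ψ t ∈ Metric.ball z₀ r) ∧
        ∀ h, 0 ≤ h → h < T → ‖rk.step G h z₀ - Ψ h‖ ≤ C * h ^ (s + 1) := by
  have ha := rk.absSum_nonneg
  set T : ℝ := min 1 (r / (2 * ((rk.absSum + 1) * A))) with hTdef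
  have hT0 : 0 < T := lt_min one_pos (by positivity)
  have hT1 : T ≤ 1 := min_le_left _ _
  have hT2 : T * ((rk.absSum + 1) * A) ≤ r / 2 := by
    have : T ≤ r / (2 * ((rk.absSum + 1) * A)) := min_le_right _ _
    rw [le_div_iff₀ (by positivity)] at this
    linarith
  have hTa : T * (rk.absSum * A) < r := by
    have : T * (rk.absSum * A) ≤ T * ((rk.absSum + 1) * A) := by gcongr; linarith
    linarith
  have hTA : T * A ≤ r / 2 := by
    refine le_trans ?_ hT2
    gcongr
    nlinarith
  obtain ⟨C₁, hC₁, H₁⟩ := exists_bound_step rk (s + 1) hA.le hT1 hTa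
  obtain ⟨C₂, hC₂, H₂⟩ := exists_bound_solution (s + 1) hA.le (B := A + r) (by positivity)
  refine ⟨C₁ + |(-1 : ℝ)| * C₂, T, by positivity, hT0, fun Z _ _ _ G z₀ hz hG => ?_⟩
  have : CompleteSpace Z := FiniteDimensional.complete ℝ Z
  obtain ⟨Ψ, hΨ0, hΨ⟩ := exists_solution_mem_ball hA.le hr hT0 hTA hG
  refine ⟨Ψ, hΨ0, hΨ, fun h h0 hT => ?_⟩
  have hb1 := H₁ Z G z₀ hz hG
  have hb2 := H₂ Z G _ _ Ψ Metric.isOpen_ball isOpen_Ioo hG (fun t ht => (hΨ t ht).1)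
    (fun t ht => (hΨ t ht).2) (fun t ht => by
      have h1 := mem_ball_iff_norm.1 (hΨ t ht).2
      have h2 := norm_le_norm_add_norm_sub' (Ψ t) z₀
      linarith)
  have hd : BoundedDerivs (s + 1) (C₁ + |(-1 : ℝ)| * C₂) (fun h => rk.step G h z₀ - Ψ h)
      (Set.Ioo (-T) T) :=
    (hb1.add isOpen_Ioo (hb2.const_smul isOpen_Ioo (-1))).congr isOpen_Ioo fun h _ => by
      simp [sub_eq_add_neg]
  refine norm_le_pow_of_isBigO hd (hrk Z G z₀ Ψ ?_ hΨ0 ?_) h0 hT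
  · exact hG.contDiffAt Metric.isOpen_ball (Metric.mem_ball_self hr)
  · filter_upwards [Ioo_mem_nhds (neg_lt_zero.2 hT0) hT0] with t ht using (hΨ t ht).1

end localError

/-! ### Conjugates of strongly convex functions -/

section conjugate

variable {E : Type*} [NormedAddCommGroup E] [InnerProductSpace ℝ E] {g : E → ℝ} {μ : ℝ}

lemma strongConvexOn_segment (hg : StrongConvexOn Set.univ μ g) (x x' : E) {t : ℝ} (h0 : 0 ≤ t)
    (h1 : t ≤ 1) :
    g (x + t • (x' - x)) ≤ g x + t * (g x' - g x - (1 - t) * (μ / 2 * ‖x' - x‖ ^ 2)) := by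
  have := hg.2 (Set.mem_univ x) (Set.mem_univ x') (sub_nonneg.2 h1) h0 (by ring)
  simp only [smul_eq_mul] at this
  have e : x + t • (x' - x) = (1 - t) • x + t • x' := by module
  rw [e, norm_sub_rev x' x]
  linarith

/-- A lower bound on the growth of `g` along segments issuing from `x` improves to one with
quadratic excess, by strong convexity. -/
lemma strongConvex_lower_bound (hg : StrongConvexOn Set.univ μ g) {x x' : E} {c : ℝ → ℝ} {c₀ : ℝ}
    (hc : Filter.Tendsto c (𝓝[>] 0) (𝓝 c₀))
    (h : ∀ᶠ t in 𝓝[>] (0 : ℝ), g x + t * c t ≤ g (x + t • (x' - x))) :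
    g x + c₀ + μ / 2 * ‖x' - x‖ ^ 2 ≤ g x' := by
  have hlim : Filter.Tendsto (fun t : ℝ => g x' - g x - (1 - t) * (μ / 2 * ‖x' - x‖ ^ 2)) (𝓝[>] 0)
      (𝓝 (g x' - g x - (1 - 0) * (μ / 2 * ‖x' - x‖ ^ 2))) := by
    have : Continuous fun t : ℝ => g x' - g x - (1 - t) * (μ / 2 * ‖x' - x‖ ^ 2) := by fun_prop
    exact (this.tendsto 0).mono_left nhdsWithin_le_nhds
  have := le_of_tendsto_of_tendsto hc hlim (by
    filter_upwards [h, Ioo_mem_nhdsGT (zero_lt_one' ℝ)] with t ht ht'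
    have h1 := strongConvexOn_segment hg x x' ht'.1.le ht'.2.le
    exact le_of_mul_le_mul_left (by linarith) ht'.1)
  linarith

lemma gradient_strong [CompleteSpace E] (hg : StrongConvexOn Set.univ μ g) {x : E}
    (hd : DifferentiableAt ℝ g x) (x' : E) :
    g x + ⟪gradient g x, x' - x⟫_ℝ + μ / 2 * ‖x' - x‖ ^ 2 ≤ g x' := by
  have hline : HasDerivAt (fun t : ℝ => g (x + t • (x' - x))) ⟪gradient g x, x' - x⟫_ℝ 0 := by
    have h1 : HasFDerivAt g (fderiv ℝ g x) (x + (0 : ℝ) • (x' - x)) := by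
      simpa using hd.hasFDerivAt
    have h2 : HasDerivAt (fun t : ℝ => x + t • (x' - x)) (x' - x) 0 := by
      simpa using ((hasDerivAt_id (0 : ℝ)).smul_const (x' - x)).const_add x
    have := h1.comp_hasDerivAt (0 : ℝ) h2
    rwa [gradient, InnerProductSpace.toDual_symm_apply]
  have hslope := hline.tendsto_slope_zero_right
  refine strongConvex_lower_bound hg hslope ?_
  filter_upwards [self_mem_nhdsWithin] with t ht
  have ht' : t ≠ 0 := (Set.mem_Ioi.1 ht).ne'
  simp only [zero_add, zero_smul, add_zero, smul_eq_mul]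
  rw [mul_inv_cancel_left₀ ht']
  linarith

lemma continuous_of_strongConvexOn [FiniteDimensional ℝ E] (hg : StrongConvexOn Set.univ μ g)
    (hμ : 0 < μ) : Continuous g := by
  have := (hg.strictConvexOn hμ).convexOn.locallyLipschitz
  exact this.continuous

/-- A convex function decreases at most linearly. -/
lemma convexOn_lower_linear [FiniteDimensional ℝ E] {q : E → ℝ} (hq : ConvexOn ℝ Set.univ q) :
    ∃ B : ℝ, 0 ≤ B ∧ ∀ x, -B * (‖x‖ + 1) ≤ q x := by
  have hc : Continuous q := hq.locallyLipschitz.continuous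
  obtain ⟨u₀, -, hu₀⟩ := (isCompact_closedBall (0 : E) 1).exists_isMinOn ⟨0, by simp⟩
    hc.continuousOn
  have hu : ∀ u : E, ‖u‖ ≤ 1 → q u₀ ≤ q u := fun u hu => hu₀ (by simpa using hu)
  refine ⟨|q u₀| + |q 0|, by positivity, fun x => ?_⟩
  have a1 := neg_abs_le (q u₀)
  have a2 := le_abs_self (q 0)
  have a3 := abs_nonneg (q u₀)
  have a4 := abs_nonneg (q 0)
  rcases le_or_gt ‖x‖ 1 with hx | hx
  · have := hu x hx
    nlinarith [norm_nonneg x]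
  · have hx0 : 0 < ‖x‖ := by linarith
    have h1 := hq.2 (Set.mem_univ (0 : E)) (Set.mem_univ x)
      (sub_nonneg.2 (inv_le_one_of_one_le₀ hx.le)) (inv_nonneg.2 hx0.le) (sub_add_cancel 1 ‖x‖⁻¹)
    have h2 := hu (‖x‖⁻¹ • x) (by rw [norm_smul, norm_inv, norm_norm, inv_mul_cancel₀ hx0.ne'])
    simp only [smul_zero, zero_add, smul_eq_mul] at h1
    have h3 : ‖x‖ * q u₀ ≤ (‖x‖ - 1) * q 0 + q x := by
      have := mul_le_mul_of_nonneg_left (h2.trans h1) hx0.le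
      field_simp at this
      linarith
    nlinarith

variable [FiniteDimensional ℝ E]

lemma exists_argmaxConj (hg : StrongConvexOn Set.univ μ g) (hμ : 0 < μ) (z : E) :
    ∃ x, ∀ x', ⟪z, x'⟫_ℝ - g x' ≤ ⟪z, x⟫_ℝ - g x := by
  obtain ⟨B, hB0, hB⟩ := convexOn_lower_linear (strongConvexOn_iff_convex.1 hg)
  have hcont : Continuous fun x => g x - ⟪z, x⟫_ℝ :=
    (continuous_of_strongConvexOn hg hμ).sub (by fun_prop)
  have hlow : ∀ x, ‖x‖ * (μ / 2 * ‖x‖ - (B + ‖z‖)) - B ≤ g x - ⟪z, x⟫_ℝ := by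
    intro x
    have h1 := hB x
    have h2 := real_inner_le_norm z x
    nlinarith
  have ht : Filter.Tendsto (fun x => g x - ⟪z, x⟫_ℝ) (Filter.cocompact E) Filter.atTop := by
    refine Filter.tendsto_atTop_mono hlow (Filter.tendsto_atTop_add_const_right _ _ ?_)
    have hn := tendsto_norm_cocompact_atTop (E := E)
    refine hn.atTop_mul_atTop₀ ?_
    exact Filter.tendsto_atTop_add_const_right _ _ (hn.const_mul_atTop (by positivity))
  obtain ⟨x, hx⟩ := hcont.exists_forall_le ht
  exact ⟨x, fun x' => by linarith [hx x']⟩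

lemma argmaxConj_spec (hg : StrongConvexOn Set.univ μ g) (hμ : 0 < μ) (z x' : E) :
    ⟪z, x'⟫_ℝ - g x' ≤ ⟪z, argmaxConj g z⟫_ℝ - g (argmaxConj g z) :=
  Classical.epsilon_spec (exists_argmaxConj hg hμ z) x'

/-- At the maximizer of `⟨z, ·⟩ - g`, the vector `z` is a subgradient of `g`. -/
lemma argmaxConj_strong (hg : StrongConvexOn Set.univ μ g) (hμ : 0 < μ) (z x' : E) :
    g (argmaxConj g z) + ⟪z, x' - argmaxConj g z⟫_ℝ + μ / 2 * ‖x' - argmaxConj g z‖ ^ 2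
      ≤ g x' := by
  refine strongConvex_lower_bound hg (c := fun _ => ⟪z, x' - argmaxConj g z⟫_ℝ)
    tendsto_const_nhds (Filter.Eventually.of_forall fun t => ?_)
  have := argmaxConj_spec hg hμ z (argmaxConj g z + t • (x' - argmaxConj g z))
  rw [inner_add_right, inner_smul_right] at this
  linarith

lemma eq_argmaxConj (hg : StrongConvexOn Set.univ μ g) (hμ : 0 < μ) {z x : E}
    (hx : ∀ x', ⟪z, x'⟫_ℝ - g x' ≤ ⟪z, x⟫_ℝ - g x) : x = argmaxConj g z := by
  have h1 := argmaxConj_strong hg hμ z x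
  have h2 := hx (argmaxConj g z)
  rw [inner_sub_right] at h1
  have h3 : ‖x - argmaxConj g z‖ ^ 2 ≤ 0 := by nlinarith
  have h4 : ‖x - argmaxConj g z‖ = 0 := by
    have := sq_nonneg ‖x - argmaxConj g z‖
    exact pow_eq_zero_iff (two_ne_zero) |>.1 (le_antisymm h3 this)
  exact sub_eq_zero.1 (norm_eq_zero.1 h4)

lemma argmaxConj_gradient (hg : StrongConvexOn Set.univ μ g) (hμ : 0 < μ) {x : E}
    (hd : DifferentiableAt ℝ g x) :
    haveI := FiniteDimensional.complete ℝ E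
    argmaxConj g (gradient g x) = x := by
  have := FiniteDimensional.complete ℝ E
  refine (eq_argmaxConj hg hμ fun x' => ?_).symm
  have h1 := gradient_strong hg hd x'
  rw [inner_sub_right] at h1
  have : 0 ≤ μ / 2 * ‖x' - x‖ ^ 2 := by positivity
  linarith

lemma gradient_argmaxConj (hg : StrongConvexOn Set.univ μ g) (hμ : 0 < μ) {z : E}
    (hd : DifferentiableAt ℝ g (argmaxConj g z)) :
    haveI := FiniteDimensional.complete ℝ E
    gradient g (argmaxConj g z) = z := by
  have := FiniteDimensional.complete ℝ E
  have hF : HasFDerivAt (fun x => ⟪z, x⟫_ℝ - g x)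
      (innerSL ℝ z - fderiv ℝ g (argmaxConj g z)) (argmaxConj g z) :=
    (innerSL ℝ z).hasFDerivAt.sub hd.hasFDerivAt
  have hmax : IsLocalMax (fun x => ⟪z, x⟫_ℝ - g x) (argmaxConj g z) :=
    Filter.Eventually.of_forall fun x' => argmaxConj_spec hg hμ z x'
  have h0 := hmax.hasFDerivAt_eq_zero hF
  rw [gradient, LinearIsometryEquiv.symm_apply_eq]
  ext w
  have := congrArg (fun L : E →L[ℝ] ℝ => L w) h0
  simp at this
  simp
  linarith

/-- The value at `z` of the convex conjugate of `g`. -/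
def conjVal (g : E → ℝ) (z : E) : ℝ := ⟪z, argmaxConj g z⟫_ℝ - g (argmaxConj g z)

lemma conjVal_lower (hg : StrongConvexOn Set.univ μ g) (hμ : 0 < μ) (z z' : E) :
    conjVal g z + ⟪z' - z, argmaxConj g z⟫_ℝ ≤ conjVal g z' := by
  have := argmaxConj_spec hg hμ z' (argmaxConj g z)
  rw [conjVal, conjVal, inner_sub_left]
  linarith

lemma conjVal_upper (hg : StrongConvexOn Set.univ μ g) (hμ : 0 < μ) (z z' : E) :
    conjVal g z' ≤ conjVal g z + ⟪z' - z, argmaxConj g z⟫_ℝ + ‖z' - z‖ ^ 2 / (2 * μ) := by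
  have h1 := argmaxConj_strong hg hμ z (argmaxConj g z')
  set x := argmaxConj g z
  set x' := argmaxConj g z'
  have h2 : ⟪z' - z, x' - x⟫_ℝ ≤ ‖z' - z‖ * ‖x' - x‖ := real_inner_le_norm _ _
  have h3 : ‖z' - z‖ * ‖x' - x‖ ≤ ‖z' - z‖ ^ 2 / (2 * μ) + μ / 2 * ‖x' - x‖ ^ 2 := by
    have : ‖z' - z‖ ^ 2 / (2 * μ) + μ / 2 * ‖x' - x‖ ^ 2 - ‖z' - z‖ * ‖x' - x‖
        = (‖z' - z‖ - μ * ‖x' - x‖) ^ 2 / (2 * μ) := by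
      field_simp
      ring
    have h4 : 0 ≤ (‖z' - z‖ - μ * ‖x' - x‖) ^ 2 / (2 * μ) := by positivity
    linarith
  change ⟪z', x'⟫_ℝ - g x' ≤ ⟪z, x⟫_ℝ - g x + _ + _
  simp only [inner_sub_left, inner_sub_right] at *
  linarith

lemma argmaxConj_lipschitz (hg : StrongConvexOn Set.univ μ g) (hμ : 0 < μ) (z z' : E) :
    ‖argmaxConj g z' - argmaxConj g z‖ ≤ ‖z' - z‖ / μ := by
  have h1 := argmaxConj_strong hg hμ z (argmaxConj g z')
  have h2 := argmaxConj_strong hg hμ z' (argmaxConj g z)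
  set x := argmaxConj g z
  set x' := argmaxConj g z'
  have h3 : ⟪z' - z, x' - x⟫_ℝ ≤ ‖z' - z‖ * ‖x' - x‖ := real_inner_le_norm _ _
  rw [norm_sub_rev x x'] at h2
  have h4 : μ * ‖x' - x‖ ^ 2 ≤ ‖z' - z‖ * ‖x' - x‖ := by
    simp only [inner_sub_left, inner_sub_right] at *
    linarith
  rw [le_div_iff₀ hμ]
  rcases (norm_nonneg (x' - x)).eq_or_lt with h0 | h0
  · rw [← h0, zero_mul]; positivity
  · refine le_of_mul_le_mul_right ?_ h0
    linarith

lemma argmaxConj_continuous (hg : StrongConvexOn Set.univ μ g) (hμ : 0 < μ) :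
    Continuous (argmaxConj g) := by
  have : LipschitzWith ⟨1 / μ, by positivity⟩ (argmaxConj g) := by
    refine LipschitzWith.of_dist_le_mul fun z z' => ?_
    rw [dist_eq_norm, dist_eq_norm]
    refine (argmaxConj_lipschitz hg hμ z' z).trans_eq ?_
    change _ = 1 / μ * _
    ring
  exact this.continuous

end conjugate

/-! ### Blocks of stacked vectors -/

section blocks

variable {n p : ℕ}

/-- Taking the `i`-th block, as a linear map. -/
def blockₗ (i : Fin n) : Stk n p →ₗ[ℝ] Loc p where
  toFun x := block x i
  map_add' _ _ := rfl
  map_smul' _ _ := rfl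

/-- The vector with prescribed blocks. -/
def stack (u : Fin n → Loc p) : Stk n p := WithLp.toLp 2 fun ij => u ij.1 ij.2

@[simp] lemma block_stack (u : Fin n → Loc p) (i : Fin n) : block (stack u) i = u i := rfl

@[simp] lemma block_consensus (x : Loc p) (i : Fin n) : block (consensus n x) i = x := rfl

lemma block_sub (x y : Stk n p) (i : Fin n) : block (x - y) i = block x i - block y i := rfl

lemma block_neg (x : Stk n p) (i : Fin n) : block (-x) i = -block x i := rfl

lemma block_smul (c : ℝ) (x : Stk n p) (i : Fin n) : block (c • x) i = c • block x i := rfl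

lemma inner_eq_sum_block (x y : Stk n p) : ⟪x, y⟫_ℝ = ∑ i, ⟪block x i, block y i⟫_ℝ := by
  simp only [PiLp.inner_apply, block]
  rw [Fintype.sum_prod_type]

lemma norm_sq_eq_sum_block (x : Stk n p) : ‖x‖ ^ 2 = ∑ i, ‖block x i‖ ^ 2 := by
  simp only [← real_inner_self_eq_norm_sq, inner_eq_sum_block]

variable {f : Fin n → Loc p → ℝ} {μ : ℝ}

lemma F_strongConvexOn (hf : ∀ i, StrongConvexOn Set.univ μ (f i)) :
    StrongConvexOn Set.univ μ (F f) := by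
  refine ⟨convex_univ, fun x _ y _ a b ha hb hab => ?_⟩
  have h : ∀ i, f i (block (a • x + b • y) i) ≤ a * f i (block x i) + b * f i (block y i)
      - a * b * (μ / 2 * ‖block (x - y) i‖ ^ 2) := fun i =>
    (hf i).2 (Set.mem_univ (block x i)) (Set.mem_univ (block y i)) ha hb hab
  have h1 := Finset.sum_le_sum fun i (_ : i ∈ Finset.univ) => h i
  rw [Finset.sum_sub_distrib, Finset.sum_add_distrib, ← Finset.mul_sum, ← Finset.mul_sum,
    ← Finset.mul_sum, ← Finset.mul_sum, ← norm_sq_eq_sum_block] at h1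
  exact h1

/-- The maximization that defines `𝐱*` splits over the agents. -/
lemma block_xStar (hf : ∀ i, StrongConvexOn Set.univ μ (f i)) (hμ : 0 < μ) (z : Stk n p)
    (i : Fin n) : block (xStar f z) i = argmaxConj (f i) (block z i) := by
  have h : stack (fun i => argmaxConj (f i) (block z i)) = xStar f z := by
    refine eq_argmaxConj (F_strongConvexOn hf) hμ fun x' => ?_
    rw [inner_eq_sum_block, inner_eq_sum_block, F, F, ← Finset.sum_sub_distrib,
      ← Finset.sum_sub_distrib]
    exact Finset.sum_le_sum fun i _ => argmaxConj_spec (hf i) hμ (block z i) (block x' i)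
  rw [← h, block_stack]

end blocks

/-! ### Spectral facts about the Laplacian -/

section spectral

variable {n p : ℕ} (G : SimpleGraph (Fin n)) [DecidableRel G.Adj]

lemma bigLap_posSemidef : (bigLap p G).PosSemidef :=
  (G.posSemidef_lapMatrix ℝ).kronecker Matrix.PosSemidef.one

/-- `𝐋` as an operator. -/
abbrev lapOp : Stk n p →L[ℝ] Stk n p := Matrix.toEuclideanCLM (𝕜 := ℝ) (bigLap p G)

lemma sqrtLap_isSelfAdjoint : IsSelfAdjoint (sqrtLap p G) := by
  have h : IsSelfAdjoint (CFC.sqrt (bigLap p G)) := (CFC.sqrt_nonneg (bigLap p G)).isSelfAdjoint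
  exact h.map (Matrix.toEuclideanCLM (𝕜 := ℝ))

lemma sqrtLap_inner (x y : Stk n p) : ⟪sqrtLap p G x, y⟫_ℝ = ⟪x, sqrtLap p G y⟫_ℝ :=
  (sqrtLap_isSelfAdjoint G).isSymmetric x y

lemma sqrtLap_sqrtLap (x : Stk n p) : sqrtLap p G (sqrtLap p G x) = lapOp G x := by
  have h : CFC.sqrt (bigLap p G) * CFC.sqrt (bigLap p G) = bigLap p G :=
    CFC.sqrt_mul_sqrt_self _ (bigLap_posSemidef G).nonneg
  have h2 : sqrtLap p G * sqrtLap p G = lapOp G := by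
    rw [sqrtLap, ← map_mul, h]
  rw [← h2]
  rfl

lemma norm_sqrtLap_sq (x : Stk n p) : ‖sqrtLap p G x‖ ^ 2 = ⟪lapOp G x, x⟫_ℝ := by
  rw [← sqrtLap_sqrtLap, sqrtLap_inner, real_inner_self_eq_norm_sq]

lemma sqrtLap_eq_zero_iff (x : Stk n p) : sqrtLap p G x = 0 ↔ lapOp G x = 0 := by
  constructor
  · intro h
    rw [← sqrtLap_sqrtLap, h, map_zero]
  · intro h
    have := norm_sqrtLap_sq G x
    rw [h, inner_zero_left] at this
    simpa using this

/-- The block form of `𝐋 = L ⊗ I_p`. -/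
lemma block_lapOp (x : Stk n p) (i : Fin n) :
    block (lapOp G x) i = ∑ j, G.lapMatrix ℝ i j • block x j := by
  ext k
  have h1 : block (lapOp G x) i k = ∑ jl : Fin n × Fin p, bigLap p G (i, k) jl * x jl := rfl
  rw [h1, Fintype.sum_prod_type]
  simp only [bigLap, Matrix.kroneckerMap_apply, Matrix.one_apply, WithLp.ofLp_sum,
    Finset.sum_apply, WithLp.ofLp_smul, Pi.smul_apply, smul_eq_mul]
  refine Finset.sum_congr rfl fun j _ => ?_
  simp [block]

lemma lapOp_eq_zero_iff (hG : G.Connected) (x : Stk n p) :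
    lapOp G x = 0 ↔ ∃ u, x = consensus n u := by
  constructor
  · intro h
    have hk : ∀ k i j, x (i, k) = x (j, k) := by
      intro k i j
      have h2 : (G.lapMatrix ℝ).mulVec (fun i => x (i, k)) = 0 := by
        funext i
        have h3 := block_lapOp G x i
        rw [h] at h3
        have h4 := congrArg (fun w : Loc p => w k) h3
        simp only [WithLp.ofLp_sum, Finset.sum_apply, WithLp.ofLp_smul, Pi.smul_apply,
          smul_eq_mul] at h4
        exact h4.symm
      exact (SimpleGraph.lapMatrix_mulVec_eq_zero_iff_forall_reachable G).1 h2 i j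
        (hG.preconnected i j)
    obtain ⟨i₀⟩ := hG.nonempty
    refine ⟨block x i₀, ?_⟩
    ext ⟨i, k⟩
    exact hk k i i₀
  · rintro ⟨u, rfl⟩
    ext ⟨i, k⟩
    have h1 := congrArg (fun w : Loc p => w k) (block_lapOp G (consensus n u) i)
    have h2 : (∑ j, G.lapMatrix ℝ i j) = 0 := by
      have := congrFun (G.lapMatrix_mulVec_const_eq_zero (R := ℝ)) i
      simpa [Matrix.mulVec, dotProduct] using this
    simp only [block_consensus, ← Finset.sum_smul, h2, zero_smul] at h1
    exact h1

lemma lapOp_consensus (hG : G.Connected) (u : Loc p) : lapOp G (consensus n u) = 0 :=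
  (lapOp_eq_zero_iff G hG _).2 ⟨u, rfl⟩

lemma sqrtLap_consensus (hG : G.Connected) (u : Loc p) : sqrtLap p G (consensus n u) = 0 :=
  (sqrtLap_eq_zero_iff G _).2 (lapOp_consensus G hG u)

/-- The eigenvalues of `𝐋`. -/
abbrev lapEig (i : Fin n × Fin p) : ℝ := (bigLap_posSemidef G).isHermitian.eigenvalues i

/-- An orthonormal basis of eigenvectors of `𝐋`. -/
abbrev lapBasis : OrthonormalBasis (Fin n × Fin p) ℝ (Stk n p) :=
  (bigLap_posSemidef (p := p) G).isHermitian.eigenvectorBasis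

lemma lapOp_lapBasis (i : Fin n × Fin p) : lapOp G (lapBasis G i) = lapEig G i • lapBasis G i := by
  have := (bigLap_posSemidef (p := p) G).isHermitian.mulVec_eigenvectorBasis i
  ext k
  exact congrFun this k

lemma spectrum_bigLap : spectrum ℝ (bigLap p G) = Set.range (lapEig (p := p) G) :=
  (bigLap_posSemidef (p := p) G).isHermitian.spectrum_real_eq_range_eigenvalues

lemma lapEig_le_lamMax (i : Fin n × Fin p) : lapEig G i ≤ lamMax p G := by
  rw [lamMax, spectrum_bigLap]
  exact le_csSup (Set.finite_range _).bddAbove ⟨i, rfl⟩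

lemma lamMin_le_lapEig (i : Fin n × Fin p) (hi : 0 < lapEig G i) : lamMin p G ≤ lapEig G i := by
  rw [lamMin, spectrum_bigLap]
  exact csInf_le ⟨0, fun x hx => hx.2.le⟩ ⟨⟨i, rfl⟩, hi⟩

lemma norm_sqrtLap_sq_eq_sum (x : Stk n p) :
    ‖sqrtLap p G x‖ ^ 2 = ∑ i, lapEig G i * ⟪lapBasis G i, x⟫_ℝ ^ 2 := by
  rw [norm_sqrtLap_sq]
  have h : ∀ i, ⟪lapBasis G i, lapOp G x⟫_ℝ = lapEig G i * ⟪lapBasis G i, x⟫_ℝ := by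
    intro i
    rw [← sqrtLap_sqrtLap, ← sqrtLap_inner, ← sqrtLap_inner, sqrtLap_sqrtLap, lapOp_lapBasis,
      inner_smul_left]
    rfl
  rw [← (lapBasis G).sum_inner_mul_inner]
  refine Finset.sum_congr rfl fun i _ => ?_
  rw [real_inner_comm, h]
  ring

lemma norm_sq_eq_sum_lapBasis (x : Stk n p) : ‖x‖ ^ 2 = ∑ i, ⟪lapBasis G i, x⟫_ℝ ^ 2 := by
  rw [← real_inner_self_eq_norm_sq, ← (lapBasis G).sum_inner_mul_inner]
  refine Finset.sum_congr rfl fun i _ => ?_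
  rw [real_inner_comm, sq]

lemma norm_sqrtLap_sq_le (x : Stk n p) : ‖sqrtLap p G x‖ ^ 2 ≤ lamMax p G * ‖x‖ ^ 2 := by
  rw [norm_sqrtLap_sq_eq_sum, norm_sq_eq_sum_lapBasis G, Finset.mul_sum]
  exact Finset.sum_le_sum fun i _ =>
    mul_le_mul_of_nonneg_right (lapEig_le_lamMax G i) (sq_nonneg _)

lemma le_norm_sqrtLap_sq {x : Stk n p} (hx : ∀ w, sqrtLap p G w = 0 → ⟪w, x⟫_ℝ = 0) :
    lamMin p G * ‖x‖ ^ 2 ≤ ‖sqrtLap p G x‖ ^ 2 := by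
  rw [norm_sqrtLap_sq_eq_sum, norm_sq_eq_sum_lapBasis G, Finset.mul_sum]
  refine Finset.sum_le_sum fun i _ => ?_
  rcases ((bigLap_posSemidef (p := p) G).eigenvalues_nonneg i).eq_or_lt with h0 | h0
  · have : sqrtLap p G (lapBasis G i) = 0 := by
      rw [sqrtLap_eq_zero_iff, lapOp_lapBasis, lapEig, ← h0, zero_smul]
    rw [hx _ this]
    simp
  · exact mul_le_mul_of_nonneg_right (lamMin_le_lapEig G i h0) (sq_nonneg _)

lemma exists_lapEig_pos (hG : G.Connected) (hn : 2 ≤ n) (hp : 1 ≤ p) :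
    ∃ i : Fin n × Fin p, 0 < lapEig G i := by
  by_contra! hall
  have hz : ∀ x : Stk n p, lapOp G x = 0 := by
    intro x
    rw [← sqrtLap_eq_zero_iff]
    have : ‖sqrtLap p G x‖ ^ 2 ≤ 0 := by
      rw [norm_sqrtLap_sq_eq_sum]
      exact Finset.sum_nonpos fun i _ => mul_nonpos_of_nonpos_of_nonneg (hall i) (sq_nonneg _)
    simpa using le_antisymm this (sq_nonneg _)
  obtain ⟨u, hu⟩ := (lapOp_eq_zero_iff G hG _).1
    (hz (WithLp.toLp 2 fun ij => if ij.1 = ⟨0, by omega⟩ then 1 else 0))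
  have h0 := congrArg (fun w : Stk n p => w (⟨0, by omega⟩, ⟨0, by omega⟩)) hu
  have h1 := congrArg (fun w : Stk n p => w (⟨1, by omega⟩, ⟨0, by omega⟩)) hu
  simp [consensus] at h0 h1
  rw [← h0] at h1
  exact zero_ne_one h1

lemma lamMin_pos (hG : G.Connected) (hn : 2 ≤ n) (hp : 1 ≤ p) : 0 < lamMin p G := by
  have hfin : {l | l ∈ spectrum ℝ (bigLap p G) ∧ 0 < l}.Finite := by
    rw [spectrum_bigLap]
    exact (Set.finite_range _).subset fun x hx => hx.1
  obtain ⟨i, hi⟩ := exists_lapEig_pos (p := p) G hG hn hp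
  have hne : {l | l ∈ spectrum ℝ (bigLap p G) ∧ 0 < l}.Nonempty :=
    ⟨lapEig G i, by rw [spectrum_bigLap]; exact ⟨i, rfl⟩, hi⟩
  exact (hne.csInf_mem hfin).2

lemma lamMin_le_lamMax (hG : G.Connected) (hn : 2 ≤ n) (hp : 1 ≤ p) :
    lamMin p G ≤ lamMax p G := by
  obtain ⟨i, hi⟩ := exists_lapEig_pos (p := p) G hG hn hp
  exact (lamMin_le_lapEig G i hi).trans (lapEig_le_lamMax G i)

/-- A vector orthogonal to the consensus vectors has a preimage under `√𝐋`, of controlled norm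
if taken orthogonal to the kernel. -/
lemma exists_sqrtLap_eq (hG : G.Connected) (hn : 2 ≤ n) (hp : 1 ≤ p) {w : Stk n p}
    (hw : ∀ u, ⟪w, consensus n u⟫_ℝ = 0) :
    ∃ y, sqrtLap p G y = w ∧ ‖y‖ ^ 2 ≤ ‖w‖ ^ 2 / lamMin p G := by
  set T : Stk n p →ₗ[ℝ] Stk n p := (sqrtLap p G : Stk n p →ₗ[ℝ] Stk n p) with hT
  have hsymm : T.IsSymmetric := (sqrtLap_isSelfAdjoint G).isSymmetric
  have hmem : w ∈ LinearMap.range T := by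
    have h1 : (LinearMap.range T)ᗮ = LinearMap.ker T := hsymm.orthogonal_range
    have h2 : w ∈ (LinearMap.ker T)ᗮ := by
      rw [Submodule.mem_orthogonal']
      intro k hk
      obtain ⟨u, rfl⟩ := (lapOp_eq_zero_iff G hG k).1
        ((sqrtLap_eq_zero_iff G k).1 (LinearMap.mem_ker.1 hk))
      exact hw u
    rwa [← h1, Submodule.orthogonal_orthogonal] at h2
  obtain ⟨y₀, hy₀⟩ := hmem
  obtain ⟨k, hk, y, hy, rfl⟩ := (LinearMap.ker T).exists_add_mem_mem_orthogonal y₀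
  have hTy : sqrtLap p G y = w := by
    rw [map_add, LinearMap.mem_ker.1 hk, zero_add] at hy₀
    exact hy₀
  refine ⟨y, hTy, ?_⟩
  rw [le_div_iff₀ (lamMin_pos G hG hn hp), mul_comm, ← hTy]
  exact le_norm_sqrtLap_sq G fun k hk => (Submodule.mem_orthogonal _ _).1 hy k hk

end spectral

/-! ### Smoothness of the maximizer in the conjugate -/

section smoothness

lemma norm_iteratedFDeriv_comp_clm_le {D E F' : Type*} [NormedAddCommGroup D] [NormedSpace ℝ D]
    [NormedAddCommGroup E] [NormedSpace ℝ E] [NormedAddCommGroup F'] [NormedSpace ℝ F']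
    (L : D →L[ℝ] E) {f : E → F'} {U : Set E} (hU : IsOpen U) {m j : ℕ} (hf : ContDiffOn ℝ m f U)
    (hj : j ≤ m) {x : D} (hx : L x ∈ U) :
    ‖iteratedFDeriv ℝ j (fun x => f (L x)) x‖ ≤ ‖iteratedFDeriv ℝ j f (L x)‖ * ‖L‖ ^ j := by
  have hV : IsOpen (L ⁻¹' U) := hU.preimage L.continuous
  have h := L.iteratedFDerivWithin_comp_right hf hU.uniqueDiffOn hV.uniqueDiffOn hx
    (i := j) (by exact_mod_cast hj)
  rw [iteratedFDerivWithin_of_isOpen j hV hx, iteratedFDerivWithin_of_isOpen j hU hx] at h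
  change ‖iteratedFDeriv ℝ j (f ∘ L) x‖ ≤ _
  rw [h]
  refine (ContinuousMultilinearMap.norm_compContinuousLinearMap_le _ _).trans_eq ?_
  simp

/-- A map that is `C^k` on a closed ball, up to the boundary, has bounded derivatives inside. -/
lemma exists_boundedDerivs_ball {E F' : Type*} [NormedAddCommGroup E] [NormedSpace ℝ E]
    [FiniteDimensional ℝ E] [NormedAddCommGroup F'] [NormedSpace ℝ F'] {f : E → F'} {c : E} {ρ : ℝ}
    (hρ : 0 < ρ) {k : ℕ} (hf : ContDiffOn ℝ k f (Metric.closedBall c ρ)) :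
    ∃ C : ℝ, 0 ≤ C ∧ BoundedDerivs k C f (Metric.ball c ρ) := by
  have hint : (interior (Metric.closedBall c ρ)).Nonempty :=
    ⟨c, Metric.ball_subset_interior_closedBall (Metric.mem_ball_self hρ)⟩
  have huniq : UniqueDiffOn ℝ (Metric.closedBall c ρ) :=
    uniqueDiffOn_convex (convex_closedBall c ρ) hint
  have hex : ∀ j : Fin (k + 1), ∃ C : ℝ, ∀ x ∈ Metric.closedBall c ρ,
      ‖iteratedFDerivWithin ℝ j f (Metric.closedBall c ρ) x‖ ≤ C := fun j =>
    (isCompact_closedBall c ρ).exists_bound_of_continuousOn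
      (hf.continuousOn_iteratedFDerivWithin (by exact_mod_cast Nat.lt_succ_iff.1 j.isLt) huniq)
  choose C hC using hex
  refine ⟨∑ j, |C j|, Finset.sum_nonneg fun _ _ => abs_nonneg _,
    hf.mono Metric.ball_subset_closedBall, fun j hj x hx => ?_⟩
  have hx' := Metric.ball_subset_closedBall hx
  have hat : ContDiffAt ℝ k f x :=
    hf.contDiffAt (Filter.mem_of_superset (Metric.isOpen_ball.mem_nhds hx)
      Metric.ball_subset_closedBall)
  have h1 := hC ⟨j, Nat.lt_succ_of_le hj⟩ x hx'
  rw [iteratedFDerivWithin_eq_iteratedFDeriv huniq (hat.of_le (by exact_mod_cast hj)) hx'] at h1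
  refine h1.trans ((le_abs_self _).trans ?_)
  exact Finset.single_le_sum (f := fun j => |C j|) (fun _ _ => abs_nonneg _) (Finset.mem_univ _)

variable {E : Type*} [NormedAddCommGroup E] [InnerProductSpace ℝ E] [CompleteSpace E] {g : E → ℝ}
  {μ : ℝ}

lemma hessian_coercive (hg : StrongConvexOn Set.univ μ g) {U : Set E} (hU : IsOpen U)
    (hd : DifferentiableOn ℝ g U) {x : E} (hx : x ∈ U) {H : E →L[ℝ] E}
    (hH : HasFDerivAt (gradient g) H x) (u : E) : μ * ‖u‖ ^ 2 ≤ ⟪H u, u⟫_ℝ := by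
  have hline : HasDerivAt (fun t : ℝ => ⟪gradient g (x + t • u), u⟫_ℝ) ⟪H u, u⟫_ℝ 0 := by
    have h1 : HasFDerivAt (gradient g) H (x + (0 : ℝ) • u) := by simpa using hH
    have h2 : HasDerivAt (fun t : ℝ => x + t • u) u 0 := by
      simpa using ((hasDerivAt_id (0 : ℝ)).smul_const u).const_add x
    have h3 := h1.comp_hasDerivAt (0 : ℝ) h2
    have h4 := ((innerSL ℝ u).hasFDerivAt (x := gradient g (x + (0 : ℝ) • u))).comp_hasDerivAt
      (0 : ℝ) h3
    rw [innerSL_apply_apply, real_inner_comm] at h4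
    exact h4.congr_of_eventuallyEq (Filter.Eventually.of_forall fun t => real_inner_comm _ _)
  refine ge_of_tendsto hline.tendsto_slope_zero_right ?_
  have hmem : ∀ᶠ t in 𝓝[>] (0 : ℝ), x + t • u ∈ U := by
    have : Filter.Tendsto (fun t : ℝ => x + t • u) (𝓝 0) (𝓝 (x + (0 : ℝ) • u)) :=
      Continuous.tendsto (by fun_prop) 0
    rw [zero_smul, add_zero] at this
    exact (this.mono_left nhdsWithin_le_nhds).eventually (hU.mem_nhds hx)
  filter_upwards [hmem, self_mem_nhdsWithin] with t ht ht0
  have ht0' : 0 < t := ht0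
  have h1 := gradient_strong hg (hd.differentiableAt (hU.mem_nhds hx)) (x + t • u)
  have h2 := gradient_strong hg (hd.differentiableAt (hU.mem_nhds ht)) x
  rw [norm_sub_rev x] at h2
  simp only [add_sub_cancel_left, sub_add_cancel_left, norm_smul, Real.norm_eq_abs, mul_pow,
    sq_abs, inner_neg_right, inner_smul_right] at h1 h2
  simp only [zero_add, zero_smul, add_zero, smul_eq_mul]
  rw [inv_mul_eq_div, le_div_iff₀ ht0']
  refine le_of_mul_le_mul_left ?_ ht0'
  nlinarith

variable [FiniteDimensional ℝ E]

lemma isUnit_of_coercive (hμ : 0 < μ) {H : E →L[ℝ] E} (hH : ∀ u, μ * ‖u‖ ^ 2 ≤ ⟪H u, u⟫_ℝ) :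
    IsUnit H := by
  have hinj : Function.Injective (H : E →ₗ[ℝ] E) := by
    rw [← LinearMap.ker_eq_bot, LinearMap.ker_eq_bot']
    intro u hu
    have hu' : H u = 0 := hu
    have h1 := hH u
    rw [hu', inner_zero_left] at h1
    have h2 : ‖u‖ ^ 2 ≤ 0 := by nlinarith [sq_nonneg ‖u‖]
    simpa using le_antisymm h2 (sq_nonneg _)
  rw [ContinuousLinearMap.isUnit_iff_bijective]
  exact ⟨hinj, LinearMap.injective_iff_surjective.1 hinj⟩

/-- If `g` is strongly convex and `C^{k+2}` on a closed ball, the maximizer in its conjugate is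
`C^{k+1}`, with bounded derivatives, wherever it lies in the open ball: by
`D 𝐱* = (D²g)⁻¹ ∘ 𝐱*`, bounds for derivatives of one order give them for the next. -/
lemma exists_boundedDerivs_argmaxConj (hg : StrongConvexOn Set.univ μ g) (hμ : 0 < μ) {c : E}
    {ρ : ℝ} (hρ : 0 < ρ) {k : ℕ} (hgs : ContDiffOn ℝ (k + 2 : ℕ) g (Metric.closedBall c ρ)) :
    ∃ C : ℝ, 0 ≤ C ∧
      BoundedDerivs (k + 1) C (argmaxConj g) (argmaxConj g ⁻¹' Metric.ball c ρ) := by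
  set B := Metric.closedBall c ρ with hB
  set U := Metric.ball c ρ with hU
  have hUB : U ⊆ B := Metric.ball_subset_closedBall
  have hUo : IsOpen U := Metric.isOpen_ball
  have huniq : UniqueDiffOn ℝ B := uniqueDiffOn_convex (convex_closedBall c ρ)
    ⟨c, Metric.ball_subset_interior_closedBall (Metric.mem_ball_self hρ)⟩
  have hnhds : ∀ x ∈ U, B ∈ 𝓝 x := fun x hx => Filter.mem_of_superset (hUo.mem_nhds hx) hUB
  have hdU : DifferentiableOn ℝ g U :=
    (hgs.differentiableOn (by simp)).mono hUB
  -- the gradient and the Hessian, as derivatives within the closed ball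
  set J := (InnerProductSpace.toDual ℝ E).symm.toContinuousLinearEquiv.toContinuousLinearMap
  set q : E → E := fun x => J (fderivWithin ℝ g B x) with hq
  have hqs : ContDiffOn ℝ (k + 1 : ℕ) q B :=
    J.contDiff.comp_contDiffOn (hgs.fderivWithin huniq (by norm_cast))
  have hqU : ∀ x ∈ U, q x = gradient g x := by
    intro x hx
    simp only [hq]
    rw [fderivWithin_of_mem_nhds (hnhds x hx)]
    rfl
  set H : E → E →L[ℝ] E := fderivWithin ℝ q B with hHdef
  have hHs : ContDiffOn ℝ k H B := hqs.fderivWithin huniq (by norm_cast)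
  have hHU : ∀ x ∈ U, HasFDerivAt (gradient g) (H x) x := by
    intro x hx
    have h1 : HasFDerivAt q (H x) x :=
      ((hqs.differentiableOn (by simp)) x (hUB hx)).hasFDerivWithinAt.hasFDerivAt (hnhds x hx)
    refine h1.congr_of_eventuallyEq ?_
    filter_upwards [hUo.mem_nhds hx] with y hy using (hqU y hy).symm
  have hcoer : ∀ x ∈ B, ∀ u, μ * ‖u‖ ^ 2 ≤ ⟪H x u, u⟫_ℝ := by
    intro x hx u
    have hcl : x ∈ closure U := by rwa [hU, closure_ball c hρ.ne']
    have hcont : ContinuousWithinAt (fun x => ⟪H x u, u⟫_ℝ) U x := by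
      have h1 : ContinuousWithinAt H U x := (hHs.continuousOn x hx).mono hUB
      exact (h1.clm_apply continuousWithinAt_const).inner continuousWithinAt_const
    exact ContinuousWithinAt.closure_le hcl continuousWithinAt_const hcont
      fun y hy => hessian_coercive hg hUo hdU hy (hHU y hy) u
  have hunit : ∀ x ∈ B, IsUnit (H x) := fun x hx => isUnit_of_coercive hμ (hcoer x hx)
  obtain ⟨A, hA0, hA⟩ := exists_boundedDerivs_ball (f := fun x => Ring.inverse (H x)) hρ
    (k := k) (by
    intro x hx
    obtain ⟨v, hv⟩ := hunit x hx
    have h1 : ContDiffAt ℝ k Ring.inverse (H x) := by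
      rw [← hv]; exact contDiffAt_ringInverse ℝ v
    exact h1.comp_contDiffWithinAt x (hHs x hx))
  set V := argmaxConj g ⁻¹' U with hV
  have hxc := argmaxConj_continuous hg hμ
  have hVo : IsOpen V := hUo.preimage hxc
  have hder : ∀ z ∈ V, HasFDerivAt (argmaxConj g) (Ring.inverse (H (argmaxConj g z))) z := by
    intro z hz
    obtain ⟨v, hv⟩ := hunit _ (hUB hz)
    have h1 : HasFDerivAt (gradient g)
        (ContinuousLinearEquiv.unitsEquiv ℝ E v : E →L[ℝ] E) (argmaxConj g z) := by
      have : (ContinuousLinearEquiv.unitsEquiv ℝ E v : E →L[ℝ] E) = v := by ext; rfl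
      rw [this, hv]
      exact hHU _ hz
    have h2 := HasFDerivAt.of_local_left_inverse hxc.continuousAt h1 (by
      filter_upwards [hVo.mem_nhds hz] with w hw
      exact gradient_argmaxConj hg hμ (hdU.differentiableAt (hUo.mem_nhds hw)))
    rw [← hv, Ring.inverse_unit]
    exact h2
  have hbd : ∀ z ∈ V, ‖argmaxConj g z‖ ≤ ‖c‖ + ρ := by
    intro z hz
    have h1 := mem_ball_iff_norm.1 (show argmaxConj g z ∈ Metric.ball c ρ from hz)
    have h2 := norm_le_norm_add_norm_sub' (argmaxConj g z) c
    linarith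
  have hind : ∀ j ≤ k + 1, ∃ C : ℝ, 0 ≤ C ∧ BoundedDerivs j C (argmaxConj g) V := by
    intro j
    induction j with
    | zero =>
      refine fun _ => ⟨‖c‖ + ρ, by positivity, contDiffOn_zero.2 hxc.continuousOn,
        fun j hj z hz => ?_⟩
      obtain rfl : j = 0 := by omega
      simpa using hbd z hz
    | succ j ih =>
      intro hj
      obtain ⟨C, hC0, hC⟩ := ih (by omega)
      have h1 := BoundedDerivs.comp hVo hUo hA0 (hA.of_le (show j ≤ k by omega)) hC
        (fun z hz => hz)
      exact ⟨max (‖c‖ + ρ) (j.factorial * A * (max 1 C) ^ j), le_max_of_le_left (by positivity),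
        (h1.mono (le_max_right _ _)).of_hasFDerivAt hVo hder
          fun z hz => (hbd z hz).trans (le_max_left _ _)⟩
  exact hind (k + 1) le_rfl

end smoothness

/-! ### The dual function -/

section dualFunction

variable {n p : ℕ} (G : SimpleGraph (Fin n)) [DecidableRel G.Adj] {f : Fin n → Loc p → ℝ} {μ : ℝ}

/-- The gradient `√𝐋 𝐱*(√𝐋 y)` of the dual function. -/
def dualGrad (f : Fin n → Loc p → ℝ) (y : Stk n p) : Stk n p :=
  sqrtLap p G (xStar f (sqrtLap p G y))

section

variable (hf : ∀ i, StrongConvexOn Set.univ μ (f i)) (hμ : 0 < μ)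
include hf hμ

lemma dual_eq (y : Stk n p) : dual G f y = conjVal (F f) (sqrtLap p G y) := by
  have h := argmaxConj_spec (F_strongConvexOn hf) hμ (sqrtLap p G y)
  rw [dual]
  simp only [← sqrtLap_inner]
  exact le_antisymm (ciSup_le h) (le_ciSup (f := fun x => ⟪sqrtLap p G y, x⟫_ℝ - F f x)
    ⟨_, by rintro _ ⟨x, rfl⟩; exact h x⟩ (argmaxConj (F f) (sqrtLap p G y)))

lemma dual_lower (y y' : Stk n p) :
    dual G f y + ⟪dualGrad G f y, y' - y⟫_ℝ ≤ dual G f y' := by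
  have := conjVal_lower (F_strongConvexOn hf) hμ (sqrtLap p G y) (sqrtLap p G y')
  rw [dual_eq G hf hμ, dual_eq G hf hμ, dualGrad, sqrtLap_inner, map_sub, real_inner_comm]
  exact this

lemma dual_upper (y y' : Stk n p) :
    dual G f y' ≤ dual G f y + ⟪dualGrad G f y, y' - y⟫_ℝ
      + lamMax p G / μ / 2 * ‖y' - y‖ ^ 2 := by
  have h1 := conjVal_upper (F_strongConvexOn hf) hμ (sqrtLap p G y) (sqrtLap p G y')
  rw [dual_eq G hf hμ, dual_eq G hf hμ, dualGrad, sqrtLap_inner, map_sub, real_inner_comm]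
  refine h1.trans (add_le_add le_rfl ?_)
  rw [← map_sub, div_le_iff₀ (by positivity)]
  refine (norm_sqrtLap_sq_le G _).trans_eq ?_
  field_simp

end

/-- A function enclosed between its tangent planes and paraboloids is differentiable. -/
lemma hasFDerivAt_of_sandwich {E : Type*} [NormedAddCommGroup E] [InnerProductSpace ℝ E]
    {φ : E → ℝ} {g : E → E} {R : ℝ}
    (hlow : ∀ y y', φ y + ⟪g y, y' - y⟫_ℝ ≤ φ y')
    (hup : ∀ y y', φ y' ≤ φ y + ⟪g y, y' - y⟫_ℝ + R / 2 * ‖y' - y‖ ^ 2) (y : E) :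
    HasFDerivAt φ (innerSL ℝ (g y)) y := by
  have h1 : (fun y' => φ y' - φ y - innerSL ℝ (g y) (y' - y)) =O[𝓝 y]
      fun y' => ‖y' - y‖ ^ 2 := by
    refine Asymptotics.IsBigO.of_bound (R / 2) (Filter.Eventually.of_forall fun y' => ?_)
    have a1 := hlow y y'
    have a2 := hup y y'
    rw [innerSL_apply_apply, Real.norm_eq_abs, abs_of_nonneg (by linarith), norm_pow, norm_norm]
    linarith
  rw [hasFDerivAt_iff_isLittleO]
  refine h1.trans_isLittleO ?_
  have h2 : (fun x : E => ‖x‖ ^ 2) =o[𝓝 0] fun x : E => x :=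
    Asymptotics.isLittleO_norm_pow_id one_lt_two
  have h3 : Filter.Tendsto (fun y' => y' - y) (𝓝 y) (𝓝 0) := by
    have : Filter.Tendsto (fun y' => y' - y) (𝓝 y) (𝓝 (y - y)) :=
      Continuous.tendsto (by fun_prop) y
    rwa [sub_self] at this
  exact h2.comp_tendsto h3

/-- Derivatives of the gradient are derivatives of the function. -/
lemma norm_iteratedFDeriv_of_hasFDerivAt {E : Type*} [NormedAddCommGroup E]
    [InnerProductSpace ℝ E] [CompleteSpace E] {φ : E → ℝ} {g : E → E}
    (h : ∀ y, HasFDerivAt φ (innerSL ℝ (g y)) y) (j : ℕ) (y : E) :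
    ‖iteratedFDeriv ℝ (j + 1) φ y‖ = ‖iteratedFDeriv ℝ j g y‖ := by
  rw [← norm_iteratedFDeriv_fderiv]
  have : fderiv ℝ φ = InnerProductSpace.toDual ℝ E ∘ g := by
    funext y
    exact (h y).fderiv
  rw [this]
  exact (InnerProductSpace.toDual ℝ E).norm_iteratedFDeriv_comp_left g y j

section

variable (hf : ∀ i, StrongConvexOn Set.univ μ (f i)) (hμ : 0 < μ)
include hf hμ

lemma dual_hasFDerivAt (y : Stk n p) :
    HasFDerivAt (dual G f) (innerSL ℝ (dualGrad G f y)) y :=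
  hasFDerivAt_of_sandwich (dual_lower G hf hμ) (dual_upper G hf hμ) y

/-- The gradient of the dual function is smooth, with bounded derivatives, at the dual points whose
primal point is interior to the ball on which `F` is smooth. -/
lemma exists_boundedDerivs_dualGrad {s : ℕ} {c : Stk n p} {ρ : ℝ} (hρ : 0 < ρ)
    (hF : ContDiffOn ℝ ((s + 2 : ℕ) : WithTop ℕ∞) (F f) (Metric.closedBall c ρ)) :
    ∃ C, BoundedDerivs (s + 1) C (dualGrad G f)
      {y | ‖xStar f (sqrtLap p G y) - c‖ < ρ} := by
  obtain ⟨C, hC0, hC⟩ := exists_boundedDerivs_argmaxConj (F_strongConvexOn hf) hμ hρ (k := s) hF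
  set V := argmaxConj (F f) ⁻¹' Metric.ball c ρ
  have hVo : IsOpen V :=
    Metric.isOpen_ball.preimage (argmaxConj_continuous (F_strongConvexOn hf) hμ)
  have hset : {y | ‖xStar f (sqrtLap p G y) - c‖ < ρ} = sqrtLap p G ⁻¹' V := by
    ext y
    simp [V, xStar, dist_eq_norm]
  have hV'o : IsOpen (sqrtLap p G ⁻¹' V) := hVo.preimage (sqrtLap p G).continuous
  rw [hset]
  have h1 : BoundedDerivs (s + 1) (C * (max 1 ‖sqrtLap p G‖) ^ (s + 1))
      (fun y => xStar f (sqrtLap p G y)) (sqrtLap p G ⁻¹' V) := by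
    refine ⟨hC.contDiffOn.comp (sqrtLap p G).contDiff.contDiffOn (fun y hy => hy),
      fun j hj y hy => ?_⟩
    refine (norm_iteratedFDeriv_comp_clm_le (sqrtLap p G) hVo hC.contDiffOn hj hy).trans ?_
    refine mul_le_mul (hC.norm_le j hj _ hy) ?_ (by positivity) hC0
    calc ‖sqrtLap p G‖ ^ j ≤ (max 1 ‖sqrtLap p G‖) ^ j := by gcongr; exact le_max_right _ _
      _ ≤ _ := pow_le_pow_right₀ (le_max_left _ _) hj
  exact ⟨_, h1.clm_comp hV'o (sqrtLap p G)⟩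

end

end dualFunction

/-! ### The heavy-ball system of a smooth convex function -/

section heavyBall

variable {E : Type*} [NormedAddCommGroup E] [InnerProductSpace ℝ E]

/-- `φ` is convex and `R`-smooth with gradient `g`, is bounded below by `m`, and attains `m`
at `ys`. -/
structure SmoothConvex (φ : E → ℝ) (g : E → E) (R m : ℝ) (ys : E) : Prop where
  lower : ∀ y y', φ y + ⟪g y, y' - y⟫_ℝ ≤ φ y'
  upper : ∀ y y', φ y' ≤ φ y + ⟪g y, y' - y⟫_ℝ + R / 2 * ‖y' - y‖ ^ 2
  lip : ∀ y y', ‖g y' - g y‖ ≤ R * ‖y' - y‖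
  ge : ∀ y, m ≤ φ y
  le : φ ys ≤ m

/-- The heavy-ball field `[-(5/t) v - 4 g(y); v; 1]`. -/
def hbField (g : E → E) (ζ : E × E × ℝ) : E × E × ℝ :=
  (-((5 / ζ.2.2) • ζ.1) - (4 : ℝ) • g ζ.2.1, ζ.1, 1)

/-- The Lyapunov function of the heavy-ball system. -/
def lyap (φ : E → ℝ) (m : ℝ) (ys : E) (ζ : E × E × ℝ) : ℝ :=
  ζ.2.2 ^ 2 / 16 * ‖ζ.1‖ ^ 2 + ‖ζ.2.1 + (ζ.2.2 / 4) • ζ.1 - ys‖ ^ 2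
    + ζ.2.2 ^ 2 * (φ ζ.2.1 - m)

lemma lyap_gap (φ : E → ℝ) (m : ℝ) (ys : E) (ζ : E × E × ℝ) :
    ζ.2.2 ^ 2 * (φ ζ.2.1 - m) ≤ lyap φ m ys ζ := by
  have h1 := sq_nonneg ‖ζ.2.1 + (ζ.2.2 / 4) • ζ.1 - ys‖
  have h2 : 0 ≤ ζ.2.2 ^ 2 / 16 * ‖ζ.1‖ ^ 2 := by positivity
  rw [lyap]
  linarith

variable {φ : E → ℝ} {g : E → E} {R m : ℝ} {ys : E}

namespace SmoothConvex

/-- A gradient step of length `1/R` shows that small function values force small gradients. -/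
lemma norm_sq_le (hφ : SmoothConvex φ g R m ys) (hR : 0 < R) (y : E) :
    ‖g y‖ ^ 2 ≤ 2 * R * (φ y - m) := by
  have h1 := hφ.upper y (y - R⁻¹ • g y)
  have h2 := hφ.ge (y - R⁻¹ • g y)
  have e : y - R⁻¹ • g y - y = -(R⁻¹ • g y) := by abel
  rw [e, norm_neg, inner_neg_right, inner_smul_right, real_inner_self_eq_norm_sq, norm_smul,
    Real.norm_eq_abs, mul_pow, sq_abs] at h1
  have h3 : R / 2 * (R⁻¹ ^ 2 * ‖g y‖ ^ 2) = R⁻¹ * ‖g y‖ ^ 2 / 2 := by field_simp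
  rw [h3] at h1
  have h4 : R⁻¹ * ‖g y‖ ^ 2 ≤ 2 * (φ y - m) := by linarith
  rw [inv_mul_le_iff₀ hR] at h4
  linarith

lemma gap_nonneg (hφ : SmoothConvex φ g R m ys) (y : E) : 0 ≤ φ y - m := sub_nonneg.2 (hφ.ge y)

section

variable (hφ : SmoothConvex φ g R m ys) (ζ : E × E × ℝ)
include hφ

lemma lyap_v : (ζ.2.2 * ‖ζ.1‖) ^ 2 ≤ 16 * lyap φ m ys ζ := by
  have := mul_nonneg (sq_nonneg ζ.2.2) (hφ.gap_nonneg ζ.2.1)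
  have h2 := sq_nonneg ‖ζ.2.1 + (ζ.2.2 / 4) • ζ.1 - ys‖
  rw [lyap]
  nlinarith

lemma lyap_mid : ‖ζ.2.1 + (ζ.2.2 / 4) • ζ.1 - ys‖ ^ 2 ≤ lyap φ m ys ζ := by
  have h1 := mul_nonneg (sq_nonneg ζ.2.2) (hφ.gap_nonneg ζ.2.1)
  have h2 : 0 ≤ ζ.2.2 ^ 2 / 16 * ‖ζ.1‖ ^ 2 := by positivity
  rw [lyap]
  linarith

lemma lyap_grad (hR : 0 < R) : (ζ.2.2 * ‖g ζ.2.1‖) ^ 2 ≤ 2 * R * lyap φ m ys ζ := by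
  have h1 := lyap_gap φ m ys ζ
  have h2 := hφ.norm_sq_le hR ζ.2.1
  have h3 := mul_le_mul_of_nonneg_left h2 (sq_nonneg ζ.2.2)
  nlinarith

lemma lyap_y : ‖ζ.2.1 - ys‖ ^ 2 ≤ 2 * lyap φ m ys ζ := by
  have h1 := mul_nonneg (sq_nonneg ζ.2.2) (hφ.gap_nonneg ζ.2.1)
  have e : ζ.2.1 - ys = (ζ.2.1 + (ζ.2.2 / 4) • ζ.1 - ys) - (ζ.2.2 / 4) • ζ.1 := by abel
  have h2 := norm_sub_le (ζ.2.1 + (ζ.2.2 / 4) • ζ.1 - ys) ((ζ.2.2 / 4) • ζ.1)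
  rw [← e] at h2
  have h3 : ‖(ζ.2.2 / 4) • ζ.1‖ ^ 2 = ζ.2.2 ^ 2 / 16 * ‖ζ.1‖ ^ 2 := by
    rw [norm_smul, mul_pow, Real.norm_eq_abs, sq_abs]
    ring
  have h4 : ‖ζ.2.1 - ys‖ ^ 2 ≤ (‖ζ.2.1 + (ζ.2.2 / 4) • ζ.1 - ys‖ + ‖(ζ.2.2 / 4) • ζ.1‖) ^ 2 := by
    gcongr
  rw [lyap]
  nlinarith [sq_nonneg (‖ζ.2.1 + (ζ.2.2 / 4) • ζ.1 - ys‖ - ‖(ζ.2.2 / 4) • ζ.1‖)]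

end

/-- The Lyapunov function decreases along exact solutions: its derivative is
`-(t/2) ‖v‖² + 2 t (φ(y) - m - ⟨g(y), y - ys⟩)`. -/
lemma lyap_antitone (hφ : SmoothConvex φ g R m ys) {v y : ℝ → E} {t₀ h : ℝ} (ht₀ : 0 < t₀)
    (hh : 0 ≤ h)
    (hv : ∀ x ∈ Set.Icc 0 h, HasDerivAt v (-((5 / (t₀ + x)) • v x) - (4 : ℝ) • g (y x)) x)
    (hy : ∀ x ∈ Set.Icc 0 h, HasDerivAt y (v x) x) :
    lyap φ m ys (v h, y h, t₀ + h) ≤ lyap φ m ys (v 0, y 0, t₀ + 0) := by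
  have hder : ∀ x ∈ Set.Icc 0 h, HasDerivAt (fun x => lyap φ m ys (v x, y x, t₀ + x))
      (-((t₀ + x) / 2 * ‖v x‖ ^ 2) + 2 * (t₀ + x) * (φ (y x) - m - ⟪g (y x), y x - ys⟫_ℝ)) x := by
    intro x hx
    have hpos : t₀ + x ≠ 0 := by linarith [hx.1]
    have ht : HasDerivAt (fun x => t₀ + x) 1 x := by simpa using (hasDerivAt_id x).const_add t₀
    have h1 := ((ht.pow 2).div_const 16).mul (hv x hx).norm_sq
    have h2 := (((hy x hx).add ((ht.div_const 4).smul (hv x hx))).sub_const ys).norm_sq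
    have h3 := (hasFDerivAt_of_sandwich hφ.lower hφ.upper (y x)).comp_hasDerivAt x (hy x hx)
    have h4 := (ht.pow 2).mul (h3.sub_const m)
    have h5 := (h1.add h2).add h4
    refine h5.congr_deriv ?_
    simp only [innerSL_apply_apply, Pi.add_apply, Pi.pow_apply,
      Pi.smul_apply', inner_sub_right, inner_add_right, inner_add_left, inner_sub_left,
      inner_neg_right, inner_smul_right, inner_smul_left, Function.comp_apply,
      RCLike.conj_to_real]
    have c1 : ⟪g (y x), v x⟫_ℝ = ⟪v x, g (y x)⟫_ℝ := real_inner_comm _ _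
    have c2 : ⟪g (y x), y x⟫_ℝ = ⟪y x, g (y x)⟫_ℝ := real_inner_comm _ _
    have c3 : ⟪g (y x), ys⟫_ℝ = ⟪ys, g (y x)⟫_ℝ := real_inner_comm _ _
    rw [c1, c2, c3, real_inner_self_eq_norm_sq]
    field_simp
    ring
  have hanti : AntitoneOn (fun x => lyap φ m ys (v x, y x, t₀ + x)) (Set.Icc 0 h) := by
    refine antitoneOn_of_deriv_nonpos (convex_Icc 0 h)
      (fun x hx => (hder x hx).continuousAt.continuousWithinAt)
      (fun x hx => (hder x (interior_subset hx)).differentiableAt.differentiableWithinAt)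
      fun x hx => ?_
    have hx' := interior_subset hx
    rw [(hder x hx').deriv]
    have hpos : 0 ≤ t₀ + x := by linarith [hx'.1]
    have h1 := hφ.lower (y x) ys
    have h2 := hφ.le
    have h3 : φ (y x) - m - ⟪g (y x), y x - ys⟫_ℝ ≤ 0 := by
      rw [← neg_sub ys (y x), inner_neg_right]
      linarith
    have h4 : 0 ≤ (t₀ + x) / 2 * ‖v x‖ ^ 2 := by positivity
    nlinarith
  exact hanti ⟨le_rfl, hh⟩ ⟨hh, le_rfl⟩ hh

/-- The effect on the Lyapunov function of an error of size `ε` in the natural scaling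
`t v`, `√R t y`. -/
lemma lyap_perturb (hφ : SmoothConvex φ g R m ys) {α κ t ε : ℝ} (hα : 0 < α) (hR : R = α ^ 2)
    (hκ : 1 ≤ κ) (hακ : 1 ≤ α * κ) (ht : 1 ≤ t) (hε0 : 0 ≤ ε) (hε1 : ε ≤ 1) {v v' y y' : E}
    (hv : t * ‖v' - v‖ ≤ 2 * ε) (hy : α * (t * ‖y' - y‖) ≤ 2 * ε)
    (hl : lyap φ m ys (v, y, t) ≤ κ ^ 2) :
    lyap φ m ys (v', y', t) ≤ lyap φ m ys (v, y, t) + 22 * κ ^ 2 * ε := by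
  have hR0 : 0 < R := by rw [hR]; positivity
  have ht0 : 0 < t := by linarith
  have sq_lemma : ∀ a b : E, ‖a + b‖ ^ 2 ≤ ‖a‖ ^ 2 + 2 * (‖a‖ * ‖b‖) + ‖b‖ ^ 2 := by
    intro a b
    have := norm_add_le a b
    calc ‖a + b‖ ^ 2 ≤ (‖a‖ + ‖b‖) ^ 2 := by gcongr
      _ = _ := by ring
  have hεε : ε * ε ≤ ε := mul_le_of_le_one_left hε0 hε1
  -- the kinetic term
  have b1 : t * ‖v‖ ≤ 4 * κ := by
    have := hφ.lyap_v (v, y, t)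
    refine abs_le_of_sq_le_sq' (a := t * ‖v‖) ?_ (by positivity) |>.2
    have : (t * ‖v‖) ^ 2 ≤ 16 * lyap φ m ys (v, y, t) := this
    nlinarith
  have p1 : t ^ 2 / 16 * ‖v'‖ ^ 2 ≤ t ^ 2 / 16 * ‖v‖ ^ 2 + (κ + 1 / 4) * ε := by
    have h1 := sq_lemma v (v' - v)
    rw [add_sub_cancel] at h1
    have h2 : t ^ 2 / 16 * ‖v'‖ ^ 2 ≤ t ^ 2 / 16 * (‖v‖ ^ 2 + 2 * (‖v‖ * ‖v' - v‖)
      + ‖v' - v‖ ^ 2) := by gcongr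
    have h3 : (t * ‖v‖) * (t * ‖v' - v‖) ≤ (4 * κ) * (2 * ε) := by gcongr
    have h4 : (t * ‖v' - v‖) * (t * ‖v' - v‖) ≤ (2 * ε) * (2 * ε) := by gcongr
    have e : t ^ 2 / 16 * (‖v‖ ^ 2 + 2 * (‖v‖ * ‖v' - v‖) + ‖v' - v‖ ^ 2)
        = t ^ 2 / 16 * ‖v‖ ^ 2 + ((t * ‖v‖) * (t * ‖v' - v‖)) / 8
          + ((t * ‖v' - v‖) * (t * ‖v' - v‖)) / 16 := by ring
    linarith
  -- the mixed term
  have b2 : ‖y + (t / 4) • v - ys‖ ≤ κ := by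
    have h := hφ.lyap_mid (v, y, t)
    exact abs_le_of_sq_le_sq' (h.trans hl) (by positivity) |>.2
  have d2 : ‖(y' - y) + (t / 4) • (v' - v)‖ ≤ 3 * κ * ε := by
    have h1 : ‖y' - y‖ ≤ 2 * κ * ε := by
      calc ‖y' - y‖ ≤ t * ‖y' - y‖ := le_mul_of_one_le_left (norm_nonneg _) ht
        _ ≤ (α * κ) * (t * ‖y' - y‖) := le_mul_of_one_le_left (by positivity) hακ
        _ = κ * (α * (t * ‖y' - y‖)) := by ring
        _ ≤ κ * (2 * ε) := by gcongr
        _ = 2 * κ * ε := by ring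
    have h2 : ‖(t / 4) • (v' - v)‖ ≤ ε / 2 := by
      rw [norm_smul, Real.norm_of_nonneg (by positivity)]
      linarith
    have h3 := norm_add_le (y' - y) ((t / 4) • (v' - v))
    have h4 : ε ≤ κ * ε := le_mul_of_one_le_left hε0 hκ
    linarith
  have p2 : ‖y' + (t / 4) • v' - ys‖ ^ 2 ≤ ‖y + (t / 4) • v - ys‖ ^ 2 + 15 * κ ^ 2 * ε := by
    have h1 := sq_lemma (y + (t / 4) • v - ys) ((y' - y) + (t / 4) • (v' - v))
    have e : y + (t / 4) • v - ys + ((y' - y) + (t / 4) • (v' - v)) = y' + (t / 4) • v' - ys := by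
      module
    rw [e] at h1
    have h2 : ‖y + (t / 4) • v - ys‖ * ‖(y' - y) + (t / 4) • (v' - v)‖ ≤ κ * (3 * κ * ε) := by
      gcongr
    have h3 : ‖(y' - y) + (t / 4) • (v' - v)‖ ^ 2 ≤ (3 * κ * ε) ^ 2 := by gcongr
    have h4 : (3 * κ * ε) ^ 2 ≤ 9 * κ ^ 2 * ε := by
      have : κ ^ 2 * (ε * ε) ≤ κ ^ 2 * ε := by gcongr
      have e' : (3 * κ * ε) ^ 2 = 9 * (κ ^ 2 * (ε * ε)) := by ring
      linarith
    have e' : κ * (3 * κ * ε) = 3 * κ ^ 2 * ε := by ring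
    linarith
  -- the potential term
  have p3 : t ^ 2 * (φ y' - m) ≤ t ^ 2 * (φ y - m) + (3 * κ + 2) * ε := by
    have h1 := hφ.upper y y'
    have h2 := real_inner_le_norm (g y) (y' - y)
    have h3 : t * ‖g y‖ ≤ 3 / 2 * (α * κ) := by
      have h := hφ.lyap_grad (v, y, t) hR0
      refine abs_le_of_sq_le_sq' (a := t * ‖g y‖) ?_ (by positivity) |>.2
      have h' : (t * ‖g y‖) ^ 2 ≤ 2 * R * lyap φ m ys (v, y, t) := h
      have h'' : 2 * R * lyap φ m ys (v, y, t) ≤ 2 * R * κ ^ 2 := by gcongr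
      rw [hR] at h' h''
      nlinarith [sq_nonneg (α * κ)]
    have h4 : (t * ‖g y‖) * (t * ‖y' - y‖) ≤ 3 * κ * ε := by
      calc (t * ‖g y‖) * (t * ‖y' - y‖) ≤ 3 / 2 * (α * κ) * (t * ‖y' - y‖) := by gcongr
        _ = 3 / 2 * κ * (α * (t * ‖y' - y‖)) := by ring
        _ ≤ 3 / 2 * κ * (2 * ε) := by gcongr
        _ = 3 * κ * ε := by ring
    have h6 : (α * (t * ‖y' - y‖)) * (α * (t * ‖y' - y‖)) ≤ (2 * ε) * (2 * ε) := by gcongr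
    have h7 : t ^ 2 * (φ y' - m) ≤ t ^ 2 * (φ y + ‖g y‖ * ‖y' - y‖ + R / 2 * ‖y' - y‖ ^ 2 - m) := by
      gcongr
      linarith
    have e : t ^ 2 * (φ y + ‖g y‖ * ‖y' - y‖ + R / 2 * ‖y' - y‖ ^ 2 - m)
        = t ^ 2 * (φ y - m) + (t * ‖g y‖) * (t * ‖y' - y‖)
          + (α * (t * ‖y' - y‖)) * (α * (t * ‖y' - y‖)) / 2 := by
      rw [hR]
      ring
    linarith
  have hκ2 : κ ≤ κ ^ 2 := by nlinarith
  have hfin : (κ + 1 / 4) * ε + 15 * κ ^ 2 * ε + (3 * κ + 2) * ε ≤ 22 * κ ^ 2 * ε := by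
    rw [← add_mul, ← add_mul]
    refine mul_le_mul_of_nonneg_right ?_ hε0
    nlinarith
  simp only [lyap]
  linarith

end SmoothConvex

end heavyBall

/-! ### The heavy-ball system in its natural scaling -/

section scaling

lemma exists_boundedDerivs_inv (m : ℕ) {δ : ℝ} (hδ : 0 < δ) :
    ∃ C : ℝ, 0 ≤ C ∧ ∀ (a : ℝ) (V : Set ℝ), IsOpen V → (∀ x ∈ V, δ ≤ a + x) →
      BoundedDerivs m C (fun x : ℝ => (a + x)⁻¹) V := by
  have hbd : ∀ a x : ℝ, δ ≤ a + x → ‖(a + x)⁻¹‖ ≤ δ⁻¹ := by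
    intro a x hx
    rw [norm_inv, Real.norm_of_nonneg (hδ.le.trans hx)]
    exact inv_anti₀ hδ hx
  induction m with
  | zero =>
    refine ⟨δ⁻¹, by positivity, fun a V hV h => ⟨contDiffOn_zero.2 ?_, fun j hj x hx => ?_⟩⟩
    · refine ContinuousOn.inv₀ (by fun_prop) fun x hx => ?_
      exact (lt_of_lt_of_le hδ (h x hx)).ne'
    · obtain rfl : j = 0 := by omega
      simpa using hbd a x (h x hx)
  | succ m ih =>
    obtain ⟨C, hC0, hC⟩ := ih
    set M : ℝ →L[ℝ] ℝ →L[ℝ] ℝ :=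
      (ContinuousLinearMap.toSpanSingletonLIE ℝ ℝ).toContinuousLinearEquiv.toContinuousLinearMap
      with hM
    refine ⟨max δ⁻¹ (‖-M‖ * (‖ContinuousLinearMap.mul ℝ ℝ‖ * (2 ^ m * C * C))),
      le_max_of_le_left (by positivity), fun a V hV h => ?_⟩
    have h1 := (BoundedDerivs.bilinear hV (ContinuousLinearMap.mul ℝ ℝ) hC0 (hC a V hV h)
      (hC a V hV h)).clm_comp hV (-M)
    refine (h1.mono (le_max_right _ _)).of_hasFDerivAt hV (fun x hx => ?_)
      fun x hx => (hbd a x (h x hx)).trans (le_max_left _ _)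
    have hne : a + x ≠ 0 := (lt_of_lt_of_le hδ (h x hx)).ne'
    have h2 : HasDerivAt (fun x : ℝ => (a + x)⁻¹) (-1 / (a + x) ^ 2) x := by
      have := ((hasDerivAt_id x).const_add a).inv hne
      exact this
    have h3 := h2.hasFDerivAt
    convert! h3 using 1
    ext
    simp [hM]
    field_simp

/-- A neighbourhood, of a radius depending on `κ` only, of a state whose energy is less than `e` by
a margin of `1/2` stays in the region of regularity. -/
lemma norm_sub_sq_lt {E : Type*} [NormedAddCommGroup E] {ys : E} {κ e : ℝ} (hκ : 1 ≤ κ)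
    (he : e ≤ κ ^ 2) {y₀ y : E} (h₀ : ‖y₀ - ys‖ ^ 2 ≤ 2 * e - 1)
    (hy : ‖y - y₀‖ ≤ 1 / (4 * κ)) : ‖y - ys‖ ^ 2 < 2 * e := by
  have hκ0 : 0 < κ := by linarith
  have h1 : ‖y₀ - ys‖ ≤ 3 / 2 * κ :=
    (abs_le_of_sq_le_sq' (a := ‖y₀ - ys‖) (by nlinarith) (by positivity)).2
  have h2 : ‖y - ys‖ ≤ ‖y₀ - ys‖ + ‖y - y₀‖ := by
    have := norm_add_le (y₀ - ys) (y - y₀)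
    rwa [show y₀ - ys + (y - y₀) = y - ys by abel] at this
  have h3 : ‖y₀ - ys‖ * ‖y - y₀‖ ≤ 3 / 2 * κ * (1 / (4 * κ)) := by gcongr
  have h4 : 3 / 2 * κ * (1 / (4 * κ)) = 3 / 8 := by field_simp; norm_num
  have h5 : ‖y - y₀‖ ≤ 1 / 4 := by
    refine hy.trans ?_
    rw [div_le_div_iff₀ (by positivity) (by norm_num)]
    linarith
  have h6 : ‖y - ys‖ ^ 2 ≤ (‖y₀ - ys‖ + ‖y - y₀‖) ^ 2 := by gcongr
  nlinarith [norm_nonneg (y - y₀)]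

/-- The heavy-ball field in the variables `V = t₀ v`, `Q = α t₀ (y - y₀)`, `τ = α (t - t₀)`, with
`α t` as time. The factor `t₀` turns the decay `O(1/t)` of the trajectories into mere boundedness,
and `α = √R` normalizes the Hessian. -/
def scaledField {E : Type*} [NormedAddCommGroup E] [InnerProductSpace ℝ E] (g : E → E)
    (α t₀ : ℝ) (y₀ : E) (z : E × E × ℝ) : E × E × ℝ :=
  (-((5 * (α * t₀ + z.2.2)⁻¹) • z.1) - (4 * t₀ / α) • g (y₀ + (α * t₀)⁻¹ • z.2.1), z.1, 1)

variable {E : Type*} [NormedAddCommGroup E] [InnerProductSpace ℝ E] {φ : E → ℝ} {g : E → E}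
  {R m : ℝ} {ys : E}

lemma SmoothConvex.norm_fderiv_le (hφ : SmoothConvex φ g R m ys) (hR : 0 ≤ R) (y : E) :
    ‖fderiv ℝ g y‖ ≤ R := by
  have : LipschitzWith ⟨R, hR⟩ g := by
    refine LipschitzWith.of_dist_le_mul fun y y' => ?_
    rw [dist_eq_norm, dist_eq_norm]
    exact hφ.lip y' y
  exact norm_fderiv_le_of_lipschitz ℝ this

/-- Regularity of the gradient on the ball in which the trajectories stay. The bound `B` concerns
the orders `2, …, s + 1` only: orders `0` and `1` are controlled by the energy and by smoothness. -/
structure RegularGrad (s : ℕ) (g : E → E) (ys : E) (e B : ℝ) : Prop where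
  contDiffOn : ContDiffOn ℝ ((s + 1 : ℕ) : WithTop ℕ∞) g {y | ‖y - ys‖ ^ 2 < 2 * e}
  norm_le : ∀ j, 2 ≤ j → j ≤ s + 1 → ∀ y, ‖y - ys‖ ^ 2 < 2 * e → ‖iteratedFDeriv ℝ j g y‖ ≤ B

lemma inv_mul_le_of_one_le {α κ t₀ : ℝ} (hα : 0 < α) (hακ : 1 ≤ α * κ) (ht : 1 ≤ t₀) :
    (α * t₀)⁻¹ ≤ κ := by
  have hκ0 : 0 < κ := pos_of_mul_pos_right (by linarith) hα.le
  rw [inv_le_iff_one_le_mul₀ (by positivity)]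
  nlinarith

/-- The rescaled gradient has derivatives bounded in terms of `κ` only. -/
lemma boundedDerivs_scaledGrad (hφ : SmoothConvex φ g R m ys) {s : ℕ} {α κ t₀ e : ℝ} (hα : 0 < α)
    (hR : R = α ^ 2) (hκ : 1 ≤ κ) (hακ : 1 ≤ α * κ) (ht : 1 ≤ t₀) (he : e ≤ κ ^ 2) {v₀ y₀ : E}
    (hl : lyap φ m ys (v₀, y₀, t₀) ≤ e - 1 / 2) (hreg : RegularGrad s g ys e (κ ^ 2)) :
    BoundedDerivs (s + 1) (2 * κ + κ ^ (s + 4))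
      (fun Q => (t₀ / α) • g (y₀ + (α * t₀)⁻¹ • Q)) (Metric.ball 0 (1 / (4 * κ ^ 2))) := by
  have hR0 : 0 < R := by rw [hR]; positivity
  have hκ0 : 0 < κ := by linarith
  have ht0 : 0 < t₀ := by linarith
  set σ := (α * t₀)⁻¹ with hσ
  have hσ0 : 0 < σ := by positivity
  have hσκ : σ ≤ κ := inv_mul_le_of_one_le hα hακ ht
  set U : Set E := {y | ‖y - ys‖ ^ 2 < 2 * e} with hUdef
  have hUo : IsOpen U := isOpen_lt (by fun_prop) continuous_const
  have hy₀ : ‖y₀ - ys‖ ^ 2 ≤ 2 * e - 1 := by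
    have : ‖y₀ - ys‖ ^ 2 ≤ 2 * lyap φ m ys (v₀, y₀, t₀) := hφ.lyap_y (v₀, y₀, t₀)
    linarith
  have hmaps : ∀ Q ∈ Metric.ball (0 : E) (1 / (4 * κ ^ 2)), y₀ + σ • Q ∈ U := by
    intro Q hQ
    rw [mem_ball_zero_iff] at hQ
    refine norm_sub_sq_lt hκ he hy₀ ?_
    rw [add_sub_cancel_left, norm_smul, Real.norm_of_nonneg hσ0.le]
    calc σ * ‖Q‖ ≤ κ * (1 / (4 * κ ^ 2)) := by gcongr
      _ = 1 / (4 * κ) := by field_simp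
  set L : E →L[ℝ] E := σ • ContinuousLinearMap.id ℝ E with hL
  have hLn : ‖L‖ ≤ σ := by
    rw [hL, norm_smul, Real.norm_of_nonneg hσ0.le]
    exact mul_le_of_le_one_right hσ0.le ContinuousLinearMap.norm_id_le
  set W : Set E := (fun w => y₀ + w) ⁻¹' U
  have hWo : IsOpen W := hUo.preimage (by fun_prop)
  have hgW : ContDiffOn ℝ ((s + 1 : ℕ) : WithTop ℕ∞) (fun w => g (y₀ + w)) W :=
    hreg.contDiffOn.comp (by fun_prop) (fun w hw => hw)
  have hsm : ContDiffOn ℝ ((s + 1 : ℕ) : WithTop ℕ∞) (fun Q => g (y₀ + σ • Q))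
      (Metric.ball 0 (1 / (4 * κ ^ 2))) :=
    hreg.contDiffOn.comp (by fun_prop) hmaps
  have hiter : ∀ j ≤ s + 1, ∀ Q ∈ Metric.ball (0 : E) (1 / (4 * κ ^ 2)),
      ‖iteratedFDeriv ℝ j (fun Q => g (y₀ + σ • Q)) Q‖
        ≤ ‖iteratedFDeriv ℝ j g (y₀ + σ • Q)‖ * σ ^ j := by
    intro j hj Q hQ
    have h1 := norm_iteratedFDeriv_comp_clm_le L hWo hgW hj (x := Q) (hmaps Q hQ)
    rw [iteratedFDeriv_comp_add_left] at h1
    refine h1.trans ?_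
    gcongr ‖iteratedFDeriv ℝ j g _‖ * ?_
    exact pow_le_pow_left₀ (norm_nonneg _) hLn j
  have hc : t₀ / α * σ = 1 / α ^ 2 := by rw [hσ]; field_simp
  refine ⟨hsm.const_smul (t₀ / α), fun j hj Q hQ => ?_⟩
  have hat : ContDiffAt ℝ (j : WithTop ℕ∞) (fun Q => g (y₀ + σ • Q)) Q :=
    (hsm.contDiffAt (Metric.isOpen_ball.mem_nhds hQ)).of_le (by exact_mod_cast hj)
  rw [iteratedFDeriv_const_smul_apply' hat, norm_smul, Real.norm_of_nonneg (by positivity)]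
  have hpow : (1 : ℝ) ≤ κ ^ (s + 4) := one_le_pow₀ hκ
  have hQ' : ‖Q‖ ≤ 1 / 4 := by
    rw [mem_ball_zero_iff] at hQ
    refine hQ.le.trans ?_
    rw [div_le_div_iff₀ (by positivity) (by norm_num)]
    nlinarith
  rcases Nat.lt_or_ge j 2 with hj2 | hj2
  · interval_cases j
    · -- order zero: the gradient at `y₀` is `O(√R / t₀)`
      rw [norm_iteratedFDeriv_zero]
      have h1 := hφ.lip y₀ (y₀ + σ • Q)
      rw [add_sub_cancel_left, norm_smul, Real.norm_of_nonneg hσ0.le] at h1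
      have h2 : ‖g (y₀ + σ • Q)‖ ≤ ‖g y₀‖ + R * (σ * ‖Q‖) :=
        (norm_le_norm_add_norm_sub' _ (g y₀)).trans (add_le_add le_rfl h1)
      have h3 : t₀ * ‖g y₀‖ ≤ 3 / 2 * (α * κ) := by
        have h := hφ.lyap_grad (v₀, y₀, t₀) hR0
        refine abs_le_of_sq_le_sq' (a := t₀ * ‖g y₀‖) ?_ (by positivity) |>.2
        have h' : (t₀ * ‖g y₀‖) ^ 2 ≤ 2 * R * lyap φ m ys (v₀, y₀, t₀) := h
        have h'' : 2 * R * lyap φ m ys (v₀, y₀, t₀) ≤ 2 * R * κ ^ 2 := by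
          gcongr
          linarith
        rw [hR] at h' h''
        nlinarith [sq_nonneg (α * κ)]
      calc t₀ / α * ‖g (y₀ + σ • Q)‖ ≤ t₀ / α * (‖g y₀‖ + R * (σ * ‖Q‖)) := by gcongr
        _ = (t₀ * ‖g y₀‖) / α + (t₀ / α * σ) * R * ‖Q‖ := by ring
        _ = (t₀ * ‖g y₀‖) / α + ‖Q‖ := by
            rw [hc, hR]
            field_simp
        _ ≤ 3 / 2 * (α * κ) / α + 1 / 4 := by gcongr
        _ = 3 / 2 * κ + 1 / 4 := by field_simp
        _ ≤ _ := by linarith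
    · -- order one: the scaling normalizes the Hessian
      have h1 := hiter 1 hj Q hQ
      rw [← norm_iteratedFDeriv_fderiv (f := g), norm_iteratedFDeriv_zero, pow_one] at h1
      have h2 := hφ.norm_fderiv_le hR0.le (y₀ + σ • Q)
      calc _ ≤ t₀ / α * (R * σ) := by
            refine mul_le_mul_of_nonneg_left (h1.trans ?_) (by positivity)
            gcongr
        _ = (t₀ / α * σ) * R := by ring
        _ = 1 := by rw [hc, hR]; field_simp
        _ ≤ _ := by linarith
  · have h1 := hiter j hj Q hQ
    have h2 := hreg.norm_le j hj2 hj (y₀ + σ • Q) (hmaps Q hQ)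
    obtain ⟨i, rfl⟩ : ∃ i, j = i + 2 := ⟨j - 2, by omega⟩
    have h3 : 1 / α ^ 2 ≤ κ ^ 2 := by
      rw [div_le_iff₀ (by positivity), ← mul_pow, mul_comm]
      exact one_le_pow₀ hακ
    calc _ ≤ t₀ / α * (κ ^ 2 * σ ^ (i + 2)) := by
          refine mul_le_mul_of_nonneg_left (h1.trans ?_) (by positivity)
          gcongr
      _ = (t₀ / α * σ) * κ ^ 2 * σ ^ (i + 1) := by ring
      _ ≤ κ ^ 2 * κ ^ 2 * κ ^ (i + 1) := by
          rw [hc]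
          gcongr
      _ = κ ^ (i + 5) := by ring
      _ ≤ κ ^ (s + 4) := pow_le_pow_right₀ hκ (by omega)
      _ ≤ _ := by linarith

end scaling

/-- The rescaled field has derivatives bounded in terms of `s` and `κ` only, around the rescaled
states of controlled energy. -/
lemma exists_boundedDerivs_scaledField (s : ℕ) {κ : ℝ} (hκ : 1 ≤ κ) :
    ∃ A : ℝ, 0 < A ∧ ∀ (E : Type) [NormedAddCommGroup E] [InnerProductSpace ℝ E] (φ : E → ℝ)
      (g : E → E) (R m : ℝ) (ys : E) (α t₀ e : ℝ) (v₀ y₀ : E), SmoothConvex φ g R m ys →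
      0 < α → R = α ^ 2 → 1 ≤ α * κ → 1 ≤ t₀ → e ≤ κ ^ 2 →
      lyap φ m ys (v₀, y₀, t₀) ≤ e - 1 / 2 → RegularGrad s g ys e (κ ^ 2) →
      ‖((t₀ • v₀, 0, 0) : E × E × ℝ)‖ ≤ A ∧
        BoundedDerivs (s + 1) A (scaledField g α t₀ y₀)
          (Metric.ball (t₀ • v₀, 0, 0) (1 / (4 * κ ^ 2))) := by
  have hκ0 : 0 < κ := by linarith
  have hκ2 : 1 ≤ κ ^ 2 := one_le_pow₀ hκ
  obtain ⟨C, hC0, hC⟩ := exists_boundedDerivs_inv (s + 1) (δ := 1 / (2 * κ)) (by positivity)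
  set C₁ : ℝ := |(-5 : ℝ)| * ((s + 1).factorial * C * (max 1 1) ^ (s + 1)) with hC₁
  set C₂ : ℝ := |(-4 : ℝ)| * ((s + 1).factorial * (2 * κ + κ ^ (s + 4)) * (max 1 1) ^ (s + 1))
    with hC₂
  set A₁ : ℝ := 1 * (2 ^ (s + 1) * C₁ * (4 * κ + 1)) + C₂ with hA₁
  have hC₁0 : 0 ≤ C₁ := by positivity
  have hC₂0 : 0 ≤ C₂ := by positivity
  have hA₁0 : 0 ≤ A₁ := by positivity
  refine ⟨A₁ + ((4 * κ + 1) + 1), by positivity, ?_⟩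
  intro E _ _ φ g R m ys α t₀ e v₀ y₀ hφ hα hR hακ ht he hl hreg
  have ht0 : 0 < t₀ := by linarith
  have hv : ‖t₀ • v₀‖ ≤ 4 * κ := by
    rw [norm_smul, Real.norm_of_nonneg ht0.le]
    have h : (t₀ * ‖v₀‖) ^ 2 ≤ 16 * lyap φ m ys (v₀, y₀, t₀) := hφ.lyap_v (v₀, y₀, t₀)
    exact (abs_le_of_sq_le_sq' (a := t₀ * ‖v₀‖) (by nlinarith) (by positivity)).2
  set z₀ : E × E × ℝ := (t₀ • v₀, 0, 0) with hz₀
  set r : ℝ := 1 / (4 * κ ^ 2) with hr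
  have hr1 : r ≤ 1 / 4 := by
    rw [hr, div_le_div_iff₀ (by positivity) (by norm_num)]
    linarith
  have hrκ : r ≤ 1 / (2 * κ) := by
    rw [hr, div_le_div_iff₀ (by positivity) (by positivity)]
    nlinarith
  set U := Metric.ball z₀ r with hU
  have hUo : IsOpen U := Metric.isOpen_ball
  have hmem : ∀ z ∈ U, ‖z.1 - t₀ • v₀‖ < r ∧ ‖z.2.1‖ < r ∧ |z.2.2| < r := by
    intro z hz
    have h1 := mem_ball_iff_norm.1 hz
    have h2 := (norm_fst_le (z - z₀)).trans_lt h1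
    have h3 := (norm_snd_le (z - z₀)).trans_lt h1
    have h4 := (norm_fst_le (z - z₀).2).trans_lt h3
    have h5 := (norm_snd_le (z - z₀).2).trans_lt h3
    simp only [hz₀, Prod.fst_sub, Prod.snd_sub, sub_zero] at h2 h4 h5
    exact ⟨h2, h4, h5⟩
  have hz₀n : ‖z₀‖ ≤ 4 * κ := by
    rw [hz₀, norm_prod_le_iff]
    exact ⟨hv, by simpa using hκ0.le⟩
  refine ⟨hz₀n.trans (by linarith), ?_⟩
  -- coordinate projections
  have bV : BoundedDerivs (s + 1) (4 * κ + 1) (fun z : E × E × ℝ => z.1) U := by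
    refine BoundedDerivs.clm (ContinuousLinearMap.fst ℝ E (E × ℝ))
      ((ContinuousLinearMap.norm_fst_le ℝ E (E × ℝ)).trans (by linarith)) (fun z hz => ?_) hUo
    have h1 := (hmem z hz).1
    have h2 := norm_le_norm_add_norm_sub' z.1 (t₀ • v₀)
    change ‖z.1‖ ≤ _
    linarith
  have bQ : BoundedDerivs (s + 1) 1 (fun z : E × E × ℝ => z.2.1) U := by
    refine BoundedDerivs.clm
      ((ContinuousLinearMap.fst ℝ E ℝ).comp (ContinuousLinearMap.snd ℝ E (E × ℝ)))
      (ContinuousLinearMap.opNorm_le_bound _ zero_le_one fun z => ?_) (fun z hz => ?_) hUo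
    · rw [one_mul]
      exact (norm_fst_le z.2).trans (norm_snd_le z)
    · change ‖z.2.1‖ ≤ 1
      linarith [(hmem z hz).2.1]
  have bτ : BoundedDerivs (s + 1) 1 (fun z : E × E × ℝ => z.2.2) U := by
    refine BoundedDerivs.clm
      ((ContinuousLinearMap.snd ℝ E ℝ).comp (ContinuousLinearMap.snd ℝ E (E × ℝ)))
      (ContinuousLinearMap.opNorm_le_bound _ zero_le_one fun z => ?_) (fun z hz => ?_) hUo
    · rw [one_mul]
      exact (norm_snd_le z.2).trans (norm_snd_le z)
    · change |z.2.2| ≤ 1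
      linarith [(hmem z hz).2.2]
  -- the friction term
  have hinv : BoundedDerivs (s + 1) C (fun τ : ℝ => (α * t₀ + τ)⁻¹) (Metric.ball 0 r) := by
    refine hC (α * t₀) _ Metric.isOpen_ball fun τ hτ => ?_
    rw [mem_ball_zero_iff, Real.norm_eq_abs] at hτ
    have h1 := (abs_lt.1 hτ).1
    have h2 : 1 / κ ≤ α * t₀ := by
      rw [div_le_iff₀ hκ0]
      nlinarith
    have h3 : 1 / κ = 1 / (2 * κ) + 1 / (2 * κ) := by field_simp; norm_num
    linarith
  have b1 := (BoundedDerivs.comp hUo Metric.isOpen_ball hC0 hinv bτ (fun z hz => by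
    rw [mem_ball_zero_iff]; exact (hmem z hz).2.2)).const_smul hUo (-5)
  have b2 := BoundedDerivs.bilinear hUo (ContinuousLinearMap.lsmul ℝ ℝ : ℝ →L[ℝ] E →L[ℝ] E)
    (by positivity) b1 bV
  -- the gradient term
  have b3 := (BoundedDerivs.comp hUo Metric.isOpen_ball (by positivity)
    (boundedDerivs_scaledGrad hφ hα hR hκ hακ ht he hl hreg) bQ (fun z hz => by
      rw [mem_ball_zero_iff]; exact (hmem z hz).2.1)).const_smul hUo (-4)
  have b4 : BoundedDerivs (s + 1) A₁ (fun z : E × E × ℝ =>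
      -((5 * (α * t₀ + z.2.2)⁻¹) • z.1) - (4 * t₀ / α) • g (y₀ + (α * t₀)⁻¹ • z.2.1)) U := by
    refine ((b2.add hUo b3).mono (add_le_add ?_ le_rfl)).congr hUo fun z _ => ?_
    · exact mul_le_mul_of_nonneg_right ContinuousLinearMap.opNorm_lsmul_le (by positivity)
    · simp only [ContinuousLinearMap.lsmul_apply, smul_eq_mul, smul_smul]
      rw [neg_mul, neg_smul, neg_mul, neg_smul, sub_eq_add_neg, mul_div_assoc]
  exact b4.prodMk' hUo
    (bV.prodMk' hUo (BoundedDerivs.const (1 : ℝ) (by simp)) (by positivity) zero_le_one)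
    hA₁0 (by positivity)

/-! ### Energy control along the Runge-Kutta iterates -/

section scaledStep

variable {E : Type*} [NormedAddCommGroup E] [InnerProductSpace ℝ E] {S : ℕ} (rk : ExplicitRK S)
  (g : E → E)

/-- The linear part of the change of variables to the natural scaling. -/
def scaleMap (α t₀ : ℝ) : E × E × ℝ →ₗ[ℝ] E × E × ℝ :=
  LinearMap.prodMap (t₀ • LinearMap.id)
    (LinearMap.prodMap ((α * t₀) • LinearMap.id) (α • LinearMap.id))

lemma scaleMap_apply (α t₀ : ℝ) (ζ : E × E × ℝ) :
    scaleMap α t₀ ζ = (t₀ • ζ.1, (α * t₀) • ζ.2.1, α * ζ.2.2) := rfl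

/-- One step for the heavy-ball field, in the natural scaling. -/
lemma scaled_step {α t₀ : ℝ} (hα : α ≠ 0) (ht₀ : t₀ ≠ 0) (h : ℝ) (v₀ y₀ : E) :
    scaleMap α t₀ (rk.step (hbField g) h (v₀, y₀, t₀) - (0, y₀, t₀))
      = rk.step (scaledField g α t₀ y₀) (α * h) (t₀ • v₀, 0, 0) := by
  have hmap := rk.map_step (T := fun ζ => scaleMap α t₀ (ζ - (0, y₀, t₀))) (l := scaleMap α t₀)
    (G := hbField g) (G' := scaledField g α t₀ y₀) (h := h) (h' := α * h)
    (fun z w => by rw [← map_add]; congr 1; abel) (fun z => ?_) (v₀, y₀, t₀)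
  · rw [hmap]
    congr 1
    simp [scaleMap_apply]
  · obtain ⟨v, y, t⟩ := z
    have e1 : y₀ + (α * t₀)⁻¹ • (α * t₀) • (y - y₀) = y := by
      rw [smul_smul, inv_mul_cancel₀ (mul_ne_zero hα ht₀), one_smul]
      abel
    have e2 : α * t₀ + α * (t - t₀) = α * t := by ring
    simp only [scaleMap_apply, scaledField, hbField, Prod.fst_sub, Prod.snd_sub, sub_zero, e1, e2,
      Prod.smul_mk]
    refine Prod.ext ?_ (Prod.ext ?_ ?_)
    · simp only [smul_sub, smul_neg, smul_smul, mul_inv]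
      congr 1
      · congr 2
        field_simp
      · congr 1
        field_simp
    · simp only [smul_smul]
      congr 1
      ring
    · simp only [smul_eq_mul]
      ring

variable {rk}

/-- The time variable is integrated exactly. -/
lemma step_time (hb : ∑ i, rk.b i = 1) (h : ℝ) (ζ : E × E × ℝ) :
    (rk.step (hbField g) h ζ).2.2 = ζ.2.2 + h := by
  have hmap := rk.map_step (T := fun ζ : E × E × ℝ => ζ.2.2)
    (l := (LinearMap.snd ℝ E ℝ).comp (LinearMap.snd ℝ E (E × ℝ)))
    (G := hbField g) (G' := fun _ => (1 : ℝ)) (h := h) (h' := h)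
    (fun z w => rfl) (fun z => rfl) ζ
  rw [ExplicitRK.step_const, hb] at hmap
  simpa using hmap

end scaledStep

section energy

variable {S : ℕ} {rk : ExplicitRK S} {s : ℕ}

/-- One Runge-Kutta step increases the Lyapunov function by at most `D (√R h)^{s+1}`, where `D` and
the admissible step sizes depend on `κ` only: it decreases along the exact solution, from which the
step deviates by the local error. -/
lemma exists_lyap_step_le (hrk : rk.HasOrder s) (hs : 1 ≤ s) {κ : ℝ} (hκ : 1 ≤ κ) :
    ∃ D η₀ : ℝ, 0 ≤ D ∧ 0 < η₀ ∧ ∀ (E : Type) [NormedAddCommGroup E] [InnerProductSpace ℝ E]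
      [FiniteDimensional ℝ E] (φ : E → ℝ) (g : E → E) (R m : ℝ) (ys : E) (α t₀ e h : ℝ) (v₀ y₀ : E),
      SmoothConvex φ g R m ys →
      0 < α → R = α ^ 2 → 1 ≤ α * κ → 1 ≤ t₀ → e ≤ κ ^ 2 →
      lyap φ m ys (v₀, y₀, t₀) ≤ e - 1 / 2 → RegularGrad s g ys e (κ ^ 2) → 0 ≤ h → α * h ≤ η₀ →
      lyap φ m ys (rk.step (hbField g) h (v₀, y₀, t₀))
        ≤ lyap φ m ys (v₀, y₀, t₀) + D * (α * h) ^ (s + 1) := by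
  have hκ0 : 0 < κ := by linarith
  obtain ⟨A, hA, H₁⟩ := exists_boundedDerivs_scaledField s hκ
  obtain ⟨C, T, hC, hT, H₂⟩ := exists_local_error_bound rk hrk hA
    (r := 1 / (4 * κ ^ 2)) (by positivity)
  refine ⟨22 * κ ^ 2 * C, min (T / 2) (min (1 / κ) (min 1 (1 / (C + 1)))), by positivity,
    by positivity, ?_⟩
  intro E _ _ _ φ g R m ys α t₀ e h v₀ y₀ hφ hα hR hακ ht he hl hreg hh hη
  set η := α * h with hηdef
  have ht0 : 0 < t₀ := by linarith
  have hη0 : 0 ≤ η := by positivity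
  have hηT : η < T := by
    have := hη.trans (min_le_left _ _)
    linarith
  have hηκ : η ≤ 1 / κ := hη.trans ((min_le_right _ _).trans (min_le_left _ _))
  have hη1 : η ≤ 1 :=
    hη.trans ((min_le_right _ _).trans ((min_le_right _ _).trans (min_le_left _ _)))
  have hηC : η ≤ 1 / (C + 1) :=
    hη.trans ((min_le_right _ _).trans ((min_le_right _ _).trans (min_le_right _ _)))
  have hh1 : h ≤ 1 := by
    have h1 : h ≤ (α * κ) * h := le_mul_of_one_le_left hh hακ
    have h2 : κ * η ≤ κ * (1 / κ) := by gcongr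
    rw [mul_one_div_cancel hκ0.ne'] at h2
    calc h ≤ (α * κ) * h := h1
      _ = κ * η := by rw [hηdef]; ring
      _ ≤ 1 := h2
  obtain ⟨hz, hG⟩ := H₁ E φ g R m ys α t₀ e v₀ y₀ hφ hα hR hακ ht he hl hreg
  obtain ⟨Ψ, hΨ0, hΨ, herr⟩ := H₂ (E × E × ℝ) _ _ hz hG
  have herr' := herr η hη0 hηT
  rw [hηdef, ← scaled_step rk g hα.ne' ht0.ne' h v₀ y₀, ← hηdef] at herr'
  set ζ := rk.step (hbField g) h (v₀, y₀, t₀) with hζ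
  set ε := C * η ^ (s + 1) with hε
  have hε0 : 0 ≤ ε := by positivity
  have hε1 : ε ≤ 1 := by
    have h1 : η ^ (s + 1) ≤ η := pow_le_of_le_one hη0 hη1 (by omega)
    have h2 : C * η ≤ C * (1 / (C + 1)) := by gcongr
    have h3 : C * (1 / (C + 1)) ≤ 1 := by
      rw [mul_one_div, div_le_one (by positivity)]
      linarith
    calc ε ≤ C * η := by rw [hε]; gcongr
      _ ≤ 1 := h2.trans h3
  -- the exact solution in the original variables
  have hmem : ∀ x ∈ Set.Icc 0 h, α * x ∈ Set.Ioo (-T) T := by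
    intro x hx
    have h1 : 0 ≤ α * x := mul_nonneg hα.le hx.1
    have h2 : α * x ≤ α * h := mul_le_mul_of_nonneg_left hx.2 hα.le
    exact ⟨by linarith, by linarith⟩
  have hd1 : ∀ τ ∈ Set.Ioo (-T) T, HasDerivAt (fun τ => (Ψ τ).1)
      (scaledField g α t₀ y₀ (Ψ τ)).1 τ := fun τ hτ =>
    (ContinuousLinearMap.fst ℝ E (E × ℝ)).hasFDerivAt.comp_hasDerivAt τ (hΨ τ hτ).1
  have hd2 : ∀ τ ∈ Set.Ioo (-T) T, HasDerivAt (fun τ => (Ψ τ).2.1) (Ψ τ).1 τ := fun τ hτ =>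
    ((ContinuousLinearMap.fst ℝ E ℝ).comp
      (ContinuousLinearMap.snd ℝ E (E × ℝ))).hasFDerivAt.comp_hasDerivAt τ (hΨ τ hτ).1
  have hd3 : ∀ τ ∈ Set.Ioo (-T) T, HasDerivAt (fun τ => (Ψ τ).2.2) 1 τ := fun τ hτ =>
    ((ContinuousLinearMap.snd ℝ E ℝ).comp
      (ContinuousLinearMap.snd ℝ E (E × ℝ))).hasFDerivAt.comp_hasDerivAt τ (hΨ τ hτ).1
  have htime : ∀ τ ∈ Set.Ioo (-T) T, (Ψ τ).2.2 = τ := by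
    intro τ hτ
    have h0 : (0 : ℝ) ∈ Set.Ioo (-T) T := ⟨by linarith, hT⟩
    have hconst := (convex_Ioo (-T) T).norm_image_sub_le_of_norm_hasDerivWithin_le
      (f := fun τ => (Ψ τ).2.2 - τ) (f' := fun _ => 1 - 1) (C := 0)
      (fun x hx => ((hd3 x hx).sub (hasDerivAt_id x)).hasDerivWithinAt) (fun x _ => by simp) h0 hτ
    rw [zero_mul, hΨ0] at hconst
    have := norm_le_zero_iff.1 hconst
    simp only [sub_zero] at this
    linarith
  have hαx : ∀ x : ℝ, HasDerivAt (fun x => α * x) α x := fun x => by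
    simpa using (hasDerivAt_id x).const_mul α
  have hv : ∀ x ∈ Set.Icc 0 h, HasDerivAt (fun x => t₀⁻¹ • (Ψ (α * x)).1)
      (-((5 / (t₀ + x)) • (t₀⁻¹ • (Ψ (α * x)).1))
        - (4 : ℝ) • g (y₀ + (α * t₀)⁻¹ • (Ψ (α * x)).2.1)) x := by
    intro x hx
    have hx0 : t₀ + x ≠ 0 := by linarith [hx.1]
    have h1 := ((hd1 _ (hmem x hx)).scomp x (hαx x)).const_smul t₀⁻¹
    refine h1.congr_deriv ?_
    simp only [scaledField, htime _ (hmem x hx), smul_sub, smul_neg, smul_smul, ← mul_add]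
    congr 3
    · field_simp
    · field_simp
  have hy : ∀ x ∈ Set.Icc 0 h, HasDerivAt (fun x => y₀ + (α * t₀)⁻¹ • (Ψ (α * x)).2.1)
      (t₀⁻¹ • (Ψ (α * x)).1) x := by
    intro x hx
    have h1 := (((hd2 _ (hmem x hx)).scomp x (hαx x)).const_smul (α * t₀)⁻¹).const_add y₀
    refine h1.congr_deriv ?_
    rw [smul_smul]
    congr 1
    field_simp
  have hdec := hφ.lyap_antitone ht0 hh hv hy
  have hinit : (t₀⁻¹ • (Ψ (α * 0)).1, y₀ + (α * t₀)⁻¹ • (Ψ (α * 0)).2.1, t₀ + 0)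
      = (v₀, y₀, t₀) := by
    rw [mul_zero, hΨ0, add_zero, smul_zero, add_zero, smul_smul, inv_mul_cancel₀ ht0.ne', one_smul]
  rw [hinit, ← hηdef] at hdec
  set v₁ := t₀⁻¹ • (Ψ η).1 with hv₁
  set y₁ := y₀ + (α * t₀)⁻¹ • (Ψ η).2.1 with hy₁
  -- the local error in the original variables
  have hζt : ζ.2.2 = t₀ + h := step_time g (hrk.sum_b hs) h (v₀, y₀, t₀)
  have herr1 : t₀ * ‖ζ.1 - v₁‖ ≤ ε := by
    have h1 := (norm_fst_le _).trans herr'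
    rw [scaleMap_apply] at h1
    simp only [Prod.fst_sub, sub_zero] at h1
    have e1 : t₀ • ζ.1 - (Ψ η).1 = t₀ • (ζ.1 - v₁) := by
      rw [smul_sub, hv₁, smul_smul, mul_inv_cancel₀ ht0.ne', one_smul]
    rwa [e1, norm_smul, Real.norm_of_nonneg ht0.le] at h1
  have herr2 : α * (t₀ * ‖ζ.2.1 - y₁‖) ≤ ε := by
    have h1 := (norm_fst_le _).trans ((norm_snd_le _).trans herr')
    rw [scaleMap_apply] at h1
    simp only [Prod.fst_sub, Prod.snd_sub] at h1
    have e1 : (α * t₀) • (ζ.2.1 - y₀) - (Ψ η).2.1 = (α * t₀) • (ζ.2.1 - y₁) := by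
      rw [hy₁, ← sub_sub, smul_sub (α * t₀) (ζ.2.1 - y₀), smul_smul,
        mul_inv_cancel₀ (by positivity), one_smul]
    rwa [e1, norm_smul, Real.norm_of_nonneg (by positivity), mul_assoc] at h1
  have hth : t₀ + h ≤ 2 * t₀ := by linarith
  have hfin := hφ.lyap_perturb (t := t₀ + h) (v' := ζ.1) (y' := ζ.2.1) hα hR hκ hακ
    (by linarith) hε0 hε1
    (calc (t₀ + h) * ‖ζ.1 - v₁‖ ≤ 2 * t₀ * ‖ζ.1 - v₁‖ := by gcongr
      _ ≤ 2 * ε := by linarith)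
    (calc α * ((t₀ + h) * ‖ζ.2.1 - y₁‖) ≤ α * (2 * t₀ * ‖ζ.2.1 - y₁‖) := by gcongr
      _ ≤ 2 * ε := by linarith)
    (by linarith)
  have hζe : ζ = (ζ.1, ζ.2.1, t₀ + h) := by rw [← hζt]
  rw [hζe]
  calc _ ≤ _ := hfin
    _ ≤ lyap φ m ys (v₀, y₀, t₀) + 22 * κ ^ 2 * ε := by linarith
    _ = _ := by rw [hε]; ring

/-- With step size `c / (√R N^{1/(s+1)})`, the `N` increments of the Lyapunov function add up to at
most `1/2`, so all iterates keep the energy below `e - 1/2`. -/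
theorem exists_lyap_iterate_le (hrk : rk.HasOrder s) (hs : 1 ≤ s) {κ : ℝ} (hκ : 1 ≤ κ) :
    ∃ c : ℝ, 0 < c ∧ ∀ (E : Type) [NormedAddCommGroup E] [InnerProductSpace ℝ E]
      [FiniteDimensional ℝ E] (φ : E → ℝ) (g : E → E) (R m : ℝ) (ys : E) (α e : ℝ),
      SmoothConvex φ g R m ys →
      0 < α → R = α ^ 2 → 1 ≤ α * κ → e ≤ κ ^ 2 → RegularGrad s g ys e (κ ^ 2) →
      lyap φ m ys (0, 0, 1) ≤ e - 1 → ∀ (N : ℕ) (_ : 1 ≤ N) (h : ℝ),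
      h = c / α / (N : ℝ) ^ ((1 : ℝ) / ((s : ℝ) + 1)) →
      ((rk.step (hbField g) h)^[N] (0, 0, 1)).2.2 = 1 + N * h ∧
        lyap φ m ys ((rk.step (hbField g) h)^[N] (0, 0, 1)) ≤ e := by
  obtain ⟨D, η₀, hD, hη₀, H⟩ := exists_lyap_step_le hrk hs hκ
  refine ⟨min η₀ (min 1 (1 / (2 * (D + 1)))), by positivity, ?_⟩
  set c := min η₀ (min 1 (1 / (2 * (D + 1)))) with hc
  have hc0 : 0 < c := by positivity
  intro E _ _ _ φ g R m ys α e hφ hα hR hακ he hreg hinit N hN h hh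
  have hN1 : (1 : ℝ) ≤ N := by exact_mod_cast hN
  have hN0 : (0 : ℝ) < N := by linarith
  set q := (N : ℝ) ^ ((1 : ℝ) / ((s : ℝ) + 1)) with hq
  have hq1 : 1 ≤ q := Real.one_le_rpow hN1 (by positivity)
  have hq0 : 0 < q := by linarith
  have hqpow : q ^ (s + 1) = N := by
    rw [hq, ← Real.rpow_natCast, ← Real.rpow_mul hN0.le]
    push_cast
    rw [one_div_mul_cancel (by positivity), Real.rpow_one]
  have hη : α * h = c / q := by rw [hh]; field_simp
  have hηc : α * h ≤ c := by
    rw [hη]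
    exact div_le_self hc0.le hq1
  have hh0 : 0 ≤ h := by rw [hh]; positivity
  have hincr : D * (α * h) ^ (s + 1) ≤ 1 / (2 * N) := by
    rw [hη, div_pow, hqpow]
    have h1 : c ^ (s + 1) ≤ c :=
      pow_le_of_le_one hc0.le ((min_le_right _ _).trans (min_le_left _ _)) (by omega)
    have h2 : c ≤ 1 / (2 * (D + 1)) := (min_le_right _ _).trans (min_le_right _ _)
    have h3 : D * c ^ (s + 1) ≤ 1 / 2 := by
      calc D * c ^ (s + 1) ≤ (D + 1) * (1 / (2 * (D + 1))) := by
            gcongr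
            · linarith
            · exact h1.trans h2
        _ = 1 / 2 := by field_simp
    rw [← mul_div_assoc, div_le_div_iff₀ hN0 (by positivity)]
    nlinarith
  have hind : ∀ k ≤ N, ((rk.step (hbField g) h)^[k] (0, 0, 1)).2.2 = 1 + k * h ∧
      lyap φ m ys ((rk.step (hbField g) h)^[k] (0, 0, 1)) ≤ e - 1 + k * (1 / (2 * N)) := by
    intro k
    induction k with
    | zero => intro _; simpa using hinit
    | succ k ih =>
      intro hk
      obtain ⟨ih1, ih2⟩ := ih (by omega)
      rw [Function.iterate_succ_apply']
      set ζ := (rk.step (hbField g) h)^[k] (0, 0, 1) with hζ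
      constructor
      · rw [step_time g (hrk.sum_b hs), ih1]
        push_cast
        ring
      · have hkN : (k : ℝ) * (1 / (2 * N)) ≤ 1 / 2 := by
          have : (k : ℝ) ≤ N := by exact_mod_cast (by omega : k ≤ N)
          rw [mul_one_div, div_le_div_iff₀ (by positivity) (by norm_num)]
          linarith
        have hstep := H E φ g R m ys α ζ.2.2 e h ζ.1 ζ.2.1 hφ hα hR hακ
          (by rw [ih1]; nlinarith [Nat.cast_nonneg (α := ℝ) k]) he (ih2.trans (by linarith))
          hreg hh0 (hηc.trans (min_le_left _ _))
        refine hstep.trans ?_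
        push_cast
        have : lyap φ m ys (ζ.1, ζ.2.1, ζ.2.2) ≤ e - 1 + k * (1 / (2 * N)) := ih2
        linarith
  obtain ⟨h1, h2⟩ := hind N le_rfl
  refine ⟨h1, h2.trans ?_⟩
  have : (N : ℝ) * (1 / (2 * N)) = 1 / 2 := by field_simp
  linarith

end energy

/-! ### The distributed algorithm as an image of the dual one -/

section distributed

variable {n p : ℕ} (G : SimpleGraph (Fin n)) [DecidableRel G.Adj] {f : Fin n → Loc p → ℝ} {μ : ℝ}

/-- The states of the agents that correspond to a state of the dual system. -/
def agentMap : Stk n p × Stk n p × ℝ →ₗ[ℝ] Fin n → Loc p × Loc p × ℝ :=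
  LinearMap.pi fun i => LinearMap.prodMap ((blockₗ i).comp (sqrtLap p G : Stk n p →ₗ[ℝ] Stk n p))
    (LinearMap.prodMap ((blockₗ i).comp (sqrtLap p G : Stk n p →ₗ[ℝ] Stk n p)) LinearMap.id)

lemma agentMap_apply (ζ : Stk n p × Stk n p × ℝ) (i : Fin n) :
    agentMap G ζ i = (block (sqrtLap p G ζ.1) i, block (sqrtLap p G ζ.2.1) i, ζ.2.2) := rfl

lemma agentField_agentMap (hf : ∀ i, StrongConvexOn Set.univ μ (f i)) (hμ : 0 < μ)
    (ζ : Stk n p × Stk n p × ℝ) :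
    agentField G f (agentMap G ζ) = agentMap G (dualField G f ζ) := by
  funext i
  rw [agentMap_apply]
  refine Prod.ext ?_ rfl
  simp only [agentField, agentMap_apply, dualField, map_sub, map_neg, map_smul, block_sub,
    block_neg, block_smul, sqrtLap_sqrtLap, block_lapOp, block_xStar hf hμ]

lemma algIter_eq {S : ℕ} (rk : ExplicitRK S) (hf : ∀ i, StrongConvexOn Set.univ μ (f i))
    (hμ : 0 < μ) (h : ℝ) (N : ℕ) : algIter G f rk h N = agentMap G (dualIter G f rk h N) := by
  induction N with
  | zero =>
    funext i
    change ((0, 0, 1) : Loc p × Loc p × ℝ) = agentMap G (0, 0, 1) i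
    rw [agentMap_apply]
    simp only [map_zero]
    rfl
  | succ N ih =>
    rw [algIter, Function.iterate_succ_apply', dualIter, Function.iterate_succ_apply']
    change rk.step (agentField G f) h (algIter G f rk h N)
      = agentMap G (rk.step (dualField G f) h (dualIter G f rk h N))
    rw [ih]
    exact (rk.map_step (T := agentMap G) (l := agentMap G) (map_add _)
      (fun z => by rw [agentField_agentMap G hf hμ]) _).symm

end distributed

/-! ### The dual problem -/

section problem

variable {n p : ℕ} {G : SimpleGraph (Fin n)} [DecidableRel G.Adj] {f : Fin n → Loc p → ℝ}
  {μ : ℝ} {xs : Loc p}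

lemma iInf_ker (hG : G.Connected) (hxs : ∀ x : Loc p, ∑ i, f i xs ≤ ∑ i, f i x) :
    (⨅ x : {x : Stk n p // Matrix.toEuclideanCLM (𝕜 := ℝ) (bigLap p G) x = 0}, F f x)
      = F f (consensus n xs) := by
  have hle : ∀ x : {x : Stk n p // Matrix.toEuclideanCLM (𝕜 := ℝ) (bigLap p G) x = 0},
      F f (consensus n xs) ≤ F f x := by
    rintro ⟨x, hx⟩
    obtain ⟨u, rfl⟩ := (lapOp_eq_zero_iff G hG x).1 hx
    exact hxs u
  refine le_antisymm ?_ ?_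
  · exact ciInf_le ⟨_, by rintro _ ⟨x, rfl⟩; exact hle x⟩
      (⟨consensus n xs, lapOp_consensus G hG xs⟩ :
        {x : Stk n p // Matrix.toEuclideanCLM (𝕜 := ℝ) (bigLap p G) x = 0})
  · have : Nonempty {x : Stk n p // Matrix.toEuclideanCLM (𝕜 := ℝ) (bigLap p G) x = 0} :=
      ⟨⟨consensus n xs, lapOp_consensus G hG xs⟩⟩
    exact le_ciInf hle

/-- At the optimal consensus point, the gradient of `F` is orthogonal to the consensus vectors. -/
lemma inner_gradient_consensus (hxs : ∀ x : Loc p, ∑ i, f i xs ≤ ∑ i, f i x)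
    (hd : DifferentiableAt ℝ (F f) (consensus n xs)) (u : Loc p) :
    ⟪gradient (F f) (consensus n xs), consensus n u⟫_ℝ = 0 := by
  have hline : HasDerivAt (fun t : ℝ => F f (consensus n xs + t • consensus n u))
      ⟪gradient (F f) (consensus n xs), consensus n u⟫_ℝ 0 := by
    have h1 : HasFDerivAt (F f) (fderiv ℝ (F f) (consensus n xs))
        (consensus n xs + (0 : ℝ) • consensus n u) := by
      simpa using hd.hasFDerivAt
    have h2 : HasDerivAt (fun t : ℝ => consensus n xs + t • consensus n u) (consensus n u) 0 := by
      simpa using ((hasDerivAt_id (0 : ℝ)).smul_const (consensus n u)).const_add (consensus n xs)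
    have := h1.comp_hasDerivAt (0 : ℝ) h2
    rwa [gradient, InnerProductSpace.toDual_symm_apply]
  have hmin : IsLocalMin (fun t : ℝ => F f (consensus n xs + t • consensus n u)) 0 := by
    refine Filter.Eventually.of_forall fun t => ?_
    simp only [zero_smul, add_zero]
    exact hxs (xs + t • u)
  exact hmin.hasDerivAt_eq_zero hline

section

variable (hf : ∀ i, StrongConvexOn Set.univ μ (f i)) (hμ : 0 < μ)
include hf hμ

lemma iInf_F : (⨅ x : Stk n p, F f x) = -dual G f 0 := by
  have h := argmaxConj_spec (F_strongConvexOn hf) hμ (0 : Stk n p)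
  simp only [inner_zero_left, zero_sub, neg_le_neg_iff] at h
  rw [dual_eq G hf hμ, map_zero, conjVal, inner_zero_left, zero_sub, neg_neg]
  exact le_antisymm (ciInf_le ⟨_, by rintro _ ⟨x, rfl⟩; exact h x⟩ _) (le_ciInf h)

lemma dual_ge (hG : G.Connected) (xs : Loc p) (y : Stk n p) :
    -F f (consensus n xs) ≤ dual G f y := by
  have := argmaxConj_spec (F_strongConvexOn hf) hμ (sqrtLap p G y) (consensus n xs)
  rw [sqrtLap_inner, sqrtLap_consensus G hG, inner_zero_right, zero_sub] at this
  rwa [dual_eq G hf hμ]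

/-- The distance of the primal point to the solution is controlled by the dual gap. -/
lemma norm_xStar_sub_sq_le (hG : G.Connected) (xs : Loc p) (y : Stk n p) :
    μ / 2 * ‖xStar f (sqrtLap p G y) - consensus n xs‖ ^ 2
      ≤ dual G f y - -F f (consensus n xs) := by
  have := argmaxConj_strong (F_strongConvexOn hf) hμ (sqrtLap p G y) (consensus n xs)
  rw [inner_sub_right, sqrtLap_inner, sqrtLap_consensus G hG, inner_zero_right,
    norm_sub_rev] at this
  rw [dual_eq G hf hμ, conjVal, xStar]
  linarith

/-- The primal gap is at most `⟨√𝐋 y, 𝐱⟩`, since `√𝐋 y` is a subgradient of `F` at `𝐱`. -/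
lemma primal_gap_le (hG : G.Connected) (xs : Loc p) (y : Stk n p) :
    F f (xStar f (sqrtLap p G y)) - F f (consensus n xs)
      ≤ ‖y‖ * ‖sqrtLap p G (xStar f (sqrtLap p G y))‖ := by
  have := argmaxConj_spec (F_strongConvexOn hf) hμ (sqrtLap p G y) (consensus n xs)
  rw [sqrtLap_inner, sqrtLap_inner, sqrtLap_consensus G hG, inner_zero_right, zero_sub] at this
  have h2 := real_inner_le_norm y (sqrtLap p G (xStar f (sqrtLap p G y)))
  rw [xStar] at *
  linarith

lemma dualGrad_lip (y y' : Stk n p) :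
    ‖dualGrad G f y' - dualGrad G f y‖ ≤ lamMax p G / μ * ‖y' - y‖ := by
  rcases (sq_nonneg ‖y' - y‖).eq_or_lt with h0 | h0
  · have : y' = y := sub_eq_zero.1 (norm_eq_zero.1 (pow_eq_zero_iff two_ne_zero |>.1 h0.symm))
    simp [this]
  have hl0 : 0 ≤ lamMax p G := by
    by_contra hneg
    have := (sq_nonneg _).trans (norm_sqrtLap_sq_le G (y' - y))
    nlinarith
  have hs : ∀ w : Stk n p, ‖sqrtLap p G w‖ ≤ √(lamMax p G) * ‖w‖ := by
    intro w
    refine (abs_le_of_sq_le_sq' (a := ‖sqrtLap p G w‖) ?_ (by positivity)).2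
    rw [mul_pow, Real.sq_sqrt hl0]
    exact norm_sqrtLap_sq_le G w
  have h1 := argmaxConj_lipschitz (F_strongConvexOn hf) hμ (sqrtLap p G y) (sqrtLap p G y')
  rw [← map_sub] at h1
  rw [dualGrad, dualGrad, ← map_sub]
  calc _ ≤ √(lamMax p G) * ‖xStar f (sqrtLap p G y') - xStar f (sqrtLap p G y)‖ := hs _
    _ ≤ √(lamMax p G) * (√(lamMax p G) * ‖y' - y‖ / μ) := by
        gcongr
        exact h1.trans (div_le_div_of_nonneg_right (hs _) hμ.le)
    _ = √(lamMax p G) * √(lamMax p G) / μ * ‖y' - y‖ := by ring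
    _ = _ := by rw [Real.mul_self_sqrt hl0]

end

/-- The hypotheses on a problem, other than the Lipschitz condition on the `f i`. -/
structure IsProblem (G : SimpleGraph (Fin n)) [DecidableRel G.Adj] (f : Fin n → Loc p → ℝ) (μ : ℝ)
    (xs : Loc p) (s : ℕ) : Prop where
  two_le : 2 ≤ n
  one_le : 1 ≤ p
  connected : G.Connected
  pos : 0 < μ
  strong : ∀ i, StrongConvexOn Set.univ μ (f i)
  min : ∀ x : Loc p, ∑ i, f i xs ≤ ∑ i, f i x
  smooth : ContDiffOn ℝ ((s + 2 : ℕ) : WithTop ℕ∞) (F f) (setB G f μ xs)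

namespace IsProblem

variable {s : ℕ} (hP : IsProblem G f μ xs s)
include hP

lemma lamMin_pos : 0 < lamMin p G := HeavyBall.lamMin_pos G hP.connected hP.two_le hP.one_le

lemma lamMax_pos : 0 < lamMax p G :=
  hP.lamMin_pos.trans_le (lamMin_le_lamMax G hP.connected hP.two_le hP.one_le)

lemma energy_eq : energy G f xs = Real.exp 1 * (‖gradient (F f) (consensus n xs)‖ ^ 2 / lamMin p G
    + (dual G f 0 - -F f (consensus n xs))) + 1 := by
  rw [energy, iInf_ker hP.connected hP.min, iInf_F (G := G) hP.strong hP.pos]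
  ring

/-- The initial energy lies below the threshold by one. -/
lemma initial_le : ‖gradient (F f) (consensus n xs)‖ ^ 2 / lamMin p G
    + (dual G f 0 - -F f (consensus n xs)) ≤ energy G f xs - 1 := by
  have h1 := dual_ge (G := G) hP.strong hP.pos hP.connected xs 0
  have h2 := hP.lamMin_pos
  have h3 : 0 ≤ ‖gradient (F f) (consensus n xs)‖ ^ 2 / lamMin p G := by positivity
  have h4 : 1 ≤ Real.exp 1 := Real.one_le_exp zero_le_one
  rw [hP.energy_eq]
  nlinarith

lemma one_le_energy : 1 ≤ energy G f xs := by
  have h1 := dual_ge (G := G) hP.strong hP.pos hP.connected xs 0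
  have h2 := hP.lamMin_pos
  have h3 : 0 ≤ ‖gradient (F f) (consensus n xs)‖ ^ 2 / lamMin p G := by positivity
  linarith [hP.initial_le]

lemma radius_pos : 0 < radius G f μ xs := by
  have h1 := hP.one_le_energy
  have h2 := hP.lamMax_pos
  have h3 := hP.pos
  rw [radius]
  positivity

lemma differentiableAt : DifferentiableAt ℝ (F f) (consensus n xs) :=
  (hP.smooth.contDiffAt (Metric.closedBall_mem_nhds _ hP.radius_pos)).differentiableAt (by simp)

/-- A dual solution of small norm. -/
lemma exists_dual_solution : ∃ ys : Stk n p,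
    sqrtLap p G ys = gradient (F f) (consensus n xs) ∧
      ‖ys‖ ^ 2 ≤ ‖gradient (F f) (consensus n xs)‖ ^ 2 / lamMin p G :=
  exists_sqrtLap_eq G hP.connected hP.two_le hP.one_le
    fun u => inner_gradient_consensus hP.min hP.differentiableAt u

lemma xStar_gradient : xStar f (gradient (F f) (consensus n xs)) = consensus n xs :=
  argmaxConj_gradient (F_strongConvexOn hP.strong) hP.pos hP.differentiableAt

lemma smoothConvex {ys : Stk n p} (hys : sqrtLap p G ys = gradient (F f) (consensus n xs)) :
    SmoothConvex (dual G f) (dualGrad G f) (lamMax p G / μ) (-F f (consensus n xs)) ys where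
  lower := dual_lower G hP.strong hP.pos
  upper := dual_upper G hP.strong hP.pos
  lip := dualGrad_lip hP.strong hP.pos
  ge := dual_ge hP.strong hP.pos hP.connected xs
  le := by
    have h := hP.xStar_gradient
    rw [xStar] at h
    rw [dual_eq G hP.strong hP.pos, hys, conjVal, h,
      inner_gradient_consensus hP.min hP.differentiableAt, zero_sub]

lemma norm_xStar_lt {ys : Stk n p} (hys : sqrtLap p G ys = gradient (F f) (consensus n xs))
    {y : Stk n p} (hy : ‖y - ys‖ ^ 2 < 2 * energy G f xs) :
    ‖xStar f (sqrtLap p G y) - consensus n xs‖ < radius G f μ xs := by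
  have h1 := argmaxConj_lipschitz (F_strongConvexOn hP.strong) hP.pos (sqrtLap p G ys)
    (sqrtLap p G y)
  rw [← map_sub] at h1
  have h2 : argmaxConj (F f) (sqrtLap p G ys) = consensus n xs := by
    rw [hys]
    exact hP.xStar_gradient
  rw [h2] at h1
  refine h1.trans_lt ?_
  rw [radius]
  refine div_lt_div_of_pos_right ?_ hP.pos
  refine Real.lt_sqrt_of_sq_lt ((norm_sqrtLap_sq_le G _).trans_lt ?_)
  rw [mul_comm]
  exact mul_lt_mul_of_pos_right hy hP.lamMax_pos

lemma norm_iteratedFDeriv_dual (j : ℕ) (y : Stk n p) :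
    ‖iteratedFDeriv ℝ (j + 1) (dual G f) y‖ = ‖iteratedFDeriv ℝ j (dualGrad G f) y‖ :=
  norm_iteratedFDeriv_of_hasFDerivAt (dual_hasFDerivAt G hP.strong hP.pos) j y

lemma regularGrad {K : ℝ} (hK : Dominates G f s μ xs K) {ys : Stk n p}
    (hys : sqrtLap p G ys = gradient (F f) (consensus n xs)) :
    RegularGrad s (dualGrad G f) ys (energy G f xs) K where
  contDiffOn := by
    obtain ⟨C, hC⟩ := exists_boundedDerivs_dualGrad G hP.strong hP.pos hP.radius_pos hP.smooth
    exact hC.contDiffOn.mono fun y hy => hP.norm_xStar_lt hys hy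
  norm_le j hj2 hj y hy := by
    rw [← hP.norm_iteratedFDeriv_dual]
    exact hK.2.2 (j + 1) (by omega) (by omega) y (hP.norm_xStar_lt hys hy)

lemma exists_dominates : ∃ K : ℝ, Dominates G f s μ xs K := by
  obtain ⟨C, hC⟩ := exists_boundedDerivs_dualGrad G hP.strong hP.pos hP.radius_pos hP.smooth
  refine ⟨max (energy G f xs) (max (μ / lamMax p G) C), le_max_left _ _, ?_, ?_⟩
  · rw [← div_le_iff₀ hP.lamMax_pos]
    exact (le_max_left _ _).trans (le_max_right _ _)
  · intro j hj3 hj y hy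
    obtain ⟨i, rfl⟩ : ∃ i, j = i + 1 := ⟨j - 1, by omega⟩
    rw [hP.norm_iteratedFDeriv_dual]
    exact (hC.norm_le i (by omega) y hy).trans ((le_max_right _ _).trans (le_max_right _ _))

/-- The Lipschitz constant cannot be small: a strongly convex function varies by at least `μ ρ² / 2`
on a ball of radius `ρ`. -/
lemma lamMin_le_lipschitz {M : ℝ}
    (hM : ∀ i, ∀ x ∈ locB G f μ xs, ∀ y ∈ locB G f μ xs, |f i y - f i x| ≤ M * ‖y - x‖) :
    0 ≤ M ∧ lamMin p G ≤ 2 * M ^ 2 := by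
  set ρ := radius G f μ xs with hρ
  have hρ0 : 0 < ρ := hP.radius_pos
  have hμ := hP.pos
  have hn : 0 < n := by have := hP.two_le; omega
  set i : Fin n := ⟨0, hn⟩
  set u : Loc p := EuclideanSpace.single ⟨0, hP.one_le⟩ (1 : ℝ) with hu
  have hun : ‖u‖ = 1 := by simp [hu]
  have hρu : ‖ρ • u‖ = ρ := by rw [norm_smul, hun, mul_one, Real.norm_of_nonneg hρ0.le]
  have h0 : xs ∈ locB G f μ xs := Metric.mem_closedBall_self hρ0.le
  have h1 : xs + ρ • u ∈ locB G f μ xs := by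
    rw [locB, mem_closedBall_iff_norm, add_sub_cancel_left, hρu]
  have h2 : xs - ρ • u ∈ locB G f μ xs := by
    rw [locB, mem_closedBall_iff_norm, sub_sub_cancel_left, norm_neg, hρu]
  have a1 := (le_abs_self _).trans (hM i xs h0 _ h1)
  have a2 := (le_abs_self _).trans (hM i xs h0 _ h2)
  rw [add_sub_cancel_left, hρu] at a1
  rw [sub_sub_cancel_left, norm_neg, hρu] at a2
  have a3 := (hP.strong i).2 (Set.mem_univ (xs + ρ • u)) (Set.mem_univ (xs - ρ • u))
    (show (0 : ℝ) ≤ 1 / 2 by norm_num) (show (0 : ℝ) ≤ 1 / 2 by norm_num)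
    (show (1 / 2 : ℝ) + 1 / 2 = 1 by norm_num)
  have e1 : (1 / 2 : ℝ) • (xs + ρ • u) + (1 / 2 : ℝ) • (xs - ρ • u) = xs := by module
  have e2 : xs + ρ • u - (xs - ρ • u) = (2 : ℝ) • (ρ • u) := by module
  rw [e1, e2, norm_smul, hρu] at a3
  simp only [smul_eq_mul, Real.norm_ofNat] at a3
  have hMρ : μ * ρ / 2 ≤ M := by
    refine le_of_mul_le_mul_right ?_ hρ0
    nlinarith
  have hM0 : 0 ≤ M := le_trans (by positivity) hMρ
  refine ⟨hM0, ?_⟩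
  have hsq : (μ * ρ / 2) ^ 2 ≤ M ^ 2 := by gcongr
  have hμρ : (μ * ρ) ^ 2 = 2 * energy G f xs * lamMax p G := by
    have h1 := hP.one_le_energy
    have h2 := hP.lamMax_pos
    rw [hρ, radius, mul_div_cancel₀ _ hμ.ne', Real.sq_sqrt (by positivity)]
  have h3 := lamMin_le_lamMax (p := p) G hP.connected hP.two_le hP.one_le
  nlinarith [hP.one_le_energy, hP.lamMax_pos]

end IsProblem

end problem

/-! ### Convergence rates -/

/-- Decay of the dual gap, with a step size that depends on `K` and `λ_max / μ` only. -/
lemma exists_dual_gap_le {s S : ℕ} {rk : ExplicitRK S} (hrk : rk.HasOrder s) (hs : 1 ≤ s) {K : ℝ}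
    (hK : 1 ≤ K) :
    ∃ c : ℝ, 0 < c ∧ ∀ (n p : ℕ) (G : SimpleGraph (Fin n)) [DecidableRel G.Adj]
      (f : Fin n → Loc p → ℝ) (μ : ℝ) (xs : Loc p), IsProblem G f μ xs s →
      Dominates G f s μ xs K → ∀ N : ℕ, 1 ≤ N → ∀ h : ℝ,
      h = c / √(lamMax p G / μ) / (N : ℝ) ^ ((1 : ℝ) / ((s : ℝ) + 1)) →
      dual G f (dualIter G f rk h N).2.1 - -F f (consensus n xs)
          ≤ K * (lamMax p G / μ) * ((N : ℝ) ^ (-(s : ℝ) / ((s : ℝ) + 1))) ^ 2 / c ^ 2 ∧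
        ‖(dualIter G f rk h N).2.1‖ ≤ (√2 + 1) * √K := by
  have hK0 : (0 : ℝ) ≤ K := by linarith
  obtain ⟨c, hc, H⟩ := exists_lyap_iterate_le hrk hs (κ := √K) (Real.one_le_sqrt.2 hK)
  refine ⟨c, hc, fun n p G _ f μ xs hP hdom N hN h hh => ?_⟩
  have hμ := hP.pos
  have hlam := hP.lamMax_pos
  set R := lamMax p G / μ with hR
  have hR0 : 0 < R := div_pos hlam hμ
  have hKR : 1 ≤ R * K := by
    rw [hR, div_mul_eq_mul_div, one_le_div hμ, mul_comm]
    exact hdom.2.1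
  obtain ⟨ys, hys, hysn⟩ := hP.exists_dual_solution
  have hφ := hP.smoothConvex hys
  have hinit : lyap (dual G f) (-F f (consensus n xs)) ys (0, 0, 1) ≤ energy G f xs - 1 := by
    refine le_trans (le_of_eq ?_) ((add_le_add_left hysn _).trans hP.initial_le)
    simp [lyap]
  obtain ⟨ht, hl⟩ := H (Stk n p) (dual G f) (dualGrad G f) R _ ys (√R) (energy G f xs) hφ
    (Real.sqrt_pos.2 hR0) (Real.sq_sqrt hR0.le).symm
    (by rw [← Real.sqrt_mul hR0.le]; exact Real.one_le_sqrt.2 hKR)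
    (by rw [Real.sq_sqrt hK0]; exact hdom.1)
    (by rw [Real.sq_sqrt hK0]; exact hP.regularGrad hdom hys) hinit N hN h hh
  change (dualIter G f rk h N).2.2 = _ at ht
  change lyap _ _ _ (dualIter G f rk h N) ≤ _ at hl
  set ζ := dualIter G f rk h N
  have hlK := hl.trans hdom.1
  constructor
  · have hgap := lyap_gap (dual G f) (-F f (consensus n xs)) ys ζ
    have hgap0 := hφ.gap_nonneg ζ.2.1
    set w := (N : ℝ) ^ (-(s : ℝ) / ((s : ℝ) + 1)) with hw
    have hN0 : (0 : ℝ) < N := by exact_mod_cast hN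
    have hw0 : 0 < w := by positivity
    have hα0 : 0 < √R := Real.sqrt_pos.2 hR0
    have hNh : N * h * w = c / √R := by
      have hs1 : (s : ℝ) + 1 ≠ 0 := by positivity
      have e : (N : ℝ) * w = (N : ℝ) ^ ((1 : ℝ) / ((s : ℝ) + 1)) := by
        rw [hw, ← Real.rpow_one_add' hN0.le]
        · congr 1
          field_simp
          ring
        · have : (1 : ℝ) + -(s : ℝ) / ((s : ℝ) + 1) = 1 / ((s : ℝ) + 1) := by
            field_simp
            ring
          rw [this]
          positivity
      rw [hh, mul_right_comm, e, mul_div_cancel₀ _ (by positivity)]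
    have hct : c ≤ ζ.2.2 * w * √R := by
      rw [← div_le_iff₀ hα0, ← hNh, ht]
      gcongr
      linarith
    have hct2 : c ^ 2 ≤ ζ.2.2 ^ 2 * w ^ 2 * R := by
      calc c ^ 2 ≤ (ζ.2.2 * w * √R) ^ 2 := by gcongr
        _ = ζ.2.2 ^ 2 * w ^ 2 * √R ^ 2 := by ring
        _ = _ := by rw [Real.sq_sqrt hR0.le]
    rw [le_div_iff₀ (by positivity)]
    calc _ ≤ (dual G f ζ.2.1 - -F f (consensus n xs)) * (ζ.2.2 ^ 2 * w ^ 2 * R) := by gcongr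
      _ = ζ.2.2 ^ 2 * (dual G f ζ.2.1 - -F f (consensus n xs)) * (R * w ^ 2) := by ring
      _ ≤ K * (R * w ^ 2) := by gcongr; exact hgap.trans hlK
      _ = _ := by ring
  · have h1 : ‖ζ.2.1 - ys‖ ≤ √2 * √K := by
      rw [← Real.sqrt_mul zero_le_two]
      refine Real.le_sqrt_of_sq_le ((hφ.lyap_y ζ).trans ?_)
      linarith
    have h2 : ‖ys‖ ≤ √K := by
      refine Real.le_sqrt_of_sq_le ?_
      have h3 := dual_ge (G := G) hP.strong hP.pos hP.connected xs 0
      linarith [hP.initial_le, hdom.1]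
    have h3 := norm_le_norm_add_norm_sub ys ζ.2.1
    rw [norm_sub_rev] at h3
    linarith

/-- `λ_max / μ` is dominated by `M` times the square root that appears in the rate of the primal
gap, because `λ⁺_min ≤ 2 M²`. -/
lemma le_sqrt_mul_lipschitz {n S K μ lam lmin M : ℝ} (hn : 0 < n) (hS : 1 ≤ S) (hK : 1 ≤ K)
    (hμ : 0 < μ) (hlam : 0 < lam) (hKR : 1 ≤ lam / μ * K) (hmin : 0 < lmin) (hM : 0 ≤ M)
    (hle : lmin ≤ 2 * M ^ 2) :
    lam / μ ≤ 2 * K * n * (√(S * lam ^ 3 / (n ^ 2 * μ ^ 3 * lmin)) * M) := by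
  have hX : 0 ≤ S * lam ^ 3 / (n ^ 2 * μ ^ 3 * lmin) := by positivity
  refine (abs_le_of_sq_le_sq' (a := lam / μ) ?_ (by positivity)).2
  have h1 : 1 ≤ 2 * M ^ 2 / lmin := (one_le_div hmin).2 hle
  have hR0 : 0 < lam / μ := by positivity
  have e : (2 * K * n * (√(S * lam ^ 3 / (n ^ 2 * μ ^ 3 * lmin)) * M)) ^ 2
      = 2 * K * S * (lam / μ) ^ 2 * (lam / μ * K) * (2 * M ^ 2 / lmin) := by
    rw [mul_pow, mul_pow (√_), Real.sq_sqrt hX]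
    field_simp
  rw [e]
  have h2 : 1 ≤ 2 * K * S := by nlinarith
  calc (lam / μ) ^ 2 = 1 * (lam / μ) ^ 2 * 1 * 1 := by ring
    _ ≤ 2 * K * S * (lam / μ) ^ 2 * (lam / μ * K) * (2 * M ^ 2 / lmin) := by gcongr

end HeavyBall

end

open HeavyBall in
theorem theorem1 (s S : ℕ) (hs : 1 ≤ s) (rk : ExplicitRK S) (hrk : rk.HasOrder s) :
    ∃ (C : ℝ → ℝ) (h₀ : ℝ → ℝ → ℝ → ℝ),
      (∀ K μ lam : ℝ, 0 < K → 0 < μ → 0 < lam → 0 < h₀ K μ lam) ∧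
      ∀ (n p : ℕ) (_ : 2 ≤ n) (_ : 1 ≤ p) (G : SimpleGraph (Fin n)) [DecidableRel G.Adj]
        (_ : G.Connected) (f : Fin n → Loc p → ℝ) (μ M : ℝ) (_ : 0 < μ)
        (_ : ∀ i, StrongConvexOn Set.univ μ (f i))
        (xs : Loc p) (_ : ∀ x : Loc p, ∑ i, f i xs ≤ ∑ i, f i x)
        (_ : ∀ i, ∀ x ∈ locB G f μ xs, ∀ y ∈ locB G f μ xs, |f i y - f i x| ≤ M * ‖y - x‖)
        (_ : ContDiffOn ℝ ((s + 2 : ℕ) : WithTop ℕ∞) (F f) (setB G f μ xs)),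
        (∃ K : ℝ, Dominates G f s μ xs K) ∧
        ∀ K : ℝ, Dominates G f s μ xs K → ∀ N : ℕ, 1 ≤ N →
          let h : ℝ := h₀ K μ (lamMax p G) / (N : ℝ) ^ ((1 : ℝ) / ((s : ℝ) + 1))
          let vN : Stk n p := (dualIter G f rk h N).1
          let yN : Stk n p := (dualIter G f rk h N).2.1
          let tN : ℝ := (dualIter G f rk h N).2.2
          let xN : Stk n p := xStar f (sqrtLap p G yN)
          (∀ i, algIter G f rk h N i
            = (block (sqrtLap p G vN) i, block (sqrtLap p G yN) i, tN)) ∧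
          ‖sqrtLap p G xN‖ ^ 2
            ≤ C K * (lamMax p G ^ 3 / μ ^ 3 * (S : ℝ)
              * (N : ℝ) ^ (-2 * (s : ℝ) / ((s : ℝ) + 1))) ∧
          1 / (n : ℝ) * ‖xN - consensus n xs‖ ^ 2
            ≤ C K * (lamMax p G ^ 2 / ((n : ℝ) * μ ^ 3) * (S : ℝ)
              * (N : ℝ) ^ (-2 * (s : ℝ) / ((s : ℝ) + 1))) ∧
          1 / (n : ℝ) * (F f xN - F f (consensus n xs))
            ≤ C K * (√((S : ℝ) * lamMax p G ^ 3 / ((n : ℝ) ^ 2 * μ ^ 3 * lamMin p G)) * M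
              * (N : ℝ) ^ (-(s : ℝ) / ((s : ℝ) + 1))) := by
  classical
  choose! c hc H using fun (K : ℝ) (hK : 1 ≤ K) => exists_dual_gap_le hrk hs hK
  have hSpos : (1 : ℝ) ≤ S := by exact_mod_cast hrk.stages_pos hs
  -- For `K < 1` the values do not matter, since `1 ≤ ℰ ≤ K` whenever `K` dominates a problem.
  refine ⟨fun K => 10 * K ^ 2 / c K + 2 * K ^ 2 / c K ^ 2,
    fun K μ lam => (if 1 ≤ K then c K else 1) / √(lam / μ), ?_, ?_⟩
  · intro K μ lam hK hμ hlam
    have : 0 < if 1 ≤ K then c K else 1 := by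
      split_ifs with h
      exacts [hc K h, one_pos]
    positivity
  intro n p hn hp G _ hG f μ M hμ hf xs hxs hM hsm
  have hP : IsProblem G f μ xs s := ⟨hn, hp, hG, hμ, hf, hxs, hsm⟩
  refine ⟨hP.exists_dominates, fun K hK N hN => ?_⟩
  intro h vN yN tN xN
  have hK1 : 1 ≤ K := hP.one_le_energy.trans hK.1
  have hh : h = c K / √(lamMax p G / μ) / (N : ℝ) ^ ((1 : ℝ) / ((s : ℝ) + 1)) := by
    simp only [h, if_pos hK1]
  obtain ⟨hgap, hy⟩ := H K hK1 n p G f μ xs hP hK N hN h hh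
  change dual G f yN - _ ≤ _ at hgap
  change ‖yN‖ ≤ _ at hy
  have hc0 := hc K hK1
  set c := c K
  have hlam := hP.lamMax_pos
  set lam := lamMax p G
  set w := (N : ℝ) ^ (-(s : ℝ) / ((s : ℝ) + 1)) with hw
  have hw0 : 0 ≤ w := by positivity
  have hw2 : (N : ℝ) ^ (-2 * (s : ℝ) / ((s : ℝ) + 1)) = w ^ 2 := by
    rw [hw, ← Real.rpow_natCast, ← Real.rpow_mul (Nat.cast_nonneg N)]
    congr 1
    push_cast
    ring
  have hKR : 1 ≤ lam / μ * K := by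
    rw [div_mul_eq_mul_div, one_le_div hμ, mul_comm]
    exact hK.2.1
  have hR0 : 0 < lam / μ := div_pos hlam hμ
  have hK0 : 0 < K := by linarith
  have hn0 : (0 : ℝ) < n := by exact_mod_cast (show 0 < n by omega)
  have hKRS : 1 ≤ lam / μ * K * S := one_le_mul_of_one_le_of_one_le hKR hSpos
  obtain ⟨ys, hys, -⟩ := hP.exists_dual_solution
  have hgrad : ‖sqrtLap p G xN‖ ^ 2 ≤ 2 * K * (lam / μ) ^ 2 * w ^ 2 / c ^ 2 := by
    refine ((hP.smoothConvex hys).norm_sq_le hR0 yN).trans ?_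
    calc _ ≤ 2 * (lam / μ) * (K * (lam / μ) * w ^ 2 / c ^ 2) := by gcongr
      _ = _ := by ring
  refine ⟨fun i => ?_, ?_, ?_, ?_⟩
  · rw [algIter_eq G rk hf hμ, agentMap_apply]
  · rw [hw2]
    calc _ ≤ 2 * K * (lam / μ) ^ 2 * w ^ 2 / c ^ 2 * 1 := by rwa [mul_one]
      _ ≤ 2 * K * (lam / μ) ^ 2 * w ^ 2 / c ^ 2 * (lam / μ * K * S) := by gcongr
      _ = 2 * K ^ 2 / c ^ 2 * (lam ^ 3 / μ ^ 3 * S * w ^ 2) := by field_simp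
      _ ≤ _ := by
        gcongr
        exact le_add_of_nonneg_left (by positivity)
  · rw [hw2]
    have hd := norm_xStar_sub_sq_le (G := G) hf hμ hG xs yN
    change μ / 2 * ‖xN - consensus n xs‖ ^ 2 ≤ _ at hd
    have hd2 : ‖xN - consensus n xs‖ ^ 2 ≤ 2 / μ * (K * (lam / μ) * w ^ 2 / c ^ 2) := by
      rw [div_mul_eq_mul_div, le_div_iff₀ hμ]
      linarith
    calc _ ≤ 1 / (n : ℝ) * (2 / μ * (K * (lam / μ) * w ^ 2 / c ^ 2)) * 1 := by
          rw [mul_one]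
          gcongr
      _ ≤ 1 / (n : ℝ) * (2 / μ * (K * (lam / μ) * w ^ 2 / c ^ 2)) * (lam / μ * K * S) := by
          gcongr
      _ = 2 * K ^ 2 / c ^ 2 * (lam ^ 2 / (n * μ ^ 3) * S * w ^ 2) := by field_simp
      _ ≤ _ := by
        gcongr
        exact le_add_of_nonneg_left (by positivity)
  · obtain ⟨hM0, hMle⟩ := hP.lamMin_le_lipschitz hM
    have hX := le_sqrt_mul_lipschitz hn0 hSpos hK1 hμ hlam hKR hP.lamMin_pos hM0 hMle
    set X := √((S : ℝ) * lam ^ 3 / ((n : ℝ) ^ 2 * μ ^ 3 * lamMin p G)) * M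
    have hX0 : 0 ≤ X := by positivity
    have hg : ‖sqrtLap p G xN‖ ≤ √2 * √K * (lam / μ) * w / c := by
      refine (abs_le_of_sq_le_sq' (a := ‖sqrtLap p G xN‖) (hgrad.trans_eq ?_) (by positivity)).2
      have e : (√2 * √K * (lam / μ) * w / c) ^ 2
          = √2 ^ 2 * √K ^ 2 * (lam / μ) ^ 2 * w ^ 2 / c ^ 2 := by ring
      rw [e, Real.sq_sqrt zero_le_two, Real.sq_sqrt hK0.le]
    have hsqrt2 : (√2 + 1) * √2 ≤ 5 := by
      nlinarith [Real.sq_sqrt (zero_le_two (α := ℝ)), Real.sqrt_nonneg 2]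
    calc _ ≤ 1 / (n : ℝ) * (((√2 + 1) * √K) * (√2 * √K * (lam / μ) * w / c)) := by
          gcongr
          refine (primal_gap_le (G := G) hf hμ hG xs yN).trans ?_
          gcongr
      _ = 1 / (n : ℝ) * (((√2 + 1) * √2) * (√K * √K) * (lam / μ) * w / c) := by ring
      _ ≤ 1 / (n : ℝ) * (5 * K * (2 * K * n * X) * w / c) := by
          rw [Real.mul_self_sqrt hK0.le]
          gcongr
      _ = 10 * K ^ 2 / c * (X * w) := by field_simp; ring
      _ ≤ _ := by
        gcongr
        exact le_add_of_nonneg_right (by positivity)
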